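/- Let $K$ be an algebraically closed field of characteristic $0$, $S=K[Y_1,Y_2,Y_3,Y_4]$ with the standard grading, $f_4=Y_1^3+Y_2^3+Y_3^3+Y_4^3$ and $R_4=S/(f_4)$. For $a,b\in K$ with $a^3=b^3=-1$ and a permutation $(i\ j\ s)$ of $\{2,3,4\}$ with $i<j$ put $$\varphi_{ij}(a,b)=\begin{pmatrix} Y_1-aY_s & -(Y_i^2+bY_iY_j+b^2Y_j^2)\\ Y_i-bY_j & Y_1^2+aY_1Y_s+a^2Y_s^2\end{pmatrix},\qquad \psi_{ij}(a,b)=\begin{pmatrix} Y_1^2+aY_1Y_s+a^2Y_s^2 & Y_i^2+bY_iY_j+b^2Y_j^2\\ -(Y_i-bY_j) & Y_1-aY_s\end{pmatrix}.$$ For a $2\times 2$ matrix $A$ over $S$, $\operatorname{Coker}A$ denotes the quotient of $R_4^2$ by the submodule generated by the columns of $A$. Grade $\operatorname{Coker}\varphi_{ij}(a,b)$ by giving both generators degree $0$, and $\operatorname{Coker}\psi_{ij}(a,b)$ by giving its generators the degrees $0$ and $1$. A graded maximal Cohen–Macaulay (MCM) $R_4$-module is a nonzero finitely generated $\mathbb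 Z$-graded module $M$ admitting an $M$-regular sequence of length $\dim R_4$ in the ideal $(Y_1,\dots,Y_4)R_4$. "Two-generated" means that the minimal number of generators is $2$; a graded isomorphism is allowed to shift the grading. **Theorem.** For all $a,b$ and $i<j$ as above, $\varphi_{ij}(a,b)\,\psi_{ij}(a,b)=\psi_{ij}(a,b)\,\varphi_{ij}(a,b)=f_4\cdot I_2$. Let $$\mathcal M=\{\operatorname{Coker}\varphi_{ij}(a,b)\},\qquad \mathcal N=\{\operatorname{Coker}\psi_{ij}(a,b)\},$$ where $a,b,i,j$ vary over all these data. All members of $\mathcal M\cup\mathcal N$ are two-generated, non-free, graded MCM $R_4$-modules, and: (i) Every two-generated, non-free, graded MCM $R_4$-module is isomorphic, as a graded module up to a shift, to a member of $\mathcal M\cup\mathcal N$. (ii) The members of $\mathcal M\cup\mathcal N$ are pairwise non-isomorphic, even as ungraded $R_4$-modules: for $(i,j,a,b)\neq(u,v,a',b')$ we have $\operatorname{Coker}\varphi_{ij}(a,b)\not\cong\operatorname{Coker}\varphi_{uv}(a',b')$ and $\operatorname{Coker}\psi_{ij}(a,b)\not\cong\operatorname{Coker}\psi_{uv}(a',b')$,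 and no member of $\mathcal M$ is isomorphic to a member of $\mathcal N$. Moreover, within each of the two families the first Fitting ideals in $R_4$ (generated by the entries of the matrices $\varphi_{ij}(a,b)$, respectively $\psi_{ij}(a,b)$) are pairwise distinct. (iii) The modules of $\mathcal M$ are the first syzygies, and also the duals, of the modules of $\mathcal N$: for all $a,b,i,j$, the module $\operatorname{Coker}\varphi_{ij}(a,b)$ is isomorphic, as a graded module up to a shift, to the kernel of a minimal graded free cover of $\operatorname{Coker}\psi_{ij}(a,b)$ and to $\operatorname{Hom}_{R_4}(\operatorname{Coker}\psi_{ij}(a,b),R_4)$. (iv) All members of $\mathcal M\cup\mathcal N$ have rank one. -/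

import Mathlib

namespace FermatCubic

open MvPolynomial

noncomputable section

/-- The form `Y₁³ + Y₂³ + Y₃³ + Y₄³`; the variable `Y_{k+1}` is `X k`, for `k : Fin 4`. -/
def f4 (K : Type*) [Field K] : MvPolynomial (Fin 4) K :=
  X 0 ^ 3 + X 1 ^ 3 + X 2 ^ 3 + X 3 ^ 3

/-- The hypersurface ring `R₄ = K[Y₁, Y₂, Y₃, Y₄] / (f₄)`. -/
abbrev R4 (K : Type*) [Field K] : Type _ :=
  MvPolynomial (Fin 4) K ⧸ Ideal.span {f4 K}

/-- The projection `K[Y₁, Y₂, Y₃, Y₄] → R₄`. -/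
abbrev toR4 (K : Type*) [Field K] : MvPolynomial (Fin 4) K →+* R4 K :=
  Ideal.Quotient.mk (Ideal.span {f4 K})

/-- The irrelevant maximal ideal `(Y₁, Y₂, Y₃, Y₄)` of `R₄`. -/
def irrelevantIdeal (K : Type*) [Field K] : Ideal (R4 K) :=
  Ideal.span (Set.range fun k : Fin 4 => toR4 K (X k))

/-- The homogeneous component of degree `d` of `R₄`: the classes of the forms of degree `d`
(zero for negative `d`). -/
def homogeneousPart (K : Type*) [Field K] (d : ℤ) : AddSubgroup (R4 K) :=
  if 0 ≤ d then
    (homogeneousSubmodule (Fin 4) K d.toNat).toAddSubgroup.map (toR4 K).toAddMonoidHom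
  else ⊥

/-- The subgroups `ℳ n`, `n ∈ ℤ`, make `M` a graded `R₄`-module:
`M = ⨁ ℳ n` and `(R₄)_d · ℳ n ⊆ ℳ (d + n)`. -/
structure IsGrading {K M : Type*} [Field K] [AddCommGroup M] [Module (R4 K) M]
    (ℳ : ℤ → AddSubgroup M) : Prop where
  isInternal : DirectSum.IsInternal ℳ
  smul_mem : ∀ (d n : ℤ) (r : R4 K) (x : M),
    r ∈ homogeneousPart K d → x ∈ ℳ n → r • x ∈ ℳ (d + n)

/-- `M`, with the grading `ℳ`, is a graded maximal Cohen-Macaulay `R₄`-module: a finitely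
generated graded module whose depth is `dim R₄`, that is, there is an `M`-regular sequence of
length `dim R₄` in the irrelevant ideal (by definition of `IsRegular`, `M` is then nonzero). -/
structure IsGradedMCM {K M : Type*} [Field K] [AddCommGroup M] [Module (R4 K) M]
    (ℳ : ℤ → AddSubgroup M) : Prop where
  isGrading : IsGrading (K := K) ℳ
  finite : Module.Finite (R4 K) M
  depth_eq_dim : ∃ rs : List (R4 K), (∀ r ∈ rs, r ∈ irrelevantIdeal K) ∧
    ((rs.length : ℕ) : WithBot ℕ∞) = ringKrullDim (R4 K) ∧
    RingTheory.Sequence.IsRegular M rs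

/-- Isomorphism of graded `R₄`-modules up to a shift of the grading: there is an `R₄`-linear
isomorphism `M ≃ N` that carries `ℳ n` onto `𝒩 (n + c)` for all `n`, with a fixed `c ∈ ℤ`. -/
def GradedIso {K M N : Type*} [Field K] [AddCommGroup M] [Module (R4 K) M]
    [AddCommGroup N] [Module (R4 K) N]
    (ℳ : ℤ → AddSubgroup M) (𝒩 : ℤ → AddSubgroup N) : Prop :=
  ∃ (c : ℤ) (e : M ≃ₗ[R4 K] N), ∀ (n : ℤ) (x : M), x ∈ ℳ n ↔ e x ∈ 𝒩 (n + c)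

/-- The grading of the free module `R₄ᵐ` in which the `k`-th basis vector has degree `δ k`. -/
def freeGrading (K : Type*) [Field K] {m : ℕ} (δ : Fin m → ℤ) (n : ℤ) :
    AddSubgroup (Fin m → R4 K) :=
  AddSubgroup.pi Set.univ fun k => homogeneousPart K (n - δ k)

/-- The graded module `N` is the first syzygy (up to a shift) of the graded module `M`: it is the
kernel of a minimal graded free cover `π : R₄ᵐ → M`. -/
def IsFirstSyzygy {K M N : Type*} [Field K] [AddCommGroup M] [Module (R4 K) M]
    [AddCommGroup N] [Module (R4 K) N]
    (𝒩 : ℤ → AddSubgroup N) (ℳ : ℤ → AddSubgroup M) : Prop :=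
  ∃ (m : ℕ) (δ : Fin m → ℤ) (π : (Fin m → R4 K) →ₗ[R4 K] M),
    Function.Surjective π ∧ (∀ k, π (Pi.single k 1) ∈ ℳ (δ k)) ∧
    LinearMap.ker π ≤ irrelevantIdeal K • (⊤ : Submodule (R4 K) (Fin m → R4 K)) ∧
    GradedIso (K := K)
      (fun n => (freeGrading K δ n).comap (LinearMap.ker π).subtype.toAddMonoidHom) 𝒩

/-- The grading of the dual `Hom(M, R₄)`: the degree `n` part consists of the homomorphisms that
map `ℳ k` into `(R₄)_{n+k}` for all `k`. -/
def dualGrading {K M : Type*} [Field K] [AddCommGroup M] [Module (R4 K) M]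
    (ℳ : ℤ → AddSubgroup M) (n : ℤ) : AddSubgroup (Module.Dual (R4 K) M) where
  carrier := {h | ∀ (k : ℤ) (x : M), x ∈ ℳ k → h x ∈ homogeneousPart K (n + k)}
  zero_mem' := fun _ _ _ => zero_mem _
  add_mem' := fun hg hh k x hx => add_mem (hg k x hx) (hh k x hx)
  neg_mem' := fun hh k x hx => neg_mem (hh k x hx)

/-- The cokernel, over `R₄`, of a `2 × 2` matrix `A` of polynomials: `R₄²` modulo the submodule
generated by the columns of `A`. -/
abbrev Coker {K : Type*} [Field K] (A : Matrix (Fin 2) (Fin 2) (MvPolynomial (Fin 4) K)) :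
    Type _ :=
  (Fin 2 → R4 K) ⧸ LinearMap.range (A.map (toR4 K)).mulVecLin

/-- The grading of `Coker A` in which the class of the `k`-th basis vector has degree `δ k`. -/
def cokerGrading {K : Type*} [Field K]
    (A : Matrix (Fin 2) (Fin 2) (MvPolynomial (Fin 4) K)) (δ : Fin 2 → ℤ) (n : ℤ) :
    AddSubgroup (Coker A) :=
  (freeGrading K δ n).map (Submodule.mkQ _).toAddMonoidHom

/-- The `k`-th Fitting ideal of the module presented by the matrix `A` with `m` rows (generators):
the ideal generated by the minors of size `m - k`. -/
def fittingIdeal {R : Type*} [CommRing R] {m n : ℕ} (A : Matrix (Fin m) (Fin n) R) (k : ℕ) :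
    Ideal R :=
  Ideal.span (Set.range fun rc : (Fin (m - k) → Fin m) × (Fin (m - k) → Fin n) =>
    (A.submatrix rc.1 rc.2).det)

/-- The data `a, b, i, j, s`: cube roots `a, b` of `-1` in `K`, and a permutation `(i j s)` of the
indices of `Y₂, Y₃, Y₄` with `i < j`. -/
@[ext]
structure Datum (K : Type*) [Field K] where
  a : K
  b : K
  i : Fin 4
  j : Fin 4
  s : Fin 4
  ha : a ^ 3 = -1
  hb : b ^ 3 = -1
  hij : i < j
  perm : ({i, j, s} : Finset (Fin 4)) = {1, 2, 3}

/-- The matrix `φ_ij(a, b)`. -/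
def phi {K : Type*} [Field K] (p : Datum K) : Matrix (Fin 2) (Fin 2) (MvPolynomial (Fin 4) K) :=
  !![X 0 - C p.a * X p.s, -(X p.i ^ 2 + C p.b * X p.i * X p.j + C p.b ^ 2 * X p.j ^ 2);
     X p.i - C p.b * X p.j, X 0 ^ 2 + C p.a * X 0 * X p.s + C p.a ^ 2 * X p.s ^ 2]

/-- The matrix `ψ_ij(a, b)`. -/
def psi {K : Type*} [Field K] (p : Datum K) : Matrix (Fin 2) (Fin 2) (MvPolynomial (Fin 4) K) :=
  !![X 0 ^ 2 + C p.a * X 0 * X p.s + C p.a ^ 2 * X p.s ^ 2,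
      X p.i ^ 2 + C p.b * X p.i * X p.j + C p.b ^ 2 * X p.j ^ 2;
     -(X p.i - C p.b * X p.j), X 0 - C p.a * X p.s]

/-- The grading of `Coker φ_ij(a, b)`: both generators have degree `0`. -/
abbrev phiGrading {K : Type*} [Field K] (p : Datum K) : ℤ → AddSubgroup (Coker (phi p)) :=
  cokerGrading (phi p) ![0, 0]

/-- The grading of `Coker ψ_ij(a, b)`: the generators have degrees `0` and `1`. -/
abbrev psiGrading {K : Type*} [Field K] (p : Datum K) : ℤ → AddSubgroup (Coker (psi p)) :=
  cokerGrading (psi p) ![0, 1]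

end

end FermatCubic

/-! Classification. View a two-generated graded MCM module `M` over the polynomial ring `S` in four
variables. It has depth 3, so its module of relations has depth 4 and is free (the
Auslander–Buchsbaum argument): `M` is the cokernel of a square 2×2 matrix `A` of forms without
constant term (`IsGradedMCM.exists_isPresentation`). Since `f4` kills `M`, `det A` divides `f4 ^ 2`;
as `f4` is prime and `M` is not free, `det A = c * f4` with a constant `c ≠ 0`
(`IsPresentation.exists_det_eq`). No entry of `A` vanishes, and the degrees along either diagonal
add up to 3, so every entry has degree 1 or 2, and the linear entries fill exactly one column (type
`phi`) or one row (type `psi`).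

Expanding the determinant, `f4` lies in the ideal of the two linear entries; these are independent
because `f4` is irreducible, so they cut out a line on the Fermat cubic surface. Parametrizing the
line and comparing coefficients shows that it is one of the lines `Y₁ = a Y_s`, `Y_i = b Y_j`
(`exists_datum_of_vanishing`). A constant change of rows or columns makes the linear entries those
of a `Datum`; comparing determinants then fixes the other two entries up to a constant factor and
one further row or column operation (`IsPresentation.exists_phi`, `IsPresentation.exists_psi`).

Properties of the cokernels. A matrix factorization is exact over `R4` (`IsMF.exact`), which
identifies syzygies and, with transposes, duals. The variables `Y₂, Y₃, Y₄` form a regular sequence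
on the cokernel because `f4` is monic in `Y₁` (`IsMF.smul_mem_imp`). One row of the companion matrix
embeds the cokernel into `R4`, so the rank is one; two generators are needed, so it is not free.

Distinctness. An isomorphism of cokernels lifts to an identity `U A = B V` modulo `f4`. Its linear
part relates the linear entries of the two matrices by constant matrices (`exists_linPart_eq`), so
it preserves their span, and that span determines the `Datum` (`Datum.eq_of_form_mem`). The Fitting
ideals are separated by the same span. -/

namespace FermatCubic

open MvPolynomial

/-! ### Irreducibility of the Fermat cubic. -/

section Prime

/-- Eisenstein's criterion at `p`, where the only coefficients below the leading one are `0, 0, g`.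
-/
theorem prime_X_pow_three_add_C {R : Type*} [CommRing R] [IsDomain R] [UniqueFactorizationMonoid R]
    {p g : R} (hp : Prime p) (h1 : p ∣ g) (h2 : ¬ p ^ 2 ∣ g) :
    Prime ((Polynomial.X : Polynomial R) ^ 3 + Polynomial.C g) := by
  have hm : ((Polynomial.X : Polynomial R) ^ 3 + Polynomial.C g).Monic :=
    Polynomial.monic_X_pow_add_C g (by norm_num)
  have hd : ((Polynomial.X : Polynomial R) ^ 3 + Polynomial.C g).degree = 3 :=
    Polynomial.degree_X_pow_add_C (by norm_num) g
  refine Irreducible.prime (Polynomial.irreducible_of_eisenstein_criterion (P := Ideal.span {p})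
    ((Ideal.span_singleton_prime hp.ne_zero).2 hp) ?_ ?_ ?_ ?_ hm.isPrimitive)
  · rw [hm.leadingCoeff, Ideal.mem_span_singleton]
    exact fun h => hp.not_isUnit (isUnit_of_dvd_one h)
  · intro n hn
    rw [hd] at hn
    have hn3 : n < 3 := by exact_mod_cast hn
    rw [Ideal.mem_span_singleton]
    interval_cases n <;> simp [Polynomial.coeff_X_pow, Polynomial.coeff_C, h1]
  · rw [hd]; norm_num
  · rw [Ideal.span_singleton_pow, Ideal.mem_span_singleton]
    simpa [Polynomial.coeff_X_pow] using h2

theorem prime_X_zero_add_X_one (K : Type*) [Field K] :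
    Prime (X 0 + X 1 : MvPolynomial (Fin 2) K) := by
  rw [← MulEquiv.prime_iff (finSuccEquiv K 1).toMulEquiv]
  have : (finSuccEquiv K 1) (X 0 + X 1) = Polynomial.X - Polynomial.C (-X 0) := by
    rw [map_add, finSuccEquiv_X_zero, show (1 : Fin 2) = Fin.succ 0 from rfl,
      finSuccEquiv_X_succ]
    simp
  change Prime ((finSuccEquiv K 1) (X 0 + X 1))
  rw [this]
  exact Polynomial.prime_X_sub_C _

/-- Eisenstein at the linear factor of `X 0 ^ 3 + X 1 ^ 3`, which is a simple factor because 3 is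
invertible. -/
theorem prime_X_pow_three_sum_fin_three (K : Type*) [Field K] [CharZero K] :
    Prime (X 0 ^ 3 + (X 1 ^ 3 + X 2 ^ 3) : MvPolynomial (Fin 3) K) := by
  rw [← MulEquiv.prime_iff (finSuccEquiv K 2).toMulEquiv]
  have : (finSuccEquiv K 2) (X 0 ^ 3 + (X 1 ^ 3 + X 2 ^ 3)) =
      Polynomial.X ^ 3 + Polynomial.C (X 0 ^ 3 + X 1 ^ 3) := by
    simp only [map_add, map_pow, finSuccEquiv_X_zero]
    rw [show (1 : Fin 3) = Fin.succ 0 from rfl, show (2 : Fin 3) = Fin.succ 1 from rfl,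
      finSuccEquiv_X_succ, finSuccEquiv_X_succ]
  change Prime ((finSuccEquiv K 2) (X 0 ^ 3 + (X 1 ^ 3 + X 2 ^ 3)))
  rw [this]
  have hf : (X 0 ^ 3 + X 1 ^ 3 : MvPolynomial (Fin 2) K) =
      (X 0 + X 1) * (X 0 ^ 2 - X 0 * X 1 + X 1 ^ 2) := by ring
  refine prime_X_pow_three_add_C (prime_X_zero_add_X_one K) ⟨_, hf⟩ ?_
  rw [hf, pow_two, mul_dvd_mul_iff_left (prime_X_zero_add_X_one K).ne_zero]
  rintro ⟨q, hq⟩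
  -- The linear factor vanishes at `(1, -1)`, while the quadratic cofactor takes the value 3.
  have := congrArg (eval ![(1 : K), -1]) hq
  simp at this
  norm_num at this

variable (K : Type*) [Field K] [CharZero K]

/-- Eisenstein once more, with the ternary cubic as both the prime and the constant coefficient. -/
theorem prime_f4 : Prime (f4 K) := by
  rw [← MulEquiv.prime_iff (finSuccEquiv K 3).toMulEquiv]
  have : (finSuccEquiv K 3) (f4 K) =
      Polynomial.X ^ 3 + Polynomial.C (X 0 ^ 3 + (X 1 ^ 3 + X 2 ^ 3)) := by
    simp only [f4, map_add, map_pow, finSuccEquiv_X_zero]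
    rw [show (1 : Fin 4) = Fin.succ 0 from rfl, show (2 : Fin 4) = Fin.succ 1 from rfl,
      show (3 : Fin 4) = Fin.succ 2 from rfl,
      finSuccEquiv_X_succ, finSuccEquiv_X_succ, finSuccEquiv_X_succ]
    ring
  change Prime ((finSuccEquiv K 3) (f4 K))
  rw [this]
  have hp := prime_X_pow_three_sum_fin_three K
  refine prime_X_pow_three_add_C hp dvd_rfl ?_
  intro h
  have := (pow_dvd_pow_iff hp.ne_zero hp.not_isUnit (n := 2) (m := 1)).1 (by rwa [pow_one])
  norm_num at this

instance isDomain_R4 : IsDomain (R4 K) := by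
  have : (Ideal.span {f4 K}).IsPrime :=
    (Ideal.span_singleton_prime (prime_f4 K).ne_zero).2 (prime_f4 K)
  infer_instance

end Prime

/-! ### The Krull dimension of `R4`. -/

section Dim

variable {K : Type*} [Field K]

theorem toR4_eq_zero {p : MvPolynomial (Fin 4) K} : toR4 K p = 0 ↔ f4 K ∣ p := by
  rw [Ideal.Quotient.eq_zero_iff_mem, Ideal.mem_span_singleton]

variable (K) [CharZero K]

/-- Killing a nonzerodivisor lowers the dimension by at least one. Applied to `f4` this gives the
upper bound. Applied to `Y₁ + Y₂` in `R4` it gives the lower bound, since that quotient maps onto a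
polynomial ring in two variables. -/
theorem ringKrullDim_R4 : ringKrullDim (R4 K) = 3 := by
  have hS : ringKrullDim (MvPolynomial (Fin 4) K) = 4 := by
    simp
  apply le_antisymm
  · have h := ringKrullDim_quotient_succ_le_of_nonZeroDivisor
      (mem_nonZeroDivisors_of_ne_zero (prime_f4 K).ne_zero)
    rw [hS] at h
    have h4 : (4 : WithBot ℕ∞) = 3 + 1 := by norm_num
    rw [h4] at h
    exact ENat.WithBot.add_le_add_one_right_iff.1 h
  · have hx : toR4 K (X 0 + X 1) ≠ 0 := by
      rw [Ne, toR4_eq_zero]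
      rintro ⟨q, hq⟩
      -- This point lies on the surface but not on the plane `Y₁ + Y₂ = 0`.
      have := congrArg (eval ![(1 : K), 0, -1, 0]) hq
      simp [f4] at this
      norm_num at this
    have h := ringKrullDim_quotient_succ_le_of_nonZeroDivisor
      (mem_nonZeroDivisors_of_ne_zero hx)
    -- Restriction to the line `Y₁ + Y₂ = Y₃ + Y₄ = 0` of the surface.
    let φ : MvPolynomial (Fin 4) K →+* MvPolynomial (Fin 2) K :=
      (aeval ![X 0, -X 0, X 1, -X 1] : MvPolynomial (Fin 4) K →ₐ[K] _).toRingHom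
    have hφ : ∀ a ∈ Ideal.span {f4 K}, φ a = 0 := by
      intro a ha
      obtain ⟨q, rfl⟩ := Ideal.mem_span_singleton.1 ha
      simp only [φ, map_mul]
      convert zero_mul _
      simp [f4]
      ring
    let φ' : R4 K →+* MvPolynomial (Fin 2) K := Ideal.Quotient.lift _ φ hφ
    have hφ' : ∀ a ∈ Ideal.span {toR4 K (X 0 + X 1)}, φ' a = 0 := by
      intro a ha
      obtain ⟨q, rfl⟩ := Ideal.mem_span_singleton.1 ha
      rw [map_mul]
      convert zero_mul _
      simp [φ', φ]
    let φ'' : R4 K ⧸ Ideal.span {toR4 K (X 0 + X 1)} →+* MvPolynomial (Fin 2) K :=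
      Ideal.Quotient.lift _ φ' hφ'
    have hs : Function.Surjective φ'' := by
      refine Ideal.Quotient.lift_surjective_of_surjective _ _
        (Ideal.Quotient.lift_surjective_of_surjective _ _ ?_)
      intro p
      refine ⟨rename ![0, 2] p, ?_⟩
      simp only [φ, AlgHom.toRingHom_eq_coe, RingHom.coe_coe, aeval_rename]
      conv_rhs => rw [← aeval_X_left_apply (R := K) p]
      congr 2
      ext i
      fin_cases i <;> simp
    have h2 : ringKrullDim (MvPolynomial (Fin 2) K) ≤ ringKrullDim (R4 K ⧸ Ideal.span {toR4 K (X 0 + X 1)}) :=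
      ringKrullDim_le_of_surjective φ'' hs
    have h3 : ringKrullDim (MvPolynomial (Fin 2) K) = 2 := by simp
    rw [h3] at h2
    refine le_trans ?_ h
    calc (3 : WithBot ℕ∞) = 2 + 1 := by norm_num
      _ ≤ _ := by gcongr

end Dim

end FermatCubic

namespace FermatCubic

open MvPolynomial

/-! ### Forms of integer degree and their components. -/

section HomogeneousInt

variable {K : Type*} [Field K]

/-- Homogeneity of a polynomial of degree `n ∈ ℤ`; only `0` is homogeneous of negative degree. -/
def IsHomZ (n : ℤ) (p : MvPolynomial (Fin 4) K) : Prop :=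
  ∀ m, coeff m p ≠ 0 → (m.degree : ℤ) = n

theorem isHomZ_natCast {n : ℕ} {p : MvPolynomial (Fin 4) K} :
    IsHomZ (n : ℤ) p ↔ p.IsHomogeneous n := by
  simp only [IsHomZ, IsHomogeneous, IsWeightedHomogeneous, Nat.cast_inj,
    Finsupp.degree_eq_weight_one]
  rfl

theorem IsHomZ.zero (n : ℤ) : IsHomZ n (0 : MvPolynomial (Fin 4) K) := fun m h => by simp at h

theorem IsHomZ.add {n : ℤ} {p q : MvPolynomial (Fin 4) K} (hp : IsHomZ n p) (hq : IsHomZ n q) :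
    IsHomZ n (p + q) := fun m h => by
  by_cases h1 : coeff m p = 0
  · exact hq m (by simpa [h1] using h)
  · exact hp m h1

theorem IsHomZ.neg {n : ℤ} {p : MvPolynomial (Fin 4) K} (hp : IsHomZ n p) : IsHomZ n (-p) :=
  fun m h => hp m (by simpa using h)

theorem IsHomZ.sub {n : ℤ} {p q : MvPolynomial (Fin 4) K} (hp : IsHomZ n p) (hq : IsHomZ n q) :
    IsHomZ n (p - q) := by
  rw [sub_eq_add_neg]; exact hp.add hq.neg

theorem IsHomZ.mul {m n : ℤ} {p q : MvPolynomial (Fin 4) K} (hp : IsHomZ m p) (hq : IsHomZ n q) :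
    IsHomZ (m + n) (p * q) := fun c h => by
  classical
  rw [coeff_mul] at h
  obtain ⟨x, hx, hne⟩ := Finset.exists_ne_zero_of_sum_ne_zero h
  rw [Finset.HasAntidiagonal.mem_antidiagonal] at hx
  rw [← hx, map_add, Nat.cast_add, hp _ (left_ne_zero_of_mul hne), hq _ (right_ne_zero_of_mul hne)]

theorem IsHomZ.congr {m n : ℤ} {p : MvPolynomial (Fin 4) K} (hp : IsHomZ m p) (h : m = n) :
    IsHomZ n p := h ▸ hp

theorem isHomZ_C (c : K) : IsHomZ 0 (C c : MvPolynomial (Fin 4) K) := by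
  have := isHomZ_natCast.2 (isHomogeneous_C (Fin 4) c)
  simpa using this

theorem isHomZ_one : IsHomZ 0 (1 : MvPolynomial (Fin 4) K) := isHomZ_C 1

theorem isHomZ_X (i : Fin 4) : IsHomZ 1 (X i : MvPolynomial (Fin 4) K) := by
  have := isHomZ_natCast.2 (isHomogeneous_X K i)
  simpa using this

theorem IsHomZ.C_mul {n : ℤ} {p : MvPolynomial (Fin 4) K} (hp : IsHomZ n p) (c : K) :
    IsHomZ n (C c * p) := ((isHomZ_C c).mul hp).congr (zero_add n)

theorem IsHomZ.pow {n : ℤ} {p : MvPolynomial (Fin 4) K} (hp : IsHomZ n p) (k : ℕ) :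
    IsHomZ (k * n) (p ^ k) := by
  induction k with
  | zero => simpa using isHomZ_one
  | succ k ih => rw [pow_succ]; exact (ih.mul hp).congr (by push_cast; ring)

theorem isHomZ_f4 : IsHomZ 3 (f4 K) := by
  have h : ∀ i, IsHomZ 3 (X i ^ 3 : MvPolynomial (Fin 4) K) := fun i =>
    ((isHomZ_X i).pow 3).congr (by norm_num)
  exact (((h 0).add (h 1)).add (h 2)).add (h 3)

theorem IsHomZ.sum {ι : Type*} (s : Finset ι) {n : ℤ} {p : ι → MvPolynomial (Fin 4) K}
    (h : ∀ i ∈ s, IsHomZ n (p i)) : IsHomZ n (∑ i ∈ s, p i) := by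
  classical
  induction s using Finset.induction_on with
  | empty => simpa using IsHomZ.zero n
  | insert a s ha ih =>
    rw [Finset.sum_insert ha]
    exact (h a (Finset.mem_insert_self a s)).add
      (ih fun i hi => h i (Finset.mem_insert_of_mem hi))

theorem IsHomZ.eq_zero_of_neg {n : ℤ} {p : MvPolynomial (Fin 4) K} (hp : IsHomZ n p)
    (hn : n < 0) : p = 0 := by
  ext m
  by_contra h
  have := hp m (by simpa using h)
  omega

theorem IsHomZ.unique {m n : ℤ} {p : MvPolynomial (Fin 4) K} (hp : IsHomZ m p)
    (hq : IsHomZ n p) (h0 : p ≠ 0) : m = n := by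
  obtain ⟨c, hc⟩ := ne_zero_iff.1 h0
  rw [← hp c hc, ← hq c hc]

/-- A form of degree `0` is a constant. -/
theorem IsHomZ.eq_C {p : MvPolynomial (Fin 4) K} (hp : IsHomZ 0 p) :
    p = C (constantCoeff p) := by
  ext m
  rw [coeff_C, constantCoeff_eq]
  split_ifs with h
  · rw [h]
  · by_contra hne
    have := hp m hne
    rw [Nat.cast_eq_zero, Finsupp.degree_eq_zero_iff] at this
    exact h this.symm

/-- A nonzero form without constant term has positive degree. -/
theorem IsHomZ.pos {n : ℤ} {p : MvPolynomial (Fin 4) K} (hp : IsHomZ n p) (h0 : p ≠ 0)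
    (hc : constantCoeff p = 0) : 0 < n := by
  rcases lt_trichotomy n 0 with h | h | h
  · exact absurd (hp.eq_zero_of_neg h) h0
  · subst h
    rw [hp.eq_C, hc] at h0
    simp at h0
  · exact h

/-- A linear form is a combination of the variables. -/
theorem IsHomZ.eq_sum_X {p : MvPolynomial (Fin 4) K} (hp : IsHomZ 1 p) :
    p = ∑ i, C (coeff (Finsupp.single i 1) p) * X i := by
  have h : p ∈ homogeneousSubmodule (Fin 4) K 1 := isHomZ_natCast.1 (by simpa using hp)
  rw [homogeneousSubmodule_one_eq_span_X] at h
  obtain ⟨c, rfl⟩ := (Submodule.mem_span_range_iff_exists_fun K).1 h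
  refine Finset.sum_congr rfl fun i _ => ?_
  rw [smul_eq_C_mul]
  congr 2
  simp only [coeff_sum, coeff_smul, coeff_X, smul_eq_mul]
  rw [Finset.sum_eq_single i]
  · simp
  · intro j _ hj
    simp [Finsupp.single_left_inj, hj]
  · simp

/-- The component of degree `n ∈ ℤ` of a polynomial. -/
noncomputable def hcomp (n : ℤ) : MvPolynomial (Fin 4) K →+ MvPolynomial (Fin 4) K :=
  if 0 ≤ n then (homogeneousComponent n.toNat).toAddMonoidHom else 0

theorem coeff_hcomp (n : ℤ) (p : MvPolynomial (Fin 4) K) (m : Fin 4 →₀ ℕ) :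
    coeff m (hcomp n p) = if (m.degree : ℤ) = n then coeff m p else 0 := by
  unfold hcomp
  split_ifs with h1 h2 h2
  · simp [coeff_homogeneousComponent, ← h2]
  · simp only [LinearMap.toAddMonoidHom_coe, coeff_homogeneousComponent, ite_eq_right_iff]
    intro h; omega
  · omega
  · simp

theorem isHomZ_hcomp (n : ℤ) (p : MvPolynomial (Fin 4) K) : IsHomZ n (hcomp n p) := fun m h => by
  by_contra hne
  rw [coeff_hcomp, if_neg hne] at h
  exact h rfl

theorem IsHomZ.hcomp_eq {n : ℤ} {p : MvPolynomial (Fin 4) K} (hp : IsHomZ n p) :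
    hcomp n p = p := by
  ext m
  rw [coeff_hcomp]
  split_ifs with h
  · rfl
  · by_contra hne
    exact h (hp m (Ne.symm hne))

theorem IsHomZ.hcomp_eq_zero {m n : ℤ} {p : MvPolynomial (Fin 4) K} (hp : IsHomZ n p)
    (h : m ≠ n) : hcomp m p = 0 := by
  ext c
  rw [coeff_hcomp]
  split_ifs with h1
  · by_contra hne
    exact h (h1 ▸ hp c hne)
  · simp

/-- This shift rule is what makes the ideal of `f4`, and images of matrices of forms, stable under
taking components. -/
theorem IsHomZ.hcomp_mul {d : ℤ} {h : MvPolynomial (Fin 4) K} (hh : IsHomZ d h) (n : ℤ)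
    (p : MvPolynomial (Fin 4) K) : hcomp n (h * p) = h * hcomp (n - d) p := by
  classical
  ext m
  have hite : ∀ (P : Prop) [Decidable P] (s : Finset ((Fin 4 →₀ ℕ) × (Fin 4 →₀ ℕ))) (g : _ → K),
      (if P then ∑ x ∈ s, g x else 0) = ∑ x ∈ s, if P then g x else 0 := fun P _ s g => by
    split_ifs <;> simp
  rw [coeff_hcomp, coeff_mul, coeff_mul, hite]
  refine Finset.sum_congr rfl ?_
  rintro ⟨a, b⟩ hab
  rw [Finset.HasAntidiagonal.mem_antidiagonal] at hab
  simp only [coeff_hcomp]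
  by_cases ha : coeff a h = 0
  · simp [ha]
  · have h1 := hh a ha
    have h2 : (m.degree : ℤ) = a.degree + b.degree := by rw [← hab]; simp
    have : (m.degree : ℤ) = n ↔ (b.degree : ℤ) = n - d := by omega
    simp [this]

theorem sum_hcomp (p : MvPolynomial (Fin 4) K) :
    ∑ i ∈ Finset.range (p.totalDegree + 1), hcomp (i : ℤ) p = p := by
  conv_rhs => rw [← sum_homogeneousComponent p]
  refine Finset.sum_congr rfl fun i _ => ?_
  simp [hcomp]

theorem constantCoeff_hcomp_zero (p : MvPolynomial (Fin 4) K) :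
    constantCoeff (hcomp 0 p) = constantCoeff p := by
  simp [constantCoeff_eq, coeff_hcomp]

end HomogeneousInt

/-! ### Gradings described by families of projections. -/

section Decomposition

/-- The additive maps `π n` are the projections of `M` onto the summands of `M = ⨁ ℳ n`. -/
structure IsDecomp {M : Type*} [AddCommGroup M] (ℳ : ℤ → AddSubgroup M) (π : ℤ → M →+ M) :
    Prop where
  mem : ∀ n x, π n x ∈ ℳ n
  same : ∀ n x, x ∈ ℳ n → π n x = x
  ne : ∀ m n x, m ≠ n → x ∈ ℳ n → π m x = 0
  span : ⨆ n, ℳ n = ⊤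

variable {M N : Type*} [AddCommGroup M] [AddCommGroup N]
  {ℳ : ℤ → AddSubgroup M} {𝒩 : ℤ → AddSubgroup N} {π : ℤ → M →+ M} {ρ : ℤ → N →+ N}

theorem IsDecomp.induction (h : IsDecomp ℳ π) {P : M → Prop} (x : M)
    (mem : ∀ n x, x ∈ ℳ n → P x) (zero : P 0) (add : ∀ x y, P x → P y → P (x + y)) : P x :=
  AddSubgroup.iSup_induction ℳ (C := P) (x := x) (h.span ▸ AddSubgroup.mem_top x) mem zero add

theorem IsDecomp.isInternal (h : IsDecomp ℳ π) : DirectSum.IsInternal ℳ := by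
  classical
  constructor
  · rw [injective_iff_map_eq_zero]
    intro x hx
    ext n
    have h1 : (π n).comp (DirectSum.coeAddMonoidHom ℳ) =
        (ℳ n).subtype.comp (DFinsupp.evalAddMonoidHom n) := by
      refine DirectSum.addHom_ext fun i y => ?_
      rw [AddMonoidHom.comp_apply, DirectSum.coeAddMonoidHom_of]
      change _ = ((DirectSum.of (fun i => ℳ i) i y) n : M)
      rw [DirectSum.coe_of_apply]
      split_ifs with hi
      · subst hi; exact h.same _ _ y.2
      · exact h.ne _ _ _ (Ne.symm hi) y.2
    have h2 := DFunLike.congr_fun h1 x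
    rw [AddMonoidHom.comp_apply, hx, map_zero] at h2
    exact h2.symm
  · intro x
    refine h.induction (P := fun x => ∃ y, DirectSum.coeAddMonoidHom ℳ y = x) x
      (fun n y hy => ⟨DirectSum.of (fun i => ℳ i) n ⟨y, hy⟩, by simp⟩) ⟨0, by simp⟩ ?_
    rintro _ _ ⟨a, rfl⟩ ⟨b, rfl⟩
    exact ⟨a + b, by simp⟩

theorem exists_isDecomp (h : DirectSum.IsInternal ℳ) : ∃ π, IsDecomp ℳ π := by
  classical
  let e := AddEquiv.ofBijective (DirectSum.coeAddMonoidHom ℳ) h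
  have he : ∀ n (x : ℳ n), e.symm x = DirectSum.of (fun i => ℳ i) n x := fun n x => by
    rw [AddEquiv.symm_apply_eq]
    exact (DirectSum.coeAddMonoidHom_of ℳ n x).symm
  refine ⟨fun n => ((ℳ n).subtype.comp (DFinsupp.evalAddMonoidHom n)).comp e.symm.toAddMonoidHom,
    fun n x => SetLike.coe_mem _, fun n x hx => ?_, fun m n x hmn hx => ?_, ?_⟩
  · have := he n ⟨x, hx⟩
    simp only at this
    change ((e.symm x) n : M) = x
    rw [this, DirectSum.of_eq_same]
  · have := he n ⟨x, hx⟩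
    simp only at this
    change ((e.symm x) m : M) = 0
    rw [this, DirectSum.of_eq_of_ne _ _ _ hmn]; rfl
  · rw [eq_top_iff]
    rintro x -
    obtain ⟨y, rfl⟩ := h.2 x
    induction y using DirectSum.induction_on with
    | zero => simp
    | of i y => simpa using AddSubgroup.mem_iSup_of_mem i y.2
    | add y z hy hz => simpa using add_mem hy hz

theorem IsDecomp.exists_sum (h : IsDecomp ℳ π) (x : M) :
    ∃ s : Finset ℤ, ∀ t : Finset ℤ, s ⊆ t → ∑ n ∈ t, π n x = x := by
  classical
  refine h.induction (P := fun x => ∃ s : Finset ℤ, ∀ t : Finset ℤ, s ⊆ t → ∑ n ∈ t, π n x = x)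
    x (fun m y hy => ⟨{m}, fun t ht => ?_⟩) ⟨∅, by simp⟩ ?_
  · rw [Finset.sum_eq_single_of_mem m (ht (by simp)) fun n _ hn => h.ne _ _ _ hn hy,
      h.same _ _ hy]
  · rintro y z ⟨s, hs⟩ ⟨s', hs'⟩
    refine ⟨s ∪ s', fun t ht => ?_⟩
    simp only [map_add, Finset.sum_add_distrib]
    rw [hs t (Finset.union_subset_left ht), hs' t (Finset.union_subset_right ht)]

/-- The grading induced on a quotient by a homogeneous subgroup. -/
theorem IsDecomp.map (h : IsDecomp ℳ π) (q : M →+ N) (hq : Function.Surjective q)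
    (hk : ∀ n x, q x = 0 → q (π n x) = 0) :
    ∃ ρ : ℤ → N →+ N, IsDecomp (fun n => (ℳ n).map q) ρ ∧ ∀ n x, ρ n (q x) = q (π n x) := by
  let ρ : ℤ → N →+ N := fun n => AddMonoidHom.liftOfSurjective q hq
    ⟨q.comp (π n), fun x hx => hk n x hx⟩
  have hρ : ∀ n x, ρ n (q x) = q (π n x) := fun n x =>
    AddMonoidHom.liftOfRightInverse_comp_apply q _ _ _ x
  refine ⟨ρ, ⟨?_, ?_, ?_, ?_⟩, hρ⟩
  · intro n x
    obtain ⟨x, rfl⟩ := hq x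
    rw [hρ]
    exact AddSubgroup.mem_map_of_mem q (h.mem n x)
  · rintro n _ ⟨x, hx, rfl⟩
    rw [hρ, h.same n x hx]
  · rintro m n _ hmn ⟨x, hx, rfl⟩
    rw [hρ, h.ne m n x hmn hx, map_zero]
  · rw [← AddSubgroup.map_iSup, h.span, AddSubgroup.map_top_of_surjective q hq]

/-- The grading induced on a homogeneous subgroup. -/
theorem IsDecomp.comap (h : IsDecomp ℳ π) (i : N →+ M) (hi : Function.Injective i)
    (ρ : ℤ → N →+ N) (hρ : ∀ n x, i (ρ n x) = π n (i x)) :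
    IsDecomp (fun n => (ℳ n).comap i) ρ := by
  refine ⟨fun n x => ?_, fun n x hx => hi ?_, fun m n x hmn hx => hi ?_, ?_⟩
  · rw [AddSubgroup.mem_comap, hρ]
    exact h.mem n _
  · rw [hρ, h.same n _ hx]
  · rw [hρ, h.ne m n _ hmn hx, map_zero]
  · rw [eq_top_iff]
    rintro x -
    obtain ⟨s, hs⟩ := h.exists_sum (i x)
    have : x = ∑ n ∈ s, ρ n x := hi (by rw [map_sum, ← hs s subset_rfl]; simp [hρ])
    rw [this]
    refine sum_mem fun n _ => AddSubgroup.mem_iSup_of_mem n ?_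
    rw [AddSubgroup.mem_comap, hρ]
    exact h.mem n _

/-- The product of finitely many gradings. -/
theorem IsDecomp.pi {k : ℕ} (h : IsDecomp ℳ π) (δ : Fin k → ℤ) :
    IsDecomp (fun n => AddSubgroup.pi Set.univ fun i => ℳ (n - δ i))
      (fun n => AddMonoidHom.mk' (fun (v : Fin k → M) i => π (n - δ i) (v i))
        (fun v w => by ext; simp)) := by
  classical
  refine ⟨fun n x i _ => h.mem _ _, fun n x hx => ?_, fun m n x hmn hx => ?_, ?_⟩
  · ext i
    exact h.same _ _ (hx i trivial)
  · ext i
    exact h.ne _ _ _ (by omega) (hx i trivial)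
  · rw [eq_top_iff]
    rintro x -
    rw [← Finset.univ_sum_single x]
    refine sum_mem fun i _ => ?_
    refine h.induction (P := fun y => Pi.single i y ∈ ⨆ n, AddSubgroup.pi Set.univ
      fun j => ℳ (n - δ j)) (x i) (fun n y hy => ?_) (by simp) ?_
    · refine AddSubgroup.mem_iSup_of_mem (n + δ i) fun j _ => ?_
      by_cases hj : j = i
      · subst hj; simpa using hy
      · simp [hj]
    · intro y z hy hz
      rw [Pi.single_add]
      exact add_mem hy hz

/-- A bijection that maps one grading into another one, maps it onto the other one. -/
theorem IsDecomp.mem_iff (h : IsDecomp ℳ π) (h' : IsDecomp 𝒩 ρ) (e : M →+ N)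
    (he : Function.Injective e) (c : ℤ) (hc : ∀ n x, x ∈ ℳ n → e x ∈ 𝒩 (n + c)) (n : ℤ) (x : M) :
    x ∈ ℳ n ↔ e x ∈ 𝒩 (n + c) := by
  -- A homomorphism of degree `c` commutes with the projections; with injectivity this gives the
  -- converse inclusion.
  have key : ∀ x, e (π n x) = ρ (n + c) (e x) := fun x => by
    refine h.induction (P := fun x => e (π n x) = ρ (n + c) (e x)) x (fun m y hy => ?_)
      (by simp) (fun y z hy hz => by simp [hy, hz])
    by_cases hmn : n = m
    · subst hmn
      rw [h.same _ _ hy, h'.same _ _ (hc _ _ hy)]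
    · rw [h.ne _ _ _ hmn hy, h'.ne _ _ _ (by omega) (hc _ _ hy), map_zero]
  refine ⟨hc n x, fun hx => ?_⟩
  have : π n x = x := he (by rw [key, h'.same _ _ hx])
  rw [← this]
  exact h.mem n x

end Decomposition

end FermatCubic

namespace FermatCubic

open MvPolynomial

/-! ### The gradings of `R4`, of free modules and of cokernels. -/

section GradingR4

variable {K : Type*} [Field K]

theorem mem_homogeneousPart {n : ℤ} {r : R4 K} :
    r ∈ homogeneousPart K n ↔ ∃ p, IsHomZ n p ∧ toR4 K p = r := by
  unfold homogeneousPart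
  split_ifs with h
  · constructor
    · rintro ⟨p, hp, rfl⟩
      refine ⟨p, ?_, rfl⟩
      have := isHomZ_natCast.2 ((mem_homogeneousSubmodule _ _).1 hp)
      rwa [Int.toNat_of_nonneg h] at this
    · rintro ⟨p, hp, rfl⟩
      refine ⟨p, (mem_homogeneousSubmodule _ _).2 (isHomZ_natCast.1 ?_), rfl⟩
      rwa [Int.toNat_of_nonneg h]
  · rw [AddSubgroup.mem_bot]
    constructor
    · rintro rfl
      exact ⟨0, IsHomZ.zero n, map_zero _⟩
    · rintro ⟨p, hp, rfl⟩
      rw [hp.eq_zero_of_neg (by omega), map_zero]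

theorem IsHomZ.toR4_mem {n : ℤ} {p : MvPolynomial (Fin 4) K} (hp : IsHomZ n p) :
    toR4 K p ∈ homogeneousPart K n := mem_homogeneousPart.2 ⟨p, hp, rfl⟩

theorem mul_mem_homogeneousPart {m n : ℤ} {r s : R4 K} (hr : r ∈ homogeneousPart K m)
    (hs : s ∈ homogeneousPart K n) : r * s ∈ homogeneousPart K (m + n) := by
  obtain ⟨p, hp, rfl⟩ := mem_homogeneousPart.1 hr
  obtain ⟨q, hq, rfl⟩ := mem_homogeneousPart.1 hs
  rw [← map_mul]
  exact (hp.mul hq).toR4_mem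

variable (K) in
theorem isDecomp_hcomp : IsDecomp
    (fun n => AddSubgroup.mk (AddSubmonoid.mk (AddSubsemigroup.mk {p | IsHomZ (K := K) n p}
      fun hp hq => hp.add hq) (IsHomZ.zero n)) fun hp => hp.neg) (hcomp (K := K)) := by
  refine ⟨fun n p => isHomZ_hcomp n p, fun n p hp => IsHomZ.hcomp_eq hp,
    fun m n p hmn hp => IsHomZ.hcomp_eq_zero hp hmn, ?_⟩
  rw [eq_top_iff]
  rintro p -
  rw [← sum_hcomp p]
  exact sum_mem fun i _ => AddSubgroup.mem_iSup_of_mem (i : ℤ) (isHomZ_hcomp _ p)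

/-- The ideal of `f4` is homogeneous, so the component maps descend to `R4`. -/
theorem toR4_hcomp_eq_zero (n : ℤ) {p : MvPolynomial (Fin 4) K} (hp : toR4 K p = 0) :
    toR4 K (hcomp n p) = 0 := by
  rw [toR4_eq_zero] at hp
  obtain ⟨q, rfl⟩ := hp
  rw [isHomZ_f4.hcomp_mul, toR4_eq_zero]
  exact dvd_mul_right _ _

variable (K) in
theorem exists_rcomp : ∃ ρ : ℤ → R4 K →+ R4 K, IsDecomp (homogeneousPart K) ρ ∧
    ∀ n p, ρ n (toR4 K p) = toR4 K (hcomp n p) := by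
  obtain ⟨ρ, h1, h2⟩ := (isDecomp_hcomp K).map (toR4 K).toAddMonoidHom
    Ideal.Quotient.mk_surjective (fun n p hp => toR4_hcomp_eq_zero n hp)
  refine ⟨ρ, ?_, h2⟩
  convert h1 using 1
  funext n
  ext r
  exact mem_homogeneousPart

/-- The component of degree `n ∈ ℤ` of an element of `R₄`. -/
noncomputable def rcomp (n : ℤ) : R4 K →+ R4 K := (exists_rcomp K).choose n

theorem isDecomp_rcomp : IsDecomp (homogeneousPart K) (rcomp (K := K)) :=
  (exists_rcomp K).choose_spec.1

theorem rcomp_toR4 (n : ℤ) (p : MvPolynomial (Fin 4) K) :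
    rcomp n (toR4 K p) = toR4 K (hcomp n p) := (exists_rcomp K).choose_spec.2 n p

theorem rcomp_toR4_mul {d : ℤ} {h : MvPolynomial (Fin 4) K} (hh : IsHomZ d h) (n : ℤ)
    (r : R4 K) : rcomp n (toR4 K h * r) = toR4 K h * rcomp (n - d) r := by
  obtain ⟨p, rfl⟩ := Ideal.Quotient.mk_surjective r
  rw [← map_mul, rcomp_toR4, rcomp_toR4, hh.hcomp_mul, map_mul]

/-- The components of the elements of a graded free module. -/
noncomputable def fcomp {m : ℕ} (δ : Fin m → ℤ) (n : ℤ) : (Fin m → R4 K) →+ (Fin m → R4 K) :=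
  AddMonoidHom.mk' (fun v i => rcomp (n - δ i) (v i)) (fun v w => by ext; simp)

theorem fcomp_apply {m : ℕ} (δ : Fin m → ℤ) (n : ℤ) (v : Fin m → R4 K) (i : Fin m) :
    fcomp δ n v i = rcomp (n - δ i) (v i) := rfl

theorem isDecomp_fcomp {m : ℕ} (δ : Fin m → ℤ) : IsDecomp (freeGrading K δ) (fcomp δ) :=
  isDecomp_rcomp.pi δ

theorem mem_freeGrading {m : ℕ} {δ : Fin m → ℤ} {n : ℤ} {v : Fin m → R4 K} :
    v ∈ freeGrading K δ n ↔ ∀ i, v i ∈ homogeneousPart K (n - δ i) := by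
  simp [freeGrading, AddSubgroup.mem_pi]

theorem smul_mem_freeGrading {m : ℕ} {δ : Fin m → ℤ} {d n : ℤ} {r : R4 K} {v : Fin m → R4 K}
    (hr : r ∈ homogeneousPart K d) (hv : v ∈ freeGrading K δ n) :
    r • v ∈ freeGrading K δ (d + n) := by
  rw [mem_freeGrading] at hv ⊢
  intro i
  have := mul_mem_homogeneousPart hr (hv i)
  rwa [← add_sub_assoc] at this

/-- The matrix `A` of forms defines a homogeneous map, of degree `0`, between graded free modules
with generators of degrees `ε` and `δ`. -/
def IsHomMat {m k : ℕ} (δ : Fin m → ℤ) (ε : Fin k → ℤ)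
    (A : Matrix (Fin m) (Fin k) (MvPolynomial (Fin 4) K)) : Prop :=
  ∀ i j, IsHomZ (ε j - δ i) (A i j)

/-- Consequently the column space of a matrix of forms is a homogeneous submodule, and the cokernel
inherits a grading. -/
theorem IsHomMat.fcomp_mulVec {m k : ℕ} {δ : Fin m → ℤ} {ε : Fin k → ℤ}
    {A : Matrix (Fin m) (Fin k) (MvPolynomial (Fin 4) K)} (hA : IsHomMat δ ε A) (n : ℤ)
    (v : Fin k → R4 K) :
    fcomp δ n ((A.map (toR4 K)).mulVec v) = (A.map (toR4 K)).mulVec (fcomp ε n v) := by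
  ext i
  simp only [fcomp_apply, Matrix.mulVec, dotProduct, map_sum, Matrix.map_apply]
  refine Finset.sum_congr rfl fun j _ => ?_
  rw [rcomp_toR4_mul (hA i j)]
  congr 3
  ring

theorem IsHomMat.exists_isDecomp_coker {δ ε : Fin 2 → ℤ}
    {A : Matrix (Fin 2) (Fin 2) (MvPolynomial (Fin 4) K)} (hA : IsHomMat δ ε A) :
    ∃ ρ : ℤ → Coker A →+ Coker A, IsDecomp (cokerGrading A δ) ρ := by
  obtain ⟨ρ, h1, -⟩ := (isDecomp_fcomp δ).map
    (Submodule.mkQ (LinearMap.range (A.map (toR4 K)).mulVecLin)).toAddMonoidHom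
    (Submodule.mkQ_surjective _) (fun n x hx => by
      have hx' : x ∈ LinearMap.range (A.map (toR4 K)).mulVecLin :=
        (Submodule.Quotient.mk_eq_zero _).1 hx
      refine (Submodule.Quotient.mk_eq_zero _).2 ?_
      obtain ⟨y, rfl⟩ := hx'
      exact ⟨fcomp ε n y, (hA.fcomp_mulVec n y).symm⟩)
  exact ⟨ρ, h1⟩

theorem IsHomMat.isGrading_coker {δ ε : Fin 2 → ℤ}
    {A : Matrix (Fin 2) (Fin 2) (MvPolynomial (Fin 4) K)} (hA : IsHomMat δ ε A) :
    IsGrading (K := K) (cokerGrading A δ) := by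
  obtain ⟨ρ, h⟩ := hA.exists_isDecomp_coker
  refine ⟨h.isInternal, ?_⟩
  rintro d n r _ hr ⟨v, hv, rfl⟩
  exact ⟨r • v, smul_mem_freeGrading hr hv, map_smul (Submodule.mkQ _) r v⟩

theorem IsGrading.proj_smul {M : Type*} [AddCommGroup M] [Module (R4 K) M]
    {ℳ : ℤ → AddSubgroup M} {π : ℤ → M →+ M} (h : IsGrading (K := K) ℳ) (hπ : IsDecomp ℳ π)
    {d : ℤ} {r : R4 K} (hr : r ∈ homogeneousPart K d) (n : ℤ) (x : M) :
    π n (r • x) = r • π (n - d) x := by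
  refine hπ.induction (P := fun x => π n (r • x) = r • π (n - d) x) x (fun m y hy => ?_)
    (by simp) (fun y z hy hz => by simp [hy, hz])
  have h1 := h.smul_mem d m r y hr hy
  by_cases hm : n = d + m
  · subst hm
    rw [hπ.same _ _ h1, add_sub_cancel_left, hπ.same _ _ hy]
  · rw [hπ.ne _ _ _ hm h1, hπ.ne _ _ _ (by omega) hy, smul_zero]

theorem GradedIso.symm {M N : Type*} [AddCommGroup M] [Module (R4 K) M]
    [AddCommGroup N] [Module (R4 K) N] {ℳ : ℤ → AddSubgroup M} {𝒩 : ℤ → AddSubgroup N}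
    (h : GradedIso (K := K) ℳ 𝒩) : GradedIso (K := K) 𝒩 ℳ := by
  obtain ⟨c, e, he⟩ := h
  refine ⟨-c, e.symm, fun n x => ?_⟩
  rw [he, LinearEquiv.apply_symm_apply, neg_add_cancel_right]

end GradingR4

/-! ### The matrices of a datum. -/

section Matrices

variable {K : Type*} [Field K]

theorem Datum.cases (p : Datum K) : (p.i = 1 ∧ p.j = 2 ∧ p.s = 3) ∨
    (p.i = 1 ∧ p.j = 3 ∧ p.s = 2) ∨ (p.i = 2 ∧ p.j = 3 ∧ p.s = 1) := by
  obtain ⟨a, b, i, j, s, -, -, hij, perm⟩ := p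
  dsimp only
  clear * - hij perm
  revert i j s
  decide

theorem Datum.f4_eq (p : Datum K) : f4 K = X 0 ^ 3 + X p.i ^ 3 + X p.j ^ 3 + X p.s ^ 3 := by
  unfold f4
  rcases p.cases with ⟨h1, h2, h3⟩ | ⟨h1, h2, h3⟩ | ⟨h1, h2, h3⟩ <;> rw [h1, h2, h3] <;> ring

theorem Datum.C_a (p : Datum K) : (C p.a : MvPolynomial (Fin 4) K) ^ 3 = -1 := by
  rw [← map_pow, p.ha, map_neg, map_one]

theorem Datum.C_b (p : Datum K) : (C p.b : MvPolynomial (Fin 4) K) ^ 3 = -1 := by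
  rw [← map_pow, p.hb, map_neg, map_one]

/-- As `a ^ 3 = b ^ 3 = -1`, the products of linear and quadratic entries are `Y₁³ + Y_s³` and `Y_i³
+ Y_j³`, whose sum is `f4`; the matrix `psi` is the adjugate of `phi`. -/
theorem phi_mul_psi (p : Datum K) :
    phi p * psi p = f4 K • (1 : Matrix (Fin 2) (Fin 2) (MvPolynomial (Fin 4) K)) := by
  rw [p.f4_eq]
  ext i j : 1
  have ha := p.C_a
  have hb := p.C_b
  fin_cases i <;> fin_cases j <;>
    simp [phi, psi, Matrix.mul_apply, Fin.sum_univ_two]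
  · linear_combination (-X p.s ^ 3) * ha - X p.j ^ 3 * hb
  · ring
  · ring
  · linear_combination (-X p.s ^ 3) * ha - X p.j ^ 3 * hb

theorem psi_mul_phi (p : Datum K) :
    psi p * phi p = f4 K • (1 : Matrix (Fin 2) (Fin 2) (MvPolynomial (Fin 4) K)) := by
  rw [p.f4_eq]
  ext i j : 1
  have ha := p.C_a
  have hb := p.C_b
  fin_cases i <;> fin_cases j <;>
    simp [phi, psi, Matrix.mul_apply, Fin.sum_univ_two]
  · linear_combination (-X p.s ^ 3) * ha - X p.j ^ 3 * hb
  · ring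
  · ring
  · linear_combination (-X p.s ^ 3) * ha - X p.j ^ 3 * hb

theorem isHomZ_X_sub (c : K) (i j : Fin 4) :
    IsHomZ 1 (X i - C c * X j : MvPolynomial (Fin 4) K) :=
  (isHomZ_X i).sub ((isHomZ_X j).C_mul c)

theorem isHomZ_quadric (c : K) (i j : Fin 4) :
    IsHomZ 2 (X i ^ 2 + C c * X i * X j + C c ^ 2 * X j ^ 2 : MvPolynomial (Fin 4) K) := by
  refine (((isHomZ_X i).pow 2).add ?_).add ?_
  · rw [mul_assoc]
    exact (((isHomZ_X i).mul (isHomZ_X j)).C_mul c).congr (by norm_num)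
  · rw [← map_pow]
    exact (((isHomZ_X j).pow 2).C_mul _).congr (by norm_num)

theorem isHomMat_phi (p : Datum K) : IsHomMat ![0, 0] ![1, 2] (phi p) := by
  intro i j
  fin_cases i <;> fin_cases j
  · exact (isHomZ_X_sub p.a 0 p.s).congr (by norm_num)
  · exact (isHomZ_quadric p.b p.i p.j).neg.congr (by norm_num)
  · exact (isHomZ_X_sub p.b p.i p.j).congr (by norm_num)
  · exact (isHomZ_quadric p.a 0 p.s).congr (by norm_num)

theorem isHomMat_psi (p : Datum K) : IsHomMat ![0, 1] ![2, 2] (psi p) := by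
  intro i j
  fin_cases i <;> fin_cases j
  · exact (isHomZ_quadric p.a 0 p.s).congr (by norm_num)
  · exact (isHomZ_quadric p.b p.i p.j).congr (by norm_num)
  · exact (isHomZ_X_sub p.b p.i p.j).neg.congr (by norm_num)
  · exact (isHomZ_X_sub p.a 0 p.s).congr (by norm_num)

end Matrices

end FermatCubic

namespace FermatCubic

open MvPolynomial

/-! ### Ideals generated by variables, and elements of `R4` of low degree. -/

section Ideals

variable {K : Type*} [Field K]

/-- The ideal is the kernel of the endomorphism `κ` that sets the variables of `s` to zero, because
every `p` is congruent to `κ p`. -/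
theorem isPrime_span_X_image (s : Set (Fin 4)) :
    (Ideal.span (X '' s : Set (MvPolynomial (Fin 4) K))).IsPrime := by
  classical
  let κ : MvPolynomial (Fin 4) K →ₐ[K] MvPolynomial (Fin 4) K :=
    aeval fun i => if i ∈ s then 0 else X i
  have h1 : ∀ p, p - κ p ∈ Ideal.span (X '' s : Set (MvPolynomial (Fin 4) K)) := by
    intro p
    induction p using MvPolynomial.induction_on with
    | C a => simp [κ]
    | add p q hp hq =>
      rw [map_add, add_sub_add_comm]
      exact add_mem hp hq
    | mul_X p i hp =>
      have : p * X i - κ (p * X i) = (p - κ p) * X i + κ p * (X i - κ (X i)) := by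
        rw [map_mul]; ring
      rw [this]
      refine add_mem (Ideal.mul_mem_right _ _ hp) (Ideal.mul_mem_left _ _ ?_)
      by_cases hi : i ∈ s
      · simpa [κ, hi] using Ideal.subset_span (Set.mem_image_of_mem X hi)
      · simp [κ, hi]
  have h2 : Ideal.span (X '' s : Set (MvPolynomial (Fin 4) K)) = RingHom.ker κ := by
    apply le_antisymm
    · rw [Ideal.span_le]
      rintro _ ⟨i, hi, rfl⟩
      simp [κ, hi, RingHom.mem_ker]
    · intro p hp
      have := h1 p
      rwa [(RingHom.mem_ker).1 hp, sub_zero] at this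
  rw [h2]
  exact RingHom.ker_isPrime κ

theorem X_mem_span_X_image {s : Set (Fin 4)} {i : Fin 4} :
    (X i : MvPolynomial (Fin 4) K) ∈ Ideal.span (X '' s) ↔ i ∈ s := by
  rw [mem_ideal_span_X_image, support_X]
  simp [Finsupp.single_apply, eq_comm]

/-- The monomial `Y₁³` survives at the point `(1, 0, 0, 0)`. This is what makes `Y₂, Y₃, Y₄` usable
as a regular sequence. -/
theorem f4_notMem_span_X_image {s : Set (Fin 4)} (hs : 0 ∉ s) :
    f4 K ∉ Ideal.span (X '' s) := by
  have hle : Ideal.span (X '' s : Set (MvPolynomial (Fin 4) K)) ≤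
      RingHom.ker (eval (![1, 0, 0, 0] : Fin 4 → K)) := by
    rw [Ideal.span_le]
    rintro _ ⟨i, hi, rfl⟩
    fin_cases i
    · exact absurd hi hs
    all_goals simp [RingHom.mem_ker]
  intro h
  have := hle h
  simp [f4, RingHom.mem_ker] at this

theorem constantCoeff_eq_zero_of_mem_span_X_image {s : Set (Fin 4)} {p : MvPolynomial (Fin 4) K}
    (hp : p ∈ Ideal.span (X '' s)) : constantCoeff p = 0 := by
  have hle : Ideal.span (X '' s : Set (MvPolynomial (Fin 4) K)) ≤
      RingHom.ker (constantCoeff : MvPolynomial (Fin 4) K →+* K) := by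
    rw [Ideal.span_le]
    rintro _ ⟨i, hi, rfl⟩
    simp [RingHom.mem_ker]
  exact hle hp

theorem mem_span_X_of_constantCoeff {p : MvPolynomial (Fin 4) K} (hp : constantCoeff p = 0) :
    p ∈ Ideal.span (Set.range (X : Fin 4 → MvPolynomial (Fin 4) K)) := by
  rw [← Set.image_univ, mem_ideal_span_X_image]
  intro m hm
  by_contra h
  push Not at h
  have : m = 0 := by ext i; simpa using h i trivial
  subst this
  exact (mem_support_iff.1 hm) hp

theorem constantCoeff_f4 : constantCoeff (f4 K) = 0 := by simp [f4]

theorem toR4_mem_irrelevantIdeal {p : MvPolynomial (Fin 4) K} :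
    toR4 K p ∈ irrelevantIdeal K ↔ constantCoeff p = 0 := by
  have hirr : irrelevantIdeal K =
      (Ideal.span (Set.range (X : Fin 4 → MvPolynomial (Fin 4) K))).map (toR4 K) := by
    rw [Ideal.map_span, ← Set.range_comp]; rfl
  constructor
  · rw [hirr, Ideal.mem_map_iff_of_surjective _ Ideal.Quotient.mk_surjective]
    rintro ⟨q, hq, hqp⟩
    rw [← Set.image_univ] at hq
    have h1 := constantCoeff_eq_zero_of_mem_span_X_image hq
    have h2 : toR4 K (p - q) = 0 := by rw [map_sub, hqp, sub_self]
    obtain ⟨r, hr⟩ := toR4_eq_zero.1 h2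
    have h3 := congrArg constantCoeff hr
    rw [map_sub, map_mul, h1, constantCoeff_f4, zero_mul, sub_zero] at h3
    exact h3
  · intro h
    rw [hirr]
    exact Ideal.mem_map_of_mem _ (mem_span_X_of_constantCoeff h)

theorem toR4_ne_zero_of_isHomZ {n : ℤ} {p : MvPolynomial (Fin 4) K} (hp : IsHomZ n p)
    (hn : n < 3) (h0 : p ≠ 0) : toR4 K p ≠ 0 := by
  rw [Ne, toR4_eq_zero]
  rintro ⟨q, rfl⟩
  have hf : f4 K ≠ 0 := left_ne_zero_of_mul h0
  have hq : q ≠ 0 := right_ne_zero_of_mul h0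
  have hf3 : (f4 K).totalDegree = 3 :=
    IsHomogeneous.totalDegree (isHomZ_natCast.1 (by exact_mod_cast isHomZ_f4)) hf
  rcases lt_or_ge n 0 with h | h
  · exact h0 (hp.eq_zero_of_neg h)
  lift n to ℕ using h
  have h1 := (isHomZ_natCast.1 hp).totalDegree h0
  rw [totalDegree_mul_of_isDomain hf hq, hf3] at h1
  omega

end Ideals

/-! ### Matrix factorizations: exactness, and regularity of variables on cokernels. -/

section MatrixFactorization

variable {K : Type*} [Field K] [CharZero K]
  {A B : Matrix (Fin 2) (Fin 2) (MvPolynomial (Fin 4) K)}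

/-- `(A, B)` is a matrix factorization of `f₄`. -/
def IsMF (A B : Matrix (Fin 2) (Fin 2) (MvPolynomial (Fin 4) K)) : Prop :=
  A * B = f4 K • (1 : Matrix (Fin 2) (Fin 2) (MvPolynomial (Fin 4) K)) ∧
    B * A = f4 K • (1 : Matrix (Fin 2) (Fin 2) (MvPolynomial (Fin 4) K))

omit [CharZero K] in
theorem IsMF.symm (h : IsMF A B) : IsMF B A := ⟨h.2, h.1⟩

omit [CharZero K] in
theorem isMF_phi_psi (p : Datum K) : IsMF (phi p) (psi p) := ⟨phi_mul_psi p, psi_mul_phi p⟩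

omit [CharZero K] in
theorem IsMF.mulVec_mulVec (h : IsMF A B) (v : Fin 2 → MvPolynomial (Fin 4) K) :
    A.mulVec (B.mulVec v) = f4 K • v := by
  rw [Matrix.mulVec_mulVec, h.1, Matrix.smul_mulVec, Matrix.one_mulVec]

omit [CharZero K] in
theorem map_mulVec_toR4 (A : Matrix (Fin 2) (Fin 2) (MvPolynomial (Fin 4) K))
    (v : Fin 2 → MvPolynomial (Fin 4) K) :
    (A.map (toR4 K)).mulVec (fun i => toR4 K (v i)) = fun i => toR4 K (A.mulVec v i) := by
  ext i
  simp [Matrix.mulVec, dotProduct]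

omit [CharZero K] in
theorem exists_lift_vec {m : ℕ} (v : Fin m → R4 K) :
    ∃ w : Fin m → MvPolynomial (Fin 4) K, v = fun i => toR4 K (w i) := by
  choose w hw using fun i => Ideal.Quotient.mk_surjective (I := Ideal.span {f4 K}) (v i)
  exact ⟨w, funext fun i => (hw i).symm⟩

omit [CharZero K] in
theorem IsMF.map_mulVec_mulVec (h : IsMF A B) (v : Fin 2 → R4 K) :
    (A.map (toR4 K)).mulVec ((B.map (toR4 K)).mulVec v) = 0 := by
  obtain ⟨w, rfl⟩ := exists_lift_vec v
  rw [map_mulVec_toR4, map_mulVec_toR4, h.mulVec_mulVec]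
  ext i
  simp only [Pi.smul_apply, smul_eq_mul, Pi.zero_apply]
  exact toR4_eq_zero.2 (dvd_mul_right _ _)

/-- The exactness of the periodic resolution defined by a matrix factorization. -/
theorem IsMF.exact (h : IsMF A B) {v : Fin 2 → R4 K} (hv : (A.map (toR4 K)).mulVec v = 0) :
    ∃ u, v = (B.map (toR4 K)).mulVec u := by
  obtain ⟨w, rfl⟩ := exists_lift_vec v
  rw [map_mulVec_toR4] at hv
  choose q hq using fun i => toR4_eq_zero.1 (congrFun hv i)
  have h1 : A.mulVec w = f4 K • q := funext hq
  -- With `A w = f4 q` in `S`, applying `B` gives `f4 w = f4 (B q)`, and `f4` cancels in `S`.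
  have h2 : f4 K • w = f4 K • B.mulVec q := by
    rw [← h.symm.mulVec_mulVec, h1, Matrix.mulVec_smul]
  have h3 : w = B.mulVec q := smul_right_injective _ (prime_f4 K).ne_zero h2
  refine ⟨fun i => toR4 K (q i), ?_⟩
  rw [map_mulVec_toR4, h3]

theorem IsMF.mulVec_eq_zero_iff (h : IsMF A B) {v : Fin 2 → R4 K} :
    (A.map (toR4 K)).mulVec v = 0 ↔ v ∈ LinearMap.range (B.map (toR4 K)).mulVecLin := by
  constructor
  · intro hv
    obtain ⟨u, rfl⟩ := h.exact hv
    exact ⟨u, rfl⟩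
  · rintro ⟨u, rfl⟩
    exact h.map_mulVec_mulVec u

omit [CharZero K] in
/-- The homogeneous elements of a cokernel are recognized after embedding it into a free module. -/
theorem mem_cokerGrading_iff {C : Matrix (Fin 2) (Fin 2) (MvPolynomial (Fin 4) K)}
    {δ δ' : Fin 2 → ℤ} {c : ℤ} (hC : IsHomMat δ' (fun j => δ j + c) C)
    (hex : ∀ v, (C.map (toR4 K)).mulVec v = 0 ↔ v ∈ LinearMap.range (A.map (toR4 K)).mulVecLin)
    (n : ℤ) (v : Fin 2 → R4 K) :
    (Submodule.Quotient.mk v : Coker A) ∈ cokerGrading A δ n ↔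
      (C.map (toR4 K)).mulVec v ∈ freeGrading K δ' (n + c) := by
  have hcomp : ∀ u, fcomp δ' (n + c) ((C.map (toR4 K)).mulVec u) =
      (C.map (toR4 K)).mulVec (fcomp δ n u) := fun u => by
    rw [hC.fcomp_mulVec]
    congr 1
    ext j
    rw [fcomp_apply, fcomp_apply, add_sub_add_right_eq_sub]
  constructor
  · rintro ⟨u, hu, huv⟩
    have h1 : u - v ∈ LinearMap.range (A.map (toR4 K)).mulVecLin :=
      (Submodule.Quotient.eq _).1 huv
    rw [← hex, Matrix.mulVec_sub, sub_eq_zero] at h1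
    rw [← h1, ← (isDecomp_fcomp δ).same n u hu, ← hcomp]
    exact (isDecomp_fcomp δ').mem _ _
  · intro hv
    refine ⟨fcomp δ n v, (isDecomp_fcomp δ).mem _ _, ?_⟩
    refine (Submodule.Quotient.eq _).2 ?_
    rw [← hex, Matrix.mulVec_sub, sub_eq_zero, ← hcomp]
    exact (isDecomp_fcomp δ').same _ _ hv

omit [CharZero K] in
theorem mk_eq_sum (v : Fin 2 → R4 K) :
    (Submodule.Quotient.mk v : Coker A) =
      ∑ i, v i • (Submodule.Quotient.mk (Pi.single i 1) : Coker A) := by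
  rw [← Submodule.mkQ_apply]
  conv_lhs => rw [pi_eq_sum_univ' v, map_sum]
  refine Finset.sum_congr rfl fun i _ => ?_
  rw [map_smul, Submodule.mkQ_apply]

-- Lifting to polynomials leaves error terms `f4 q`; they equal `A (B q)` and are absorbed in the
-- image of `A`.
omit [CharZero K] in
theorem mk_mem_smul_top_iff (h : IsMF A B) {J : Ideal (MvPolynomial (Fin 4) K)}
    {v : Fin 2 → MvPolynomial (Fin 4) K} :
    (Submodule.Quotient.mk (fun i => toR4 K (v i)) : Coker A) ∈
        (J.map (toR4 K) • ⊤ : Submodule (R4 K) (Coker A)) ↔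
      ∃ u w : Fin 2 → MvPolynomial (Fin 4) K, v = A.mulVec u + w ∧ ∀ i, w i ∈ J := by
  have hmk : ∀ (v u w : Fin 2 → MvPolynomial (Fin 4) K), v = A.mulVec u + w →
      (Submodule.Quotient.mk (fun i => toR4 K (v i)) : Coker A) =
        Submodule.Quotient.mk (fun i => toR4 K (w i)) := by
    rintro _ u w rfl
    refine (Submodule.Quotient.eq _).2 ⟨fun i => toR4 K (u i), ?_⟩
    rw [Matrix.mulVecLin_apply, map_mulVec_toR4]
    ext i
    simp
  constructor
  · suffices H : ∀ x ∈ (J.map (toR4 K) • ⊤ : Submodule (R4 K) (Coker A)),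
        ∃ w : Fin 2 → MvPolynomial (Fin 4) K, (∀ i, w i ∈ J) ∧
          x = Submodule.Quotient.mk (fun i => toR4 K (w i)) by
      intro hv
      obtain ⟨w, hw, hvw⟩ := H _ hv
      obtain ⟨u, hu⟩ := (Submodule.Quotient.eq _).1 hvw
      obtain ⟨u, rfl⟩ := exists_lift_vec u
      rw [Matrix.mulVecLin_apply, map_mulVec_toR4] at hu
      have h1 : ∀ i, ∃ q, v i - w i - A.mulVec u i = f4 K * q := fun i => by
        rw [← dvd_def, ← toR4_eq_zero, map_sub, map_sub]
        have := congrFun hu i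
        simp only [Pi.sub_apply] at this
        rw [← this, sub_self]
      choose q hq using h1
      refine ⟨u + B.mulVec q, w, ?_, hw⟩
      rw [Matrix.mulVec_add, h.mulVec_mulVec]
      ext1 i
      have := hq i
      simp only [Pi.add_apply, Pi.smul_apply, smul_eq_mul]
      linear_combination this
    intro x hx
    refine Submodule.smul_induction_on hx ?_ ?_
    · intro r hr x _
      obtain ⟨q, hq, rfl⟩ :=
        (Ideal.mem_map_iff_of_surjective _ Ideal.Quotient.mk_surjective).1 hr
      obtain ⟨y, rfl⟩ := Submodule.Quotient.mk_surjective _ x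
      obtain ⟨y, rfl⟩ := exists_lift_vec y
      refine ⟨fun i => q * y i, fun i => Ideal.mul_mem_right _ _ hq, ?_⟩
      rw [← Submodule.Quotient.mk_smul]
      congr 1
    · rintro _ _ ⟨w, hw, rfl⟩ ⟨w', hw', rfl⟩
      refine ⟨fun i => w i + w' i, fun i => add_mem (hw i) (hw' i), ?_⟩
      rw [← Submodule.Quotient.mk_add]
      congr 1
  · rintro ⟨u, w, hv, hw⟩
    have hsum : (Submodule.Quotient.mk (fun i => toR4 K (w i)) : Coker A) =
        ∑ i, toR4 K (w i) • (Submodule.Quotient.mk (Pi.single i 1) : Coker A) :=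
      mk_eq_sum _
    rw [hmk v u w hv, hsum]
    exact sum_mem fun i _ => Submodule.smul_mem_smul (Ideal.mem_map_of_mem _ (hw i)) trivial

theorem mulVec_mem_ideal {R : Type*} [CommRing R] {m k : ℕ} (A : Matrix (Fin m) (Fin k) R)
    {J : Ideal R} {w : Fin k → R} (hw : ∀ j, w j ∈ J) (i : Fin m) : A.mulVec w i ∈ J := by
  simp only [Matrix.mulVec, dotProduct]
  exact sum_mem fun j _ => Ideal.mul_mem_left _ _ (hw j)

-- With `J` generated by the variables of `s`, suppose `Y v = A u + w`, where `w ∈ J` and `Y = X k`.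
-- Applying `B` puts `f4 u` in the prime ideal `J + (Y)`, which does not contain `f4`; so `u = Y a +
-- b` with `b ∈ J`. Then `Y (v - A a)` lies in `J`, hence so does `v - A a`.
omit [CharZero K] in
theorem IsMF.smul_mem_imp (h : IsMF A B) {s : Set (Fin 4)} {k : Fin 4} (h0 : 0 ∉ s)
    (hk0 : k ≠ 0) (hks : k ∉ s) (x : Coker A)
    (hx : toR4 K (X k) • x ∈ ((Ideal.span (X '' s)).map (toR4 K) • ⊤ :
      Submodule (R4 K) (Coker A))) :
    x ∈ ((Ideal.span (X '' s)).map (toR4 K) • ⊤ : Submodule (R4 K) (Coker A)) := by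
  obtain ⟨v, rfl⟩ := Submodule.Quotient.mk_surjective _ x
  obtain ⟨v, rfl⟩ := exists_lift_vec v
  have hm : toR4 K (X k) • (Submodule.Quotient.mk (fun i => toR4 K (v i)) : Coker A) =
      Submodule.Quotient.mk (fun i => toR4 K (((X k : MvPolynomial (Fin 4) K) • v) i)) := by
    rw [← Submodule.Quotient.mk_smul]
    congr 1
  rw [hm, mk_mem_smul_top_iff h] at hx
  rw [mk_mem_smul_top_iff h]
  obtain ⟨u, w, hvu, hw⟩ := hx
  have hp := isPrime_span_X_image (K := K) (insert k s)
  have hle : Ideal.span (X '' s) ≤ Ideal.span (X '' insert k s : Set (MvPolynomial (Fin 4) K)) :=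
    Ideal.span_mono (Set.image_mono (Set.subset_insert k s))
  have hXk : (X k : MvPolynomial (Fin 4) K) ∈ Ideal.span (X '' insert k s) :=
    X_mem_span_X_image.2 (Set.mem_insert k s)
  have h1 : f4 K • u = (X k : MvPolynomial (Fin 4) K) • B.mulVec v - B.mulVec w := by
    rw [← h.symm.mulVec_mulVec, ← Matrix.mulVec_smul, hvu, Matrix.mulVec_add, add_sub_cancel_right]
  have h2 : ∀ i, u i ∈ Ideal.span (X '' insert k s) := fun i => by
    have h3 : f4 K * u i ∈ Ideal.span (X '' insert k s) := by
      have := congrFun h1 i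
      simp only [Pi.smul_apply, smul_eq_mul, Pi.sub_apply] at this
      rw [this]
      refine sub_mem (Ideal.mul_mem_right _ _ hXk) (hle ?_)
      exact mulVec_mem_ideal B hw i
    refine (hp.mem_or_mem h3).resolve_left (f4_notMem_span_X_image ?_)
    simp [h0, hk0.symm]
  have h4 : ∀ i, ∃ a b, b ∈ Ideal.span (X '' s) ∧ u i = X k * a + b := fun i => by
    have := h2 i
    rw [Set.image_insert_eq, Ideal.mem_span_insert] at this
    obtain ⟨a, b, hb, hu⟩ := this
    exact ⟨a, b, hb, by rw [hu, mul_comm]⟩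
  choose a b hb hu using h4
  have hu' : u = (X k : MvPolynomial (Fin 4) K) • a + b := funext hu
  refine ⟨a, v - A.mulVec a, by abel, fun i => ?_⟩
  have h5 : X k * (v - A.mulVec a) i ∈ Ideal.span (X '' s) := by
    have h6 : (X k : MvPolynomial (Fin 4) K) • (v - A.mulVec a) = A.mulVec b + w := by
      rw [smul_sub, hvu, hu', Matrix.mulVec_add, Matrix.mulVec_smul]
      abel
    have := congrFun h6 i
    simp only [Pi.smul_apply, smul_eq_mul, Pi.add_apply] at this
    rw [this]
    exact add_mem (mulVec_mem_ideal A hb i) (hw i)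
  exact ((isPrime_span_X_image s).mem_or_mem h5).resolve_left
    fun h => hks (X_mem_span_X_image.1 h)

end MatrixFactorization

end FermatCubic

namespace FermatCubic

open MvPolynomial

/-! ### Cokernels of matrix factorizations: depth, number of generators, rank. -/

section Cokernels

variable {K : Type*} [Field K] [CharZero K]
  {A B : Matrix (Fin 2) (Fin 2) (MvPolynomial (Fin 4) K)}

/-- The entries of `A` have no constant terms. -/
def IsMinimal {m k : ℕ} (A : Matrix (Fin m) (Fin k) (MvPolynomial (Fin 4) K)) : Prop :=
  ∀ i j, constantCoeff (A i j) = 0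

omit [CharZero K] in
theorem isMinimal_phi (p : Datum K) : IsMinimal (phi p) := by
  intro i j
  fin_cases i <;> fin_cases j <;> simp [phi]

omit [CharZero K] in
theorem isMinimal_psi (p : Datum K) : IsMinimal (psi p) := by
  intro i j
  fin_cases i <;> fin_cases j <;> simp [psi]

omit [CharZero K] in
theorem IsMinimal.constantCoeff_mulVec {m k : ℕ}
    {A : Matrix (Fin m) (Fin k) (MvPolynomial (Fin 4) K)} (h : IsMinimal A)
    (v : Fin k → MvPolynomial (Fin 4) K) (i : Fin m) : constantCoeff (A.mulVec v i) = 0 := by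
  simp only [Matrix.mulVec, dotProduct, map_sum, map_mul, h i, zero_mul, Finset.sum_const_zero]

omit [CharZero K] in
theorem IsMF.isRegular (h : IsMF A B) (hA : IsMinimal A) :
    RingTheory.Sequence.IsRegular (Coker A) [toR4 K (X 1), toR4 K (X 2), toR4 K (X 3)] := by
  have h0 : (Ideal.ofList ([] : List (R4 K))) = (Ideal.span (X '' (∅ : Set (Fin 4)))).map (toR4 K) := by
    simp
  have h1 : (Ideal.ofList [toR4 K (X 1)]) = (Ideal.span (X '' ({1} : Set (Fin 4)))).map (toR4 K) := by
    simp [Ideal.map_span]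
  have h2 : (Ideal.ofList [toR4 K (X 1), toR4 K (X 2)]) =
      (Ideal.span (X '' ({1, 2} : Set (Fin 4)))).map (toR4 K) := by
    simp [Ideal.map_sup, Ideal.map_span, Set.image_insert_eq, Ideal.span_insert, Ideal.ofList_cons]
  have h3 : (Ideal.ofList [toR4 K (X 1), toR4 K (X 2), toR4 K (X 3)]) =
      (Ideal.span (X '' ({1, 2, 3} : Set (Fin 4)))).map (toR4 K) := by
    simp [Ideal.map_sup, Ideal.map_span, Set.image_insert_eq, Ideal.span_insert, Ideal.ofList_cons]
  refine ⟨⟨fun i hi => ?_⟩, ?_⟩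
  · rw [isSMulRegular_quotient_iff_mem_of_smul_mem]
    have hi3 : i < 3 := by simpa using hi
    interval_cases i
    · change ∀ x : Coker A, toR4 K (X 1) • x ∈ (Ideal.ofList ([] : List (R4 K)) • ⊤ : Submodule (R4 K) (Coker A)) → x ∈ (Ideal.ofList ([] : List (R4 K)) • ⊤ : Submodule (R4 K) (Coker A))
      rw [h0]
      exact fun x hx => h.smul_mem_imp (by simp) (by decide) (by simp) x hx
    · change ∀ x : Coker A, toR4 K (X 2) • x ∈ (Ideal.ofList [toR4 K (X 1)] • ⊤ : Submodule (R4 K) (Coker A)) → x ∈ (Ideal.ofList [toR4 K (X 1)] • ⊤ : Submodule (R4 K) (Coker A))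
      rw [h1]
      exact fun x hx => h.smul_mem_imp (by simp) (by decide) (by simp) x hx
    · change ∀ x : Coker A, toR4 K (X 3) • x ∈ (Ideal.ofList [toR4 K (X 1), toR4 K (X 2)] • ⊤ : Submodule (R4 K) (Coker A)) → x ∈ (Ideal.ofList [toR4 K (X 1), toR4 K (X 2)] • ⊤ : Submodule (R4 K) (Coker A))
      rw [h2]
      exact fun x hx => h.smul_mem_imp (by simp) (by decide) (by simp) x hx
  · rw [h3]
    intro htop
    have h4 : (Submodule.Quotient.mk (fun i => toR4 K ((fun _ => 1 : Fin 2 → MvPolynomial (Fin 4) K) i)) : Coker A) ∈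
        (⊤ : Submodule (R4 K) (Coker A)) := trivial
    rw [htop, mk_mem_smul_top_iff h] at h4
    obtain ⟨u, w, huw, hw⟩ := h4
    -- The quotient is nonzero: neither the image of `A` nor the ideal contributes a constant term.
    have h5 := congrArg constantCoeff (congrFun huw 0)
    rw [Pi.add_apply, map_add, hA.constantCoeff_mulVec,
      constantCoeff_eq_zero_of_mem_span_X_image (hw 0)] at h5
    simp at h5

theorem IsMF.isGradedMCM (h : IsMF A B) (hA : IsMinimal A) {δ ε : Fin 2 → ℤ}
    (hδ : IsHomMat δ ε A) : IsGradedMCM (K := K) (cokerGrading A δ) := by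
  refine ⟨hδ.isGrading_coker, inferInstance, _, ?_, ?_, h.isRegular hA⟩
  · intro r hr
    simp only [List.mem_cons, List.not_mem_nil, or_false] at hr
    rcases hr with rfl | rfl | rfl <;> exact toR4_mem_irrelevantIdeal.2 (constantCoeff_X _ _)
  · rw [ringKrullDim_R4]
    rfl

-- Modulo the irrelevant ideal the cokernel is `K²`; a single generator would make both basis
-- vectors of `K²` multiples of one vector.
omit [CharZero K] in
theorem IsMinimal.not_isPrincipal (hA : IsMinimal A) :
    ¬ (⊤ : Submodule (R4 K) (Coker A)).IsPrincipal := by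
  rintro ⟨g, hg⟩
  obtain ⟨g, rfl⟩ := Submodule.Quotient.mk_surjective _ g
  obtain ⟨g, rfl⟩ := exists_lift_vec g
  have key : ∀ i : Fin 2, ∃ c : K, ∀ j, c * constantCoeff (g j) = if j = i then 1 else 0 := by
    intro i
    have h1 : (Submodule.Quotient.mk (fun j => toR4 K (if j = i then 1 else 0)) : Coker A) ∈
      (⊤ : Submodule (R4 K) (Coker A)) := trivial
    rw [hg, Submodule.mem_span_singleton] at h1
    obtain ⟨r, hr⟩ := h1
    obtain ⟨r, rfl⟩ := Ideal.Quotient.mk_surjective r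
    rw [← Submodule.Quotient.mk_smul, Submodule.Quotient.eq] at hr
    obtain ⟨u, hu⟩ := hr
    obtain ⟨u, rfl⟩ := exists_lift_vec u
    rw [Matrix.mulVecLin_apply, map_mulVec_toR4] at hu
    refine ⟨constantCoeff r, fun j => ?_⟩
    have h2 : toR4 K (A.mulVec u j - (r * g j - if j = i then 1 else 0)) = 0 := by
      have := congrFun hu j
      simp only [Pi.sub_apply, Pi.smul_apply, smul_eq_mul] at this
      rw [map_sub, map_sub, map_mul, this, sub_self]
    have h3 : constantCoeff (A.mulVec u j - (r * g j - if j = i then 1 else 0)) = 0 :=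
      toR4_mem_irrelevantIdeal.1 (h2 ▸ zero_mem _)
    rw [map_sub, hA.constantCoeff_mulVec, map_sub, map_mul, zero_sub, neg_sub, sub_eq_zero] at h3
    rw [← h3]
    split_ifs <;> simp
  obtain ⟨c, hc⟩ := key 0
  obtain ⟨d, hd⟩ := key 1
  have h0 := hc 0
  have h1 := hc 1
  have h2 := hd 1
  simp only [if_true, one_ne_zero, if_false, mul_eq_zero] at h0 h1 h2
  rcases h1 with h1 | h1
  · rw [h1, zero_mul] at h0; exact zero_ne_one h0
  · rw [h1, mul_zero] at h2; exact zero_ne_one h2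

omit [CharZero K] in
theorem IsMinimal.spanFinrank_coker (hA : IsMinimal A) :
    (⊤ : Submodule (R4 K) (Coker A)).spanFinrank = 2 := by
  apply le_antisymm
  · have h1 : (⊤ : Submodule (R4 K) (Coker A)) = Submodule.span (R4 K)
        (Set.range fun i : Fin 2 => (Submodule.Quotient.mk (Pi.single i 1) : Coker A)) := by
      rw [eq_comm, eq_top_iff]
      rintro x -
      obtain ⟨v, rfl⟩ := Submodule.Quotient.mk_surjective _ x
      rw [mk_eq_sum]
      exact sum_mem fun i _ => Submodule.smul_mem _ _ (Submodule.subset_span ⟨i, rfl⟩)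
    rw [h1]
    refine (Submodule.spanFinrank_span_le_ncard_of_finite (Set.finite_range _)).trans ?_
    rw [← Set.image_univ]
    exact (Set.ncard_image_le).trans (by simp)
  · by_contra hlt
    have hfg : (⊤ : Submodule (R4 K) (Coker A)).FG := Module.Finite.fg_top
    have : (⊤ : Submodule (R4 K) (Coker A)).spanFinrank = 0 ∨
      (⊤ : Submodule (R4 K) (Coker A)).spanFinrank = 1 := by omega
    rcases this with h | h
    · rw [Submodule.spanFinrank_eq_zero_iff_eq_bot hfg] at h
      exact hA.not_isPrincipal (h ▸ inferInstance)
    · exact hA.not_isPrincipal ((Submodule.spanFinrank_eq_one_iff _).1 h).1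

/-- Over the domain `R4` the matrix `B` is singular with nonzero corner, so a vector killed by its
first row is killed by `B`. By exactness that row embeds `Coker A` in `R4`, with nonzero image. -/
theorem IsMF.rank_coker (h : IsMF A B) (hB : toR4 K (B 0 0) ≠ 0) (hdet : toR4 K B.det = 0) :
    Module.rank (R4 K) (Coker A) = 1 := by
  let row : (Fin 2 → R4 K) →ₗ[R4 K] R4 K :=
    (LinearMap.proj 0).comp (B.map (toR4 K)).mulVecLin
  have hrow : ∀ v, row v = (B.map (toR4 K)).mulVec v 0 := fun v => rfl
  have hker : LinearMap.range (A.map (toR4 K)).mulVecLin = LinearMap.ker row := by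
    ext v
    rw [← h.symm.mulVec_eq_zero_iff, LinearMap.mem_ker, hrow]
    constructor
    · intro hv; rw [hv]; rfl
    · intro hv
      ext i
      fin_cases i
      · exact hv
      · rw [Matrix.det_fin_two, map_sub, map_mul, map_mul] at hdet
        simp only [Matrix.mulVec, dotProduct, Fin.sum_univ_two, Matrix.map_apply] at hv
        have : toR4 K (B 0 0) * (toR4 K (B 1 0) * v 0 + toR4 K (B 1 1) * v 1) = 0 := by
          linear_combination toR4 K (B 1 0) * hv + v 1 * hdet
        simpa [Matrix.mulVec, dotProduct, Fin.sum_univ_two] using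
          (mul_eq_zero.1 this).resolve_left hB
  let ι : Coker A →ₗ[R4 K] R4 K := Submodule.liftQ _ row hker.le
  have hι : Function.Injective ι := by
    rw [← LinearMap.ker_eq_bot]
    exact Submodule.ker_liftQ_eq_bot _ _ _ hker.ge
  apply le_antisymm
  · have := LinearMap.rank_le_of_injective ι hι
    rwa [Module.rank_self] at this
  · rw [Cardinal.one_le_iff_pos]
    have : Module.IsTorsionFree (R4 K) (Coker A) := hι.moduleIsTorsionFree _ (map_smul ι)
    rw [rank_pos_iff_exists_ne_zero]
    refine ⟨Submodule.Quotient.mk (Pi.single 0 1), fun h0 => hB ?_⟩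
    have h1 : ι (Submodule.Quotient.mk (Pi.single 0 1)) = row (Pi.single 0 1) := rfl
    rw [h0, map_zero, hrow] at h1
    simpa using h1.symm

omit [CharZero K] in
theorem det_phi (p : Datum K) : (phi p).det = f4 K := by
  have h := congrFun (congrFun (phi_mul_psi p) 0) 0
  simp only [Matrix.mul_apply, Fin.sum_univ_two, Matrix.smul_apply, Matrix.one_apply_eq,
    smul_eq_mul, mul_one] at h
  rw [← h, Matrix.det_fin_two]
  simp [phi, psi]
  ring

omit [CharZero K] in
theorem det_psi (p : Datum K) : (psi p).det = f4 K := by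
  rw [← det_phi p, Matrix.det_fin_two, Matrix.det_fin_two]
  simp [phi, psi]
  ring

omit [CharZero K] in
theorem Datum.s_ne_zero (p : Datum K) : p.s ≠ 0 := by
  rcases p.cases with ⟨-, -, h⟩ | ⟨-, -, h⟩ | ⟨-, -, h⟩ <;> rw [h] <;> decide

theorem rank_coker_phi (p : Datum K) : Module.rank (R4 K) (Coker (phi p)) = 1 := by
  refine (isMF_phi_psi p).rank_coker
    (toR4_ne_zero_of_isHomZ (isHomMat_psi p 0 0) (by simp) fun h => ?_)
    (toR4_eq_zero.2 (det_psi p ▸ dvd_rfl))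
  have := congrArg (eval (Pi.single 0 1 : Fin 4 → K)) h
  simp [psi, p.s_ne_zero] at this

theorem rank_coker_psi (p : Datum K) : Module.rank (R4 K) (Coker (psi p)) = 1 := by
  refine (isMF_phi_psi p).symm.rank_coker
    (toR4_ne_zero_of_isHomZ (isHomMat_phi p 0 0) (by simp) fun h => ?_)
    (toR4_eq_zero.2 (det_phi p ▸ dvd_rfl))
  have := congrArg (eval (Pi.single 0 1 : Fin 4 → K)) h
  simp [phi, p.s_ne_zero] at this

/-- A free module of rank one would need only one generator. -/
theorem IsMinimal.not_free (hA : IsMinimal A) (h : Module.rank (R4 K) (Coker A) = 1) :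
    ¬ Module.Free (R4 K) (Coker A) := by
  intro hf
  have h1 := Module.finrank_eq_spanFinrank_of_free (R := R4 K) (M := Coker A)
  rw [hA.spanFinrank_coker, Module.finrank, h] at h1
  norm_num at h1

end Cokernels

/-! ### Syzygies and duals. -/

section SyzygyDual

variable {K : Type*} [Field K] [CharZero K]

omit [CharZero K] in
theorem range_le_smul_top {A : Matrix (Fin 2) (Fin 2) (MvPolynomial (Fin 4) K)}
    (hA : IsMinimal A) : LinearMap.range (A.map (toR4 K)).mulVecLin ≤
      irrelevantIdeal K • (⊤ : Submodule (R4 K) (Fin 2 → R4 K)) := by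
  rintro _ ⟨u, rfl⟩
  rw [Matrix.mulVecLin_apply]
  have h1 : ∀ i, (A.map (toR4 K)).mulVec u i ∈ irrelevantIdeal K := fun i => by
    simp only [Matrix.mulVec, dotProduct, Matrix.map_apply]
    exact sum_mem fun j _ => Ideal.mul_mem_right _ _ (toR4_mem_irrelevantIdeal.2 (hA i j))
  rw [pi_eq_sum_univ' ((A.map (toR4 K)).mulVec u)]
  exact sum_mem fun i _ => Submodule.smul_mem_smul (h1 i) trivial

/-- The kernel of the obvious cover is the image of `psi`, which is `R4²` modulo `ker psi = im phi`.
-/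
theorem isFirstSyzygy_phi_psi (p : Datum K) :
    IsFirstSyzygy (K := K) (phiGrading p) (psiGrading p) := by
  refine ⟨2, ![0, 1], Submodule.mkQ _, Submodule.mkQ_surjective _, fun k => ?_, ?_, ?_⟩
  · refine ⟨Pi.single k 1, mem_freeGrading.2 fun i => ?_, rfl⟩
    by_cases hik : i = k
    · subst hik
      rw [sub_self, Pi.single_eq_same, ← map_one (toR4 K)]
      exact isHomZ_one.toR4_mem
    · rw [Pi.single_eq_of_ne hik]
      exact zero_mem _
  · rw [Submodule.ker_mkQ]
    exact range_le_smul_top (isMinimal_psi p)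
  · apply GradedIso.symm
    have hex := fun v => (isMF_phi_psi p).symm.mulVec_eq_zero_iff (v := v)
    let e : Coker (phi p) ≃ₗ[R4 K] LinearMap.ker
        (Submodule.mkQ (LinearMap.range ((psi p).map (toR4 K)).mulVecLin)) :=
      (Submodule.quotEquivOfEq _ (LinearMap.ker ((psi p).map (toR4 K)).mulVecLin)
        (by ext v; rw [← hex]; rfl)).trans
      ((LinearMap.quotKerEquivRange _).trans (LinearEquiv.ofEq _ _ (Submodule.ker_mkQ _).symm))
    have he : ∀ v, (e (Submodule.Quotient.mk v) : Fin 2 → R4 K) =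
        ((psi p).map (toR4 K)).mulVec v := fun v => rfl
    -- Both columns of `psi` have degree 2.
    refine ⟨2, e, fun n x => ?_⟩
    obtain ⟨v, rfl⟩ := Submodule.Quotient.mk_surjective _ x
    rw [mem_cokerGrading_iff (C := psi p) (δ' := ![0, 1]) (c := 2) ?_ hex, ← he]
    · rfl
    · intro i j
      refine (isHomMat_psi p i j).congr ?_
      fin_cases j <;> simp

/-- The matrix of the pairing `(u, v) ↦ det (u, φ v)`. -/
noncomputable def pairingMatrix (p : Datum K) : Matrix (Fin 2) (Fin 2) (MvPolynomial (Fin 4) K) :=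
  !![phi p 1 0, -phi p 0 0; phi p 1 1, -phi p 0 1]

/-- The pairing matrix is `phiᵀ J` with `J` the matrix of a quarter turn. Its companion factor has
the columns of `phi`, swapped and up to sign, so exactness identifies the kernel with the image of
`phi`. -/
theorem pairingMatrix_mulVec_eq_zero_iff (p : Datum K) (v : Fin 2 → R4 K) :
    ((pairingMatrix p).map (toR4 K)).mulVec v = 0 ↔
      v ∈ LinearMap.range ((phi p).map (toR4 K)).mulVecLin := by
  have hdet := det_phi p
  rw [Matrix.det_fin_two] at hdet
  have hmf : IsMF (pairingMatrix p) !![-phi p 0 1, phi p 0 0; -phi p 1 1, phi p 1 0] := by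
    constructor <;> rw [← hdet] <;> ext i j : 1 <;> fin_cases i <;> fin_cases j <;>
      simp [pairingMatrix, Matrix.mul_apply, Fin.sum_univ_two] <;> ring
  rw [hmf.mulVec_eq_zero_iff]
  constructor
  · rintro ⟨u, rfl⟩
    refine ⟨![u 1, -u 0], ?_⟩
    ext i
    fin_cases i <;> simp [Matrix.mulVec, dotProduct, Fin.sum_univ_two] <;> ring_nf
  · rintro ⟨u, rfl⟩
    refine ⟨![-u 1, u 0], ?_⟩
    ext i
    fin_cases i <;> simp [Matrix.mulVec, dotProduct, Fin.sum_univ_two] <;> ring_nf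

omit [CharZero K] in
theorem dual_ext {A : Matrix (Fin 2) (Fin 2) (MvPolynomial (Fin 4) K)}
    {g h : Module.Dual (R4 K) (Coker A)}
    (H : ∀ i, g (Submodule.Quotient.mk (Pi.single i 1)) =
      h (Submodule.Quotient.mk (Pi.single i 1))) : g = h := by
  refine LinearMap.ext fun x => ?_
  obtain ⟨v, rfl⟩ := Submodule.Quotient.mk_surjective _ x
  rw [mk_eq_sum, map_sum, map_sum]
  refine Finset.sum_congr rfl fun i _ => ?_
  rw [map_smul, map_smul, H]

/-- The functional on `Coker ψ` with values `w`, for `ψᵀ w = 0`. -/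
noncomputable def functional (A : Matrix (Fin 2) (Fin 2) (MvPolynomial (Fin 4) K))
    (w : Fin 2 → R4 K) (hw : ∀ x, ∑ i, (A.map (toR4 K)).mulVec x i * w i = 0) :
    Module.Dual (R4 K) (Coker A) :=
  Submodule.liftQ _ (Fintype.linearCombination (R4 K) w) (by
    rintro _ ⟨x, rfl⟩
    exact hw x)

omit [CharZero K] in
theorem functional_mk_single (A : Matrix (Fin 2) (Fin 2) (MvPolynomial (Fin 4) K))
    (w : Fin 2 → R4 K) (hw) (i : Fin 2) :
    functional A w hw (Submodule.Quotient.mk (Pi.single i 1)) = w i := by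
  change Fintype.linearCombination (R4 K) w (Pi.single i 1) = _
  rw [Fintype.linearCombination_apply_single, one_smul]

omit [CharZero K] in
theorem sum_psi_mulVec_mul_pairingMatrix_mulVec (p : Datum K) (x u : Fin 2 → R4 K) :
    ∑ i, ((psi p).map (toR4 K)).mulVec x i * ((pairingMatrix p).map (toR4 K)).mulVec u i = 0 := by
  obtain ⟨u, rfl⟩ := exists_lift_vec u
  obtain ⟨x, rfl⟩ := exists_lift_vec x
  rw [map_mulVec_toR4, map_mulVec_toR4, Fin.sum_univ_two, ← map_mul, ← map_mul, ← map_add,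
    toR4_eq_zero]
  -- The sum is `xᵀ (phi psi)ᵀ J u = f4 · xᵀ J u`, and this is `xᵀ J u`.
  refine ⟨x 0 * -u 1 + x 1 * u 0, ?_⟩
  have h := det_phi p
  rw [Matrix.det_fin_two] at h
  rw [← h]
  simp only [pairingMatrix, Matrix.mulVec, dotProduct, Fin.sum_univ_two, phi, psi,
    Matrix.of_apply, Matrix.cons_val', Matrix.cons_val_zero, Matrix.cons_val_one,
    Matrix.cons_val_fin_one]
  ring

/-- The functionals on `Coker ψ` defined by `pairingMatrix`. -/
noncomputable def pairing (p : Datum K) :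
    (Fin 2 → R4 K) →ₗ[R4 K] Module.Dual (R4 K) (Coker (psi p)) where
  toFun u := functional (psi p) (((pairingMatrix p).map (toR4 K)).mulVec u)
    fun x => sum_psi_mulVec_mul_pairingMatrix_mulVec p x u
  map_add' u v := dual_ext fun i => by
    rw [LinearMap.add_apply]
    simp only [functional_mk_single, Matrix.mulVec_add, Pi.add_apply]
  map_smul' r u := dual_ext fun i => by
    rw [LinearMap.smul_apply]
    simp only [functional_mk_single, Matrix.mulVec_smul, Pi.smul_apply, RingHom.id_apply]

omit [CharZero K] in
theorem pairing_mk_single (p : Datum K) (u : Fin 2 → R4 K) (i : Fin 2) :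
    pairing p u (Submodule.Quotient.mk (Pi.single i 1)) =
      ((pairingMatrix p).map (toR4 K)).mulVec u i :=
  functional_mk_single _ _ (fun x => sum_psi_mulVec_mul_pairingMatrix_mulVec p x u) i

theorem pairing_eq_zero_iff (p : Datum K) (u : Fin 2 → R4 K) :
    pairing p u = 0 ↔ u ∈ LinearMap.range ((phi p).map (toR4 K)).mulVecLin := by
  rw [← pairingMatrix_mulVec_eq_zero_iff]
  constructor
  · intro h
    ext i
    rw [← pairing_mk_single, h]; rfl
  · intro h
    refine dual_ext fun i => ?_
    rw [pairing_mk_single, h]; rfl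

/-- The values `w` of a functional on the generators satisfy `psiᵀ w = 0`. Exactness of the
transposed factorization gives `w = phiᵀ y`, which is the pairing matrix applied to `J⁻¹ y`. -/
theorem pairing_surjective (p : Datum K) : Function.Surjective (pairing p) := by
  intro h
  let w : Fin 2 → R4 K := fun i => h (Submodule.Quotient.mk (Pi.single i 1))
  have hmf : IsMF (psi p).transpose (phi p).transpose := by
    constructor
    · rw [← Matrix.transpose_mul, phi_mul_psi, Matrix.transpose_smul, Matrix.transpose_one]
    · rw [← Matrix.transpose_mul, psi_mul_phi, Matrix.transpose_smul, Matrix.transpose_one]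
  have hw : ((psi p).transpose.map (toR4 K)).mulVec w = 0 := by
    ext i
    have h1 : (Submodule.Quotient.mk (((psi p).map (toR4 K)).mulVec (Pi.single i 1)) :
        Coker (psi p)) = 0 := (Submodule.Quotient.mk_eq_zero _).2 ⟨_, rfl⟩
    have h2 := congrArg h h1
    rw [mk_eq_sum, map_sum, map_zero] at h2
    simp only [map_smul, smul_eq_mul] at h2
    rw [Pi.zero_apply, ← h2]
    fin_cases i <;> simp [Matrix.mulVec, dotProduct, Fin.sum_univ_two, w]
  obtain ⟨y, hy⟩ := hmf.exact hw
  -- This vector is `J⁻¹ y`.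
  refine ⟨![y 1, -y 0], dual_ext fun i => ?_⟩
  rw [pairing_mk_single]
  change _ = w i
  rw [hy]
  fin_cases i <;> simp [Matrix.mulVec, dotProduct, Fin.sum_univ_two, pairingMatrix]
  · exact (congrArg₂ (· + ·) rfl (neg_mul_neg _ _)).trans (add_comm _ _)
  · exact (congrArg₂ (· + ·) rfl (neg_mul_neg _ _)).trans (add_comm _ _)

-- A functional is determined by its values on generators of degrees 0 and 1; the dual coordinates
-- therefore have degrees 0 and -1.
omit [CharZero K] in
theorem mem_dualGrading_iff (p : Datum K) (n : ℤ) (h : Module.Dual (R4 K) (Coker (psi p))) :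
    h ∈ dualGrading (K := K) (psiGrading p) n ↔
      (fun i => h (Submodule.Quotient.mk (Pi.single i 1))) ∈ freeGrading K ![0, -1] n := by
  rw [mem_freeGrading]
  constructor
  · intro hh i
    have := hh (![0, 1] i) (Submodule.Quotient.mk (Pi.single i 1)) ⟨Pi.single i 1, ?_, rfl⟩
    · convert this using 1
      fin_cases i <;> simp
    · refine mem_freeGrading.2 fun j => ?_
      by_cases hij : j = i
      · subst hij
        rw [sub_self, Pi.single_eq_same, ← map_one (toR4 K)]
        exact isHomZ_one.toR4_mem
      · rw [Pi.single_eq_of_ne hij]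
        exact zero_mem _
  · rintro hh k _ ⟨v, hv, rfl⟩
    change h (Submodule.Quotient.mk v) ∈ _
    rw [mk_eq_sum, map_sum]
    refine sum_mem fun i _ => ?_
    rw [map_smul, smul_eq_mul]
    have := mul_mem_homogeneousPart (mem_freeGrading.1 hv i) (hh i)
    convert this using 1
    fin_cases i <;> simp <;> ring_nf

theorem gradedIso_dual_psi_phi (p : Datum K) :
    GradedIso (K := K) (dualGrading (K := K) (psiGrading p)) (phiGrading p) := by
  apply GradedIso.symm
  let e : Coker (phi p) ≃ₗ[R4 K] Module.Dual (R4 K) (Coker (psi p)) :=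
    (Submodule.quotEquivOfEq _ (LinearMap.ker (pairing p))
      (by ext v; rw [LinearMap.mem_ker, pairing_eq_zero_iff])).trans
    ((pairing p).quotKerEquivOfSurjective (pairing_surjective p))
  have he : ∀ v, e (Submodule.Quotient.mk v) = pairing p v := fun v => rfl
  -- The rows of the pairing matrix have degrees 1 and 2; relative to target generators of degrees 0
  -- and -1 the map raises degrees by 1.
  refine ⟨1, e, fun n x => ?_⟩
  obtain ⟨v, rfl⟩ := Submodule.Quotient.mk_surjective _ x
  rw [mem_cokerGrading_iff (C := pairingMatrix p) (δ' := ![0, -1]) (c := 1) ?_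
    (pairingMatrix_mulVec_eq_zero_iff p), he, mem_dualGrading_iff]
  · simp only [pairing_mk_single]
  · intro i j
    have h := isHomMat_phi p
    fin_cases i <;> fin_cases j
    · exact (h 1 0).congr (by simp)
    · exact (h 0 0).neg.congr (by simp)
    · exact (h 1 1).congr (by simp)
    · exact (h 0 1).neg.congr (by simp)

end SyzygyDual

end FermatCubic

namespace FermatCubic

open MvPolynomial

/-! ### Linear parts as an invariant of cokernels and Fitting ideals. -/

section LinearParts

variable {K : Type*} [Field K]

/-- The coefficient vector of the linear part of a polynomial. -/
noncomputable def linPart (p : MvPolynomial (Fin 4) K) : Fin 4 → K :=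
  fun k => coeff (Finsupp.single k 1) p

theorem linPart_add (p q : MvPolynomial (Fin 4) K) : linPart (p + q) = linPart p + linPart q := by
  ext k; simp [linPart]

theorem linPart_sub (p q : MvPolynomial (Fin 4) K) : linPart (p - q) = linPart p - linPart q := by
  ext k; simp [linPart]

theorem linPart_neg (p : MvPolynomial (Fin 4) K) : linPart (-p) = -linPart p := by
  ext k; simp [linPart]

theorem linPart_sum {ι : Type*} (s : Finset ι) (p : ι → MvPolynomial (Fin 4) K) :
    linPart (∑ i ∈ s, p i) = ∑ i ∈ s, linPart (p i) := by
  ext k; simp [linPart, coeff_sum]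

/-- The product rule for the differential at the origin. Since `f4` has neither a constant nor a
linear part, linear parts are well defined on `R4`. -/
theorem linPart_mul (p q : MvPolynomial (Fin 4) K) :
    linPart (p * q) = constantCoeff p • linPart q + constantCoeff q • linPart p := by
  ext k
  have h : Finset.HasAntidiagonal.antidiagonal (Finsupp.single k 1 : Fin 4 →₀ ℕ) =
      {(0, Finsupp.single k 1), (Finsupp.single k 1, 0)} := by
    rw [Finsupp.antidiagonal_single]
    ext x
    simp [Finset.Nat.antidiagonal_succ, Prod.ext_iff]
  simp only [linPart, coeff_mul, h, Pi.add_apply, Pi.smul_apply, smul_eq_mul]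
  rw [Finset.sum_pair (by simp [Prod.ext_iff])]
  simp [constantCoeff_eq, mul_comm]

theorem IsHomZ.linPart_eq_zero {n : ℤ} {p : MvPolynomial (Fin 4) K} (hp : IsHomZ n p)
    (hn : n ≠ 1) : linPart p = 0 := by
  ext k
  by_contra h
  have := hp _ h
  simp at this
  exact hn this.symm

theorem linPart_f4_mul (q : MvPolynomial (Fin 4) K) : linPart (f4 K * q) = 0 := by
  rw [linPart_mul, constantCoeff_f4, isHomZ_f4.linPart_eq_zero (by norm_num)]
  simp

theorem linPart_congr {p q : MvPolynomial (Fin 4) K} (h : toR4 K p = toR4 K q) :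
    linPart p = linPart q := by
  rw [← sub_eq_zero, ← map_sub, toR4_eq_zero] at h
  obtain ⟨r, hr⟩ := h
  rw [← sub_eq_zero, ← linPart_sub, hr, linPart_f4_mul]

theorem constantCoeff_congr {p q : MvPolynomial (Fin 4) K} (h : toR4 K p = toR4 K q) :
    constantCoeff p = constantCoeff q := by
  rw [← sub_eq_zero, ← map_sub, toR4_eq_zero] at h
  obtain ⟨r, hr⟩ := h
  rw [← sub_eq_zero, ← map_sub, hr, map_mul, constantCoeff_f4, zero_mul]

theorem linPart_X_sub (c : K) (i j : Fin 4) :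
    linPart (X i - C c * X j) = Pi.single i 1 - c • Pi.single j 1 := by
  ext k
  simp [linPart, coeff_X, Pi.single_apply, Finsupp.single_left_inj, eq_comm]

variable {A B : Matrix (Fin 2) (Fin 2) (MvPolynomial (Fin 4) K)}

theorem exists_lift_hom (e : Coker A →ₗ[R4 K] Coker B) :
    ∃ U : Matrix (Fin 2) (Fin 2) (MvPolynomial (Fin 4) K), ∀ v,
      e (Submodule.Quotient.mk v) = Submodule.Quotient.mk ((U.map (toR4 K)).mulVec v) := by
  have h1 : ∀ j, ∃ u : Fin 2 → MvPolynomial (Fin 4) K,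
      e (Submodule.Quotient.mk (Pi.single j 1)) = Submodule.Quotient.mk fun i => toR4 K (u i) := by
    intro j
    obtain ⟨v, hv⟩ := Submodule.Quotient.mk_surjective _ (e (Submodule.Quotient.mk (Pi.single j 1)))
    obtain ⟨u, rfl⟩ := exists_lift_vec v
    exact ⟨u, hv.symm⟩
  choose u hu using h1
  refine ⟨Matrix.of fun i j => u j i, fun v => ?_⟩
  rw [mk_eq_sum, map_sum]
  simp only [map_smul, hu]
  rw [Fin.sum_univ_two, ← Submodule.Quotient.mk_smul, ← Submodule.Quotient.mk_smul,
    ← Submodule.Quotient.mk_add]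
  congr 1
  ext i
  simp only [Pi.add_apply, Pi.smul_apply, smul_eq_mul, Matrix.mulVec, dotProduct,
    Fin.sum_univ_two, Matrix.map_apply, Matrix.of_apply, mul_comm]

/-- An isomorphism between cokernels of minimal matrices relates the linear parts. -/
theorem exists_linPart_eq (hA : IsMinimal A) (hB : IsMinimal B) (e : Coker A ≃ₗ[R4 K] Coker B) :
    ∃ G G' H : Matrix (Fin 2) (Fin 2) K, G' * G = 1 ∧
      ∀ i j, ∑ l, G i l • linPart (A l j) = ∑ l, H l j • linPart (B i l) := by
  obtain ⟨U, hU⟩ := exists_lift_hom (e : Coker A →ₗ[R4 K] Coker B)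
  obtain ⟨U', hU'⟩ := exists_lift_hom (e.symm : Coker B →ₗ[R4 K] Coker A)
  -- The lift `U` of `e` carries the columns of `A` into the image of `B`: `U A = B V` modulo `f4`.
  have h1 : ∀ j, ∃ v : Fin 2 → MvPolynomial (Fin 4) K, ∀ i,
      toR4 K (∑ l, U i l * A l j) = toR4 K (∑ l, B i l * v l) := by
    intro j
    have h0 : (Submodule.Quotient.mk ((A.map (toR4 K)).mulVec (Pi.single j 1)) : Coker A) = 0 :=
      (Submodule.Quotient.mk_eq_zero _).2 ⟨_, rfl⟩
    have h2 := hU ((A.map (toR4 K)).mulVec (Pi.single j 1))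
    rw [h0, map_zero, eq_comm, Submodule.Quotient.mk_eq_zero] at h2
    obtain ⟨v, hv⟩ := h2
    obtain ⟨v, rfl⟩ := exists_lift_vec v
    refine ⟨v, fun i => ?_⟩
    have := congrFun hv i
    rw [Matrix.mulVecLin_apply, map_mulVec_toR4] at this
    change toR4 K (B.mulVec v i) = _ at this
    rw [show ∑ l, B i l * v l = B.mulVec v i from rfl, this, Matrix.mulVec_single_one]
    simp [Matrix.mulVec, dotProduct]
  choose v hv using h1
  refine ⟨U.map constantCoeff, U'.map constantCoeff, Matrix.of fun l j => constantCoeff (v j l),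
    ?_, fun i j => ?_⟩
  · ext i j
    have h2 : e.symm (e (Submodule.Quotient.mk (Pi.single j 1))) =
        Submodule.Quotient.mk (Pi.single j 1) := e.symm_apply_apply _
    have h3 := hU (Pi.single j 1)
    rw [LinearEquiv.coe_coe] at h3
    have h4 := hU' ((U.map (toR4 K)).mulVec (Pi.single j 1))
    rw [LinearEquiv.coe_coe] at h4
    rw [h3, h4, Submodule.Quotient.eq] at h2
    obtain ⟨w, hw⟩ := h2
    obtain ⟨w, rfl⟩ := exists_lift_vec w
    have h5 := congrFun hw i
    rw [Matrix.mulVecLin_apply, map_mulVec_toR4, Matrix.mulVec_single_one] at h5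
    change toR4 K (A.mulVec w i) = _ at h5
    have h6 : toR4 K (A.mulVec w i) =
        toR4 K (∑ l, U' i l * U l j - (1 : Matrix (Fin 2) (Fin 2) (MvPolynomial (Fin 4) K)) i j) := by
      rw [h5, map_sub, Pi.sub_apply]
      refine congrArg₂ (· - ·) ?_ ?_
      · simp [Matrix.mulVec, dotProduct]
      · rw [Matrix.one_apply, Pi.single_apply]
        split_ifs <;> simp
    -- `U' U - 1` has columns in the image of `A` modulo `f4`, so its constant terms vanish.
    have h7 := constantCoeff_congr h6
    rw [hA.constantCoeff_mulVec, map_sub, eq_comm, sub_eq_zero] at h7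
    rw [Matrix.mul_apply]
    simp only [map_sum, map_mul] at h7
    simp only [Matrix.map_apply]
    rw [h7, Matrix.one_apply, Matrix.one_apply]
    split_ifs <;> simp
  -- As `A` and `B` have no constant terms, only the constant terms of `U` and `V` enter the linear
  -- part of `U A = B V`.
  · have h2 := linPart_congr (hv j i)
    rw [linPart_sum, linPart_sum] at h2
    simp only [linPart_mul, hA _ _, hB _ _, zero_smul, add_zero, zero_add] at h2
    exact h2

theorem mem_fittingIdeal_one (A : Matrix (Fin 2) (Fin 2) (MvPolynomial (Fin 4) K)) (i j : Fin 2) :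
    toR4 K (A i j) ∈ fittingIdeal (A.map (toR4 K)) 1 := by
  refine Ideal.subset_span ⟨(fun _ => i, fun _ => j), ?_⟩
  change Matrix.det (n := Fin 1) _ = _
  rw [Matrix.det_fin_one]
  rfl

/-- A multiple `a x` of an element without constant term has linear part `a(0)` times that of `x`,
so passing to the ideal adds no new linear parts. -/
theorem linPart_mem_span_of_mem_fittingIdeal (hB : IsMinimal B) {x : MvPolynomial (Fin 4) K}
    (hx : toR4 K x ∈ fittingIdeal (B.map (toR4 K)) 1) :
    linPart x ∈ Submodule.span K (Set.range fun ij : Fin 2 × Fin 2 => linPart (B ij.1 ij.2)) := by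
  suffices H : ∀ r ∈ fittingIdeal (B.map (toR4 K)) 1, ∃ x, toR4 K x = r ∧ constantCoeff x = 0 ∧
      linPart x ∈ Submodule.span K (Set.range fun ij : Fin 2 × Fin 2 => linPart (B ij.1 ij.2)) by
    obtain ⟨y, hy, -, h⟩ := H _ hx
    rwa [← linPart_congr hy]
  intro r hr
  induction hr using Submodule.span_induction with
  | mem r hr =>
    obtain ⟨⟨rows, cols⟩, rfl⟩ := hr
    refine ⟨B (rows 0) (cols 0), ?_, hB _ _, Submodule.subset_span ⟨(rows 0, cols 0), rfl⟩⟩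
    change _ = Matrix.det (n := Fin 1) _
    rw [Matrix.det_fin_one]
    rfl
  | zero => exact ⟨0, by simp, by simp, by
      have : linPart (0 : MvPolynomial (Fin 4) K) = 0 := by ext; simp [linPart]
      rw [this]; exact zero_mem _⟩
  | add r s _ _ hr hs =>
    obtain ⟨x, rfl, hx, hx'⟩ := hr
    obtain ⟨y, rfl, hy, hy'⟩ := hs
    exact ⟨x + y, by simp, by simp [hx, hy], by rw [linPart_add]; exact add_mem hx' hy'⟩
  | smul a r _ hr =>
    obtain ⟨x, rfl, hx, hx'⟩ := hr
    obtain ⟨a, rfl⟩ := Ideal.Quotient.mk_surjective a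
    refine ⟨a * x, by simp, by simp [hx], ?_⟩
    rw [linPart_mul, hx, zero_smul, add_zero]
    exact Submodule.smul_mem _ _ hx'

end LinearParts

/-! ### Recovering the datum from a cokernel or a Fitting ideal. -/

section NonIsomorphic

variable {K : Type*} [Field K]

/-- The two linear forms among the entries of `φ`. -/
noncomputable def Datum.form (p : Datum K) : Fin 2 → Fin 4 → K :=
  ![Pi.single 0 1 - p.a • Pi.single p.s 1, Pi.single p.i 1 - p.b • Pi.single p.j 1]

theorem Datum.a_ne_zero (p : Datum K) : p.a ≠ 0 := fun h => by
  have := p.ha; simp [h] at this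

theorem Datum.b_ne_zero (p : Datum K) : p.b ≠ 0 := fun h => by
  have := p.hb; simp [h] at this

theorem Datum.form_independent (p : Datum K) {x y : K} (h : x • p.form 0 + y • p.form 1 = 0) :
    x = 0 ∧ y = 0 := by
  rcases p.cases with ⟨h1, h2, h3⟩ | ⟨h1, h2, h3⟩ | ⟨h1, h2, h3⟩ <;>
  · have e0 := congrFun h 0
    have e1 := congrFun h p.i
    simp [Datum.form, h1, h2, h3] at e0 e1
    exact ⟨e0, e1⟩

/-- The line defined by the two linear forms determines the datum. -/
theorem Datum.eq_of_form_mem {p q : Datum K}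
    (h : ∀ k, ∃ x y : K, p.form k = x • q.form 0 + y • q.form 1) : p = q := by
  obtain ⟨x, y, h0⟩ := h 0
  obtain ⟨z, w, h1⟩ := h 1
  have ha := p.a_ne_zero
  have hb := p.b_ne_zero
  have ha' := q.a_ne_zero
  have hb' := q.b_ne_zero
  have e0 := fun k => congrFun h0 k
  have e1 := fun k => congrFun h1 k
  have f0 := e0 0
  have f1 := e0 1
  have f2 := e0 2
  have f3 := e0 3
  have g0 := e1 0
  have g1 := e1 1
  have g2 := e1 2
  have g3 := e1 3
  clear e0 e1 h0 h1 h
  -- Nine pairs of index triples. Different triples contradict the nonvanishing of `a` and `b`; for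
  -- equal triples the coefficients give `a` and `b`.
  rcases p.cases with ⟨h1, h2, h3⟩ | ⟨h1, h2, h3⟩ | ⟨h1, h2, h3⟩ <;>
  rcases q.cases with ⟨h1', h2', h3'⟩ | ⟨h1', h2', h3'⟩ | ⟨h1', h2', h3'⟩ <;>
  simp [Datum.form, h1, h2, h3, h1', h2', h3'] at f0 f1 f2 f3 g0 g1 g2 g3 <;>
  first
  | (exfalso; grind)
  | (ext1
     · grind
     · grind
     · rw [h1, h1']
     · rw [h2, h2']
     · rw [h3, h3'])

theorem linPart_phi (p : Datum K) (i : Fin 2) :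
    linPart (phi p i 0) = p.form i ∧ linPart (phi p i 1) = 0 := by
  fin_cases i
  · exact ⟨linPart_X_sub _ _ _, (isHomMat_phi p 0 1).linPart_eq_zero (by simp)⟩
  · exact ⟨linPart_X_sub _ _ _, (isHomMat_phi p 1 1).linPart_eq_zero (by simp)⟩

theorem linPart_psi_zero (p : Datum K) (j : Fin 2) : linPart (psi p 0 j) = 0 := by
  refine (isHomMat_psi p 0 j).linPart_eq_zero ?_
  fin_cases j <;> simp

theorem linPart_psi_one_zero (p : Datum K) : linPart (psi p 1 0) = -p.form 1 := by
  change linPart (-(X p.i - C p.b * X p.j)) = _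
  rw [linPart_neg, linPart_X_sub]; rfl

theorem linPart_psi_one_one (p : Datum K) : linPart (psi p 1 1) = p.form 0 :=
  linPart_X_sub _ _ _

/-- The linear entries of `phi` form its first column, so `G` sends the forms of `p` to a multiple
of those of `q`; inverting `G` expresses the former by the latter. -/
theorem eq_of_coker_phi_equiv {p q : Datum K} (e : Coker (phi p) ≃ₗ[R4 K] Coker (phi q)) :
    p = q := by
  obtain ⟨G, G', H, hG, h⟩ := exists_linPart_eq (isMinimal_phi p) (isMinimal_phi q) e
  have h0 := h 0 0
  have h1 := h 1 0
  simp only [Fin.sum_univ_two, (linPart_phi _ _).1, (linPart_phi _ _).2, smul_zero,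
    add_zero] at h0 h1
  refine Datum.eq_of_form_mem fun k => ⟨G' k 0 * H 0 0, G' k 1 * H 0 0, ?_⟩
  rw [mul_smul, mul_smul, ← h0, ← h1]
  have h2 := fun l => congrFun (congrFun hG k) l
  simp only [Matrix.mul_apply, Fin.sum_univ_two] at h2
  have h3 : G' k 0 • (G 0 0 • p.form 0 + G 0 1 • p.form 1) +
      G' k 1 • (G 1 0 • p.form 0 + G 1 1 • p.form 1) =
      (G' k 0 * G 0 0 + G' k 1 * G 1 0) • p.form 0 +
      (G' k 0 * G 0 1 + G' k 1 * G 1 1) • p.form 1 := by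
    module
  rw [h3, h2 0, h2 1]
  fin_cases k <;> simp [Matrix.one_apply]

/-- The linear entries of `psi` form its second row. The first row of the relation forces `G 0 1 =
0`; invertibility then gives `G 1 1 ≠ 0`, and the second row can be divided by it. -/
theorem eq_of_coker_psi_equiv {p q : Datum K} (e : Coker (psi p) ≃ₗ[R4 K] Coker (psi q)) :
    p = q := by
  obtain ⟨G, G', H, hG, h⟩ := exists_linPart_eq (isMinimal_psi p) (isMinimal_psi q) e
  have h00 := h 0 1
  have h0 := h 1 1
  have h1 := h 1 0
  simp only [Fin.sum_univ_two, linPart_psi_zero, linPart_psi_one_zero, linPart_psi_one_one,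
    smul_zero, add_zero, zero_add] at h00 h0 h1
  have hG0 : G 0 1 = 0 := by
    refine (p.form_independent (x := G 0 1) (y := 0) ?_).1
    rw [h00, zero_smul, add_zero]
  have hG1 : G 1 1 ≠ 0 := by
    intro hG1
    have := congrFun (congrFun hG 1) 1
    simp [Matrix.mul_apply, Fin.sum_univ_two, hG0, hG1] at this
  refine Datum.eq_of_form_mem fun k => ?_
  fin_cases k
  · refine ⟨(G 1 1)⁻¹ * H 1 1, -((G 1 1)⁻¹ * H 0 1), smul_right_injective _ hG1 ?_⟩
    change G 1 1 • p.form 0 = G 1 1 • _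
    rw [h0, smul_add, smul_smul, smul_smul, mul_neg, mul_inv_cancel_left₀ hG1,
      mul_inv_cancel_left₀ hG1]
    module
  · refine ⟨-((G 1 1)⁻¹ * H 1 0), (G 1 1)⁻¹ * H 0 0, smul_right_injective _ hG1 ?_⟩
    change G 1 1 • p.form 1 = G 1 1 • _
    rw [← neg_inj, ← smul_neg, h1, smul_add, smul_smul, smul_smul, mul_neg,
      mul_inv_cancel_left₀ hG1, mul_inv_cancel_left₀ hG1]
    module

/-- The first row of `psi` has no linear part, so the independence of the two forms in the first
column of `phi` would make the first row of the invertible matrix `G` vanish. -/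
theorem isEmpty_coker_phi_equiv_coker_psi (p q : Datum K) :
    IsEmpty (Coker (phi p) ≃ₗ[R4 K] Coker (psi q)) := by
  refine ⟨fun e => ?_⟩
  obtain ⟨G, G', H, hG, h⟩ := exists_linPart_eq (isMinimal_phi p) (isMinimal_psi q) e
  have h0 := h 0 0
  simp only [Fin.sum_univ_two, (linPart_phi _ _).1, linPart_psi_zero, smul_zero, add_zero] at h0
  obtain ⟨h1, h2⟩ := p.form_independent h0
  have hG' : G * G' = 1 := mul_eq_one_comm.1 hG
  have := congrFun (congrFun hG' 0) 0
  simp [Matrix.mul_apply, Fin.sum_univ_two, h1, h2] at this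

theorem eq_of_fittingIdeal_phi {p q : Datum K}
    (h : fittingIdeal ((phi p).map (toR4 K)) 1 = fittingIdeal ((phi q).map (toR4 K)) 1) :
    p = q := by
  refine Datum.eq_of_form_mem fun k => ?_
  have h1 := linPart_mem_span_of_mem_fittingIdeal (isMinimal_phi q)
    (h ▸ mem_fittingIdeal_one (phi p) k 0)
  rw [(linPart_phi p k).1, Submodule.mem_span_range_iff_exists_fun] at h1
  obtain ⟨c, hc⟩ := h1
  refine ⟨c (0, 0), c (1, 0), ?_⟩
  rw [← hc, Fintype.sum_prod_type]
  simp [Fin.sum_univ_two, (linPart_phi _ _).1, (linPart_phi _ _).2]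

theorem eq_of_fittingIdeal_psi {p q : Datum K}
    (h : fittingIdeal ((psi p).map (toR4 K)) 1 = fittingIdeal ((psi q).map (toR4 K)) 1) :
    p = q := by
  have key : ∀ x, toR4 K x ∈ fittingIdeal ((psi q).map (toR4 K)) 1 →
      ∃ y z : K, linPart x = y • q.form 0 + z • q.form 1 := by
    intro x hx
    have h1 := linPart_mem_span_of_mem_fittingIdeal (isMinimal_psi q) hx
    rw [Submodule.mem_span_range_iff_exists_fun] at h1
    obtain ⟨c, hc⟩ := h1
    refine ⟨c (1, 1), -c (1, 0), ?_⟩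
    rw [← hc, Fintype.sum_prod_type]
    simp [Fin.sum_univ_two, linPart_psi_zero, linPart_psi_one_zero, linPart_psi_one_one, add_comm]
  refine Datum.eq_of_form_mem fun k => ?_
  fin_cases k
  · have := key _ (h ▸ mem_fittingIdeal_one (psi p) 1 1)
    rwa [linPart_psi_one_one] at this
  · obtain ⟨y, z, hyz⟩ := key _ (h ▸ mem_fittingIdeal_one (psi p) 1 0)
    rw [linPart_psi_one_zero] at hyz
    refine ⟨-y, -z, ?_⟩
    rw [neg_smul, neg_smul, ← neg_add, ← hyz, neg_neg]
    rfl

end NonIsomorphic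

end FermatCubic

namespace FermatCubic

open MvPolynomial

/-! ### Regular sequences of generic linear forms. -/

section RegularLinearForms

variable {K : Type*} [Field K] [Infinite K] {R : Type*} [CommRing R] [IsNoetherianRing R]
  [Algebra K R] {n : ℕ}

/-- If no nonzero element of `M` is annihilated by `x₁, …, xₙ`, then a generic linear combination
of `x₁, …, xₙ` is `M`-regular. -/
theorem exists_linearCombination_regular {M : Type*} [AddCommGroup M] [Module R M]
    [Module.Finite R M] (x : Fin n → R) (hM : ∀ y : M, (∀ k, x k • y = 0) → y = 0)
    (V : Submodule K (Fin n → K)) (hV : V ≠ ⊤) :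
    ∃ v ∉ V, ∀ y : M, Fintype.linearCombination K x v • y = 0 → y = 0 := by
  classical
  -- The coefficient vectors whose combination falls into `P`. For an associated prime this is a
  -- proper subspace, since otherwise all `x k` would annihilate a nonzero element.
  let sub : Ideal R → Submodule K (Fin n → K) := fun P =>
    (P.restrictScalars K).comap (Fintype.linearCombination K x)
  let T : Finset (Submodule K (Fin n → K)) :=
    insert V ((associatedPrimes.finite R M).toFinset.image sub)
  have hT : ⊤ ∉ T := by
    intro h
    rcases Finset.mem_insert.1 h with h | h
    · exact hV h.symm
    · obtain ⟨P, hP, hsub⟩ := Finset.mem_image.1 h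
      rw [Set.Finite.mem_toFinset] at hP
      obtain ⟨y, hy⟩ := (isAssociatedPrime_iff.1 hP).2
      have hxy : ∀ k, x k • y = 0 := fun k => by
        have h1 : Pi.single k 1 ∈ sub P := hsub ▸ Submodule.mem_top
        have h2 : x k ∈ P := by
          simpa [sub, Fintype.linearCombination_apply_single] using h1
        rw [hy, Submodule.mem_colon_singleton] at h2
        simpa using h2
      have h0 := hM y hxy
      apply hP.1.ne_top
      rw [hy, Ideal.eq_top_iff_one, Submodule.mem_colon_singleton]
      simp [h0]
  -- Over an infinite field, finitely many proper subspaces do not cover the space.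
  obtain ⟨v, hv⟩ := (Set.ne_univ_iff_exists_notMem _).1 (Subspace.biUnion_ne_univ_of_top_notMem hT)
  simp only [Set.mem_iUnion, not_exists] at hv
  refine ⟨v, hv V (Finset.mem_insert_self _ _), fun y hy => ?_⟩
  by_contra hne
  have h1 : Fintype.linearCombination K x v ∈ ⋃ p ∈ associatedPrimes R M, (p : Set R) := by
    rw [biUnion_associatedPrimes_eq_zero_divisors]
    exact ⟨y, hne, hy⟩
  simp only [Set.mem_iUnion] at h1
  obtain ⟨P, hP, hvP⟩ := h1
  exact hv (sub P) (Finset.mem_insert_of_mem (Finset.mem_image_of_mem _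
    ((Set.Finite.mem_toFinset _).2 hP))) hvP

variable {M : Type*} [AddCommGroup M] [Module R M]

/-- The element `r` is regular modulo `W`. -/
def RegularMod (r : R) (W : Submodule R M) : Prop := ∀ y : M, r • y ∈ W → y ∈ W

/-- No nonzero element of `M / W` is annihilated by `x₁, …, xₙ`. -/
def SocleFree (x : Fin n → R) (W : Submodule R M) : Prop :=
  ∀ y : M, (∀ k, x k • y ∈ W) → y ∈ W

/-- The submodule `W + r M`. -/
def addMul (W : Submodule R M) (r : R) : Submodule R M :=
  W ⊔ LinearMap.range (LinearMap.lsmul R M r)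

omit [IsNoetherianRing R] in
theorem mem_addMul {W : Submodule R M} {r : R} {y : M} :
    y ∈ addMul W r ↔ ∃ w ∈ W, ∃ z, y = w + r • z := by
  simp only [addMul, Submodule.mem_sup, LinearMap.mem_range, LinearMap.lsmul_apply]
  constructor
  · rintro ⟨w, hw, _, ⟨z, rfl⟩, rfl⟩
    exact ⟨w, hw, z, rfl⟩
  · rintro ⟨w, hw, z, rfl⟩
    exact ⟨w, hw, _, ⟨z, rfl⟩, rfl⟩

/-- One generic form serves for both quotients: apply the previous result to their product. -/
theorem exists_regularMod [Module.Finite R M] (x : Fin n → R) {W W' : Submodule R M}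
    (h : SocleFree x W) (h' : SocleFree x W') (V : Submodule K (Fin n → K)) (hV : V ≠ ⊤) :
    ∃ v ∉ V, RegularMod (Fintype.linearCombination K x v) W ∧
      RegularMod (Fintype.linearCombination K x v) W' := by
  obtain ⟨v, hvV, hv⟩ := exists_linearCombination_regular (M := (M ⧸ W) × (M ⧸ W')) x
    (by
      rintro ⟨y, z⟩ hyz
      obtain ⟨y, rfl⟩ := Submodule.Quotient.mk_surjective _ y
      obtain ⟨z, rfl⟩ := Submodule.Quotient.mk_surjective _ z
      simp only [Prod.smul_mk, ← Submodule.Quotient.mk_smul, Prod.mk_eq_zero,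
        Submodule.Quotient.mk_eq_zero] at hyz ⊢
      exact ⟨h y fun k => (hyz k).1, h' z fun k => (hyz k).2⟩) V hV
  refine ⟨v, hvV, fun y hy => ?_, fun y hy => ?_⟩
  · have := hv (Submodule.Quotient.mk y, 0) (by
      rw [Prod.smul_mk, ← Submodule.Quotient.mk_smul, (Submodule.Quotient.mk_eq_zero _).2 hy,
        smul_zero]; rfl)
    exact (Submodule.Quotient.mk_eq_zero _).1 (Prod.mk_eq_zero.1 this).1
  · have := hv (0, Submodule.Quotient.mk y) (by
      rw [Prod.smul_mk, ← Submodule.Quotient.mk_smul, (Submodule.Quotient.mk_eq_zero _).2 hy,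
        smul_zero]; rfl)
    exact (Submodule.Quotient.mk_eq_zero _).1 (Prod.mk_eq_zero.1 this).2

omit [IsNoetherianRing R] in
theorem smul_mem_of_mem_span {x : Fin n → R} {r : R} (hr : r ∈ Ideal.span (Set.range x))
    {W : Submodule R M} {y : M} (hy : ∀ k, x k • y ∈ W) : r • y ∈ W := by
  have h1 : Ideal.span (Set.range x) ≤ W.colon {y} := by
    rw [Ideal.span_le]
    rintro _ ⟨k, rfl⟩
    exact Submodule.mem_colon_singleton.2 (hy k)
  exact Submodule.mem_colon_singleton.1 (h1 hr)

omit [IsNoetherianRing R] in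
theorem RegularMod.socleFree {x : Fin n → R} {r : R} (hr : r ∈ Ideal.span (Set.range x))
    {W : Submodule R M} (h : RegularMod r W) : SocleFree x W :=
  fun y hy => h y (smul_mem_of_mem_span hr hy)

omit [IsNoetherianRing R] in
/-- The socles of `M / (W + r M)` and `M / (W + s M)` are isomorphic. -/
theorem SocleFree.transfer {x : Fin n → R} {r s : R} (hr : r ∈ Ideal.span (Set.range x))
    {W : Submodule R M} (h : RegularMod r W) (h' : RegularMod s W)
    (hsoc : SocleFree x (addMul W r)) : SocleFree x (addMul W s) := by
  intro u hu
  -- The isomorphism of socles sends `u` to the `v` with `r u = s v` modulo `W`.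
  obtain ⟨w, hw, v, huv⟩ := mem_addMul.1 (smul_mem_of_mem_span hr hu)
  have hv : v ∈ addMul W r := by
    refine hsoc v fun k => ?_
    obtain ⟨w', hw', t, ht⟩ := mem_addMul.1 (hu k)
    have h1 : s • (x k • v - r • t) = r • w' - x k • w := by
      have h2 : s • v = r • u - w := by rw [huv]; abel
      have h3 : s • t = x k • u - w' := by rw [ht]; abel
      rw [smul_sub, smul_comm s (x k), smul_comm s r, h2, h3, smul_sub, smul_sub,
        smul_comm (x k) r]
      abel
    have h4 := h' (x k • v - r • t) (h1 ▸ sub_mem (W.smul_mem _ hw') (W.smul_mem _ hw))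
    exact mem_addMul.2 ⟨_, h4, t, by abel⟩
  obtain ⟨w', hw', t, rfl⟩ := mem_addMul.1 hv
  have h1 : r • (u - s • t) = w + s • w' := by
    rw [smul_sub, huv, smul_add, smul_comm r s]; abel
  have h2 := h (u - s • t) (h1 ▸ add_mem hw (W.smul_mem _ hw'))
  exact mem_addMul.2 ⟨_, h2, t, by abel⟩

-- The half of exchanging `r` and `s` that needs no Nakayama argument; regularity of `s` modulo `W`
-- itself is secured separately, by the choice of `s`.
omit [IsNoetherianRing R] in
theorem RegularMod.swap {r s : R} {W : Submodule R M} (hr : RegularMod r W)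
    (h : RegularMod s (addMul W r)) : RegularMod r (addMul W s) := by
  intro y hy
  obtain ⟨w, hw, z, hz⟩ := mem_addMul.1 hy
  have h1 : z ∈ addMul W r := h z (mem_addMul.2 ⟨-w, W.neg_mem hw, y, by rw [hz]; abel⟩)
  obtain ⟨w', hw', t, rfl⟩ := mem_addMul.1 h1
  have h2 : r • (y - s • t) = w + s • w' := by
    rw [smul_sub, hz, smul_add, smul_comm s r]; abel
  have h3 := hr (y - s • t) (h2 ▸ add_mem hw (W.smul_mem _ hw'))
  exact mem_addMul.2 ⟨_, h3, t, by abel⟩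

omit [IsNoetherianRing R] in
theorem addMul_comm (W : Submodule R M) (r s : R) :
    addMul (addMul W r) s = addMul (addMul W s) r := by
  unfold addMul
  rw [sup_assoc, sup_assoc, sup_comm (LinearMap.range _)]

/-- A regular sequence of length `3` can be exchanged for one that consists of linear combinations
of the generators of the ideal. -/
theorem exists_regular_linearCombinations [Module.Finite R M] {x : Fin n → R} {r₁ r₂ r₃ : R}
    (h₁ : r₁ ∈ Ideal.span (Set.range x)) (h₂ : r₂ ∈ Ideal.span (Set.range x))
    (h₃ : r₃ ∈ Ideal.span (Set.range x)) {W : Submodule R M} (reg₁ : RegularMod r₁ W)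
    (reg₂ : RegularMod r₂ (addMul W r₁)) (reg₃ : RegularMod r₃ (addMul (addMul W r₁) r₂))
    (hn : 3 < n) :
    ∃ v₀ v₁ v₂ v₃ : Fin n → K, LinearIndependent K ![v₀, v₁, v₂, v₃] ∧
      RegularMod (Fintype.linearCombination K x v₀) W ∧
      RegularMod (Fintype.linearCombination K x v₁)
        (addMul W (Fintype.linearCombination K x v₀)) ∧
      RegularMod (Fintype.linearCombination K x v₂)
        (addMul (addMul W (Fintype.linearCombination K x v₀))
          (Fintype.linearCombination K x v₁)) := by
  have hspan : ∀ v : Fin n → K, Fintype.linearCombination K x v ∈ Ideal.span (Set.range x) := by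
    intro v
    rw [Fintype.linearCombination_apply]
    exact sum_mem fun k _ => Submodule.smul_of_tower_mem _ _ (Ideal.subset_span ⟨k, rfl⟩)
  have hV : ∀ {m : ℕ} (w : Fin m → Fin n → K), m ≤ 3 →
      Submodule.span K (Set.range w) ≠ ⊤ := by
    intro m w hm htop
    have := finrank_range_le_card (R := K) w
    rw [Set.finrank, htop, finrank_top, Module.finrank_fin_fun, Fintype.card_fin] at this
    omega
  -- The first form is chosen regular modulo `W` and modulo `W + r₁ M`, so that it can be moved in
  -- front of `r₁`; socle transfer then replaces `r₂` by it. The next form replaces `r₁` in the same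
  -- way.
  obtain ⟨v₀, hv₀, a₀, b₀⟩ := exists_regularMod x (reg₁.socleFree h₁) (reg₂.socleFree h₂)
    (Submodule.span K (Set.range (![] : Fin 0 → Fin n → K))) (hV _ (by norm_num))
  set l₀ := Fintype.linearCombination K x v₀
  have c₀ : RegularMod r₁ (addMul W l₀) := reg₁.swap b₀
  have d₀ : SocleFree x (addMul (addMul W l₀) r₁) := by
    rw [addMul_comm]
    exact (reg₃.socleFree h₃).transfer h₂ reg₂ b₀
  obtain ⟨v₁, hv₁, a₁, -⟩ := exists_regularMod x (c₀.socleFree h₁) (c₀.socleFree h₁)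
    (Submodule.span K (Set.range (![v₀] : Fin 1 → Fin n → K))) (hV _ (by norm_num))
  set l₁ := Fintype.linearCombination K x v₁
  have d₁ := d₀.transfer h₁ c₀ a₁
  obtain ⟨v₂, hv₂, a₂, -⟩ := exists_regularMod x d₁ d₁
    (Submodule.span K (Set.range (![v₁, v₀] : Fin 2 → Fin n → K))) (hV _ (by norm_num))
  -- The fourth vector carries no regularity; it only extends the family to a fourth independent
  -- vector.
  obtain ⟨v₃, hv₃⟩ : ∃ v₃, v₃ ∉ Submodule.span K
      (Set.range (![v₂, v₁, v₀] : Fin 3 → Fin n → K)) := by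
    by_contra! h
    exact hV ![v₂, v₁, v₀] le_rfl (eq_top_iff.2 fun v _ => h v)
  refine ⟨v₀, v₁, v₂, v₃, ?_, a₀, a₁, a₂⟩
  have e0 : LinearIndependent K (![] : Fin 0 → Fin n → K) := linearIndependent_empty_type
  have e1 := linearIndependent_finCons.2 ⟨e0, hv₀⟩
  have e2 := linearIndependent_finCons.2 ⟨e1, hv₁⟩
  have e3 := linearIndependent_finCons.2 ⟨e2, hv₂⟩
  have e4 := linearIndependent_finCons.2 ⟨e3, hv₃⟩
  have e5 : LinearIndependent K ((![v₃, v₂, v₁, v₀] : Fin 4 → Fin n → K) ∘ ![3, 2, 1, 0]) :=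
    e4.comp _ (by decide)
  have he : (![v₀, v₁, v₂, v₃] : Fin 4 → Fin n → K) = ![v₃, v₂, v₁, v₀] ∘ ![3, 2, 1, 0] := by
    ext i
    fin_cases i <;> rfl
  rw [he]
  exact e5

end RegularLinearForms

end FermatCubic

namespace FermatCubic

open MvPolynomial

/-! ### Depth of a kernel, and freeness from a regular sequence generating the relevant ideal. -/

section Chains

variable {R : Type*} [CommRing R] {F M : Type*} [AddCommGroup F] [Module R F]
  [AddCommGroup M] [Module R M]

/-- The submodule `r₁ Z + ⋯ + rₙ Z`. -/
def chain (Z : Submodule R F) : List R → Submodule R F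
  | [] => ⊥
  | r :: l => chain Z l ⊔ Z.map (LinearMap.lsmul R F r)

/-- The elements of the list, read from its end, form a weakly regular sequence on `Z`. -/
def IsReg (Z : Submodule R F) : List R → Prop
  | [] => True
  | r :: l => (∀ y ∈ Z, r • y ∈ chain Z l → y ∈ chain Z l) ∧ IsReg Z l

theorem mem_chain_cons {Z : Submodule R F} {r : R} {l : List R} {y : F} :
    y ∈ chain Z (r :: l) ↔ ∃ w ∈ chain Z l, ∃ z ∈ Z, y = w + r • z := by
  simp only [chain, Submodule.mem_sup, Submodule.mem_map, LinearMap.lsmul_apply]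
  constructor
  · rintro ⟨w, hw, _, ⟨z, hz, rfl⟩, rfl⟩
    exact ⟨w, hw, z, hz, rfl⟩
  · rintro ⟨w, hw, z, hz, rfl⟩
    exact ⟨w, hw, _, ⟨z, hz, rfl⟩, rfl⟩

theorem map_chain (π : F →ₗ[R] M) (Z : Submodule R F) (l : List R) :
    (chain Z l).map π = chain (Z.map π) l := by
  induction l with
  | nil => simp [chain]
  | cons r l ih =>
    simp only [chain, Submodule.map_sup, ih, ← Submodule.map_comp]
    congr 2
    ext y
    simp

theorem chain_mono {Z Z' : Submodule R F} (h : Z ≤ Z') (l : List R) : chain Z l ≤ chain Z' l := by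
  induction l with
  | nil => exact le_rfl
  | cons r l ih => exact sup_le_sup ih (Submodule.map_mono h)

theorem chain_le_smul {Z : Submodule R F} {l : List R} {I : Ideal R} (h : ∀ r ∈ l, r ∈ I) :
    chain Z l ≤ I • Z := by
  induction l with
  | nil => exact bot_le
  | cons r l ih =>
    refine sup_le (ih fun s hs => h s (List.mem_cons_of_mem _ hs)) ?_
    rintro _ ⟨z, hz, rfl⟩
    exact Submodule.smul_mem_smul (h r List.mem_cons_self) hz

/-- The vanishing of `Tor₁` for a regular sequence on the image. If `j + r c` maps to zero, then `π
c` lies in the earlier chain by regularity; correcting `c` by a lift from that chain puts it in the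
kernel, and the remainder is handled by induction. -/
theorem ker_inf_chain_le (π : F →ₗ[R] M) {l : List R} (h : IsReg (LinearMap.range π) l) :
    LinearMap.ker π ⊓ chain ⊤ l ≤ chain (LinearMap.ker π) l := by
  induction l with
  | nil => exact inf_le_right
  | cons r l ih =>
    rintro z ⟨hz, hz'⟩
    have hz0 : π z = 0 := hz
    obtain ⟨j, hj, c, -, rfl⟩ := mem_chain_cons.1 hz'
    have hrange : (chain ⊤ l).map π = chain (LinearMap.range π) l := by
      rw [map_chain, LinearMap.range_eq_map]
    have h1 : r • π c ∈ chain (LinearMap.range π) l := by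
      rw [map_add, map_smul, add_eq_zero_iff_neg_eq] at hz0
      rw [← hz0, ← hrange]
      exact neg_mem (Submodule.mem_map_of_mem hj)
    have h2 := h.1 (π c) ⟨c, rfl⟩ h1
    rw [← hrange] at h2
    obtain ⟨c', hc', hcc⟩ := h2
    have h3 : c - c' ∈ LinearMap.ker π := by rw [LinearMap.mem_ker, map_sub, hcc, sub_self]
    have h4 : j + r • c' ∈ chain (LinearMap.ker π) l := by
      refine ih h.2 ⟨?_, add_mem hj (Submodule.smul_mem _ r hc')⟩
      change π (j + r • c') = 0
      rw [map_add, map_smul, hcc, ← map_smul, ← map_add, hz0]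
    exact mem_chain_cons.2 ⟨_, h4, _, h3, by rw [smul_sub]; abel⟩

/-- The kernel of a homomorphism is as regular as its source, for sequences longer by one. -/
theorem isReg_ker (π : F →ₗ[R] M) {l : List R} {r : R} (h : IsReg (LinearMap.range π) l)
    (hF : IsReg (⊤ : Submodule R F) (r :: l)) : IsReg (LinearMap.ker π) (r :: l) := by
  induction l generalizing r with
  | nil =>
    refine ⟨fun y _ hy => ?_, trivial⟩
    exact hF.1 y trivial hy
  | cons s l ih =>
    refine ⟨fun y hy hry => ?_, ih h.2 hF.2⟩
    -- Regularity on `F` puts `y` in the chain of `F`; intersecting with the kernel costs nothing,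
    -- by regularity of the shorter sequence on the image.
    exact ker_inf_chain_le π h ⟨hy, hF.1 y trivial (chain_mono le_top _ hry)⟩

theorem mem_chain_top_pi {k : ℕ} {l : List R} {z : Fin k → R} :
    z ∈ chain ⊤ l ↔ ∀ i, z i ∈ Ideal.ofList l := by
  induction l generalizing z with
  | nil =>
    simp only [chain, Submodule.mem_bot, Ideal.ofList_nil]
    exact funext_iff
  | cons r l ih =>
    rw [mem_chain_cons]
    simp only [Ideal.ofList_cons]
    constructor
    · rintro ⟨w, hw, c, -, rfl⟩ i
      refine add_mem (Ideal.mem_sup_right (ih.1 hw i)) (Ideal.mem_sup_left ?_)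
      exact Ideal.mul_mem_right _ _ (Ideal.mem_span_singleton_self r)
    · intro h
      have h1 : ∀ i, ∃ a, ∃ b ∈ Ideal.ofList l, r * a + b = z i := fun i => by
        obtain ⟨a, ha, b, hb, hab⟩ := Submodule.mem_sup.1 (h i)
        obtain ⟨c, rfl⟩ := Ideal.mem_span_singleton.1 ha
        exact ⟨c, b, hb, hab⟩
      choose a b hb hab using h1
      refine ⟨b, ih.2 hb, a, trivial, ?_⟩
      ext i
      rw [← hab, add_comm]
      rfl

/-- A module with a regular sequence that generates an ideal `I` is free on any generators without
relations outside of `I`. -/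
theorem ker_eq_bot_of_isReg [IsDomain R] [IsNoetherianRing R] {k : ℕ} (π : (Fin k → R) →ₗ[R] M)
    {l : List R} (h : IsReg (LinearMap.range π) l) (htop : Ideal.ofList l ≠ ⊤)
    (hmin : ∀ z, π z = 0 → ∀ i, z i ∈ Ideal.ofList l) : LinearMap.ker π = ⊥ := by
  -- By minimality the kernel lies in `I F`, hence in `I` times itself.
  have h1 : LinearMap.ker π ≤ Ideal.ofList l • LinearMap.ker π := by
    refine le_trans (fun z hz => ?_) (chain_le_smul (l := l) fun r hr => Ideal.subset_span hr)
    exact ker_inf_chain_le π h ⟨hz, mem_chain_top_pi.2 (hmin z hz)⟩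
  -- Nakayama without a local ring: some `r ≡ 1` modulo `I` kills the kernel, which is torsion-free
  -- over the domain.
  obtain ⟨r, hr, hr0⟩ := Submodule.exists_sub_one_mem_and_smul_eq_zero_of_fg_of_le_smul
    (Ideal.ofList l) _ (IsNoetherian.noetherian (LinearMap.ker π)) h1
  have hrne : r ≠ 0 := by
    rintro rfl
    apply htop
    rw [Ideal.eq_top_iff_one, ← neg_mem_iff]
    simpa using hr
  rw [eq_bot_iff]
  intro z hz
  exact (smul_eq_zero.1 (hr0 z hz)).resolve_left hrne

end Chains

/-! ### Linear changes of coordinates. -/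

section Coordinates

variable {K : Type*} [Field K]

/-- The linear form with coefficients `v`. -/
noncomputable def linForm (v : Fin 4 → K) : MvPolynomial (Fin 4) K := ∑ k, C (v k) * X k

theorem linForm_mem (v : Fin 4 → K) : constantCoeff (linForm v) = 0 := by
  simp [linForm]

/-- Substitutions of linear forms compose like their coefficient matrices, so the inverse matrix
gives the inverse substitution. -/
theorem exists_linear_change {v : Fin 4 → Fin 4 → K} (hv : LinearIndependent K v) :
    ∃ σ : MvPolynomial (Fin 4) K ≃ₐ[K] MvPolynomial (Fin 4) K, ∀ i, σ (X i) = linForm (v i) := by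
  let P : Matrix (Fin 4) (Fin 4) K := Matrix.of v
  have hP : IsUnit P := Matrix.linearIndependent_rows_iff_isUnit.1 hv
  have key : ∀ A B : Matrix (Fin 4) (Fin 4) K, A * B = 1 →
      (aeval fun i => linForm (B i) : MvPolynomial (Fin 4) K →ₐ[K] _).comp
        (aeval fun i => linForm (A i)) = AlgHom.id K _ := by
    intro A B hAB
    ext i : 1
    simp only [AlgHom.comp_apply, aeval_X, AlgHom.id_apply]
    have h1 : ∀ k, ∑ j, A i j * B j k = if i = k then 1 else 0 := fun k => by
      rw [← Matrix.mul_apply, hAB, Matrix.one_apply]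
    calc (aeval fun i => linForm (B i)) (linForm (A i))
        = ∑ j, ∑ k, C (A i j * B j k) * X k := by
          simp only [linForm, map_sum, map_mul, aeval_X, aeval_C, algebraMap_eq, Finset.mul_sum,
            mul_assoc]
      _ = ∑ k, C (∑ j, A i j * B j k) * X k := by
          rw [Finset.sum_comm]
          simp only [map_sum, Finset.sum_mul]
      _ = X i := by
          simp only [h1]
          simp
  have h1 : P * P⁻¹ = 1 := Matrix.mul_nonsing_inv P ((Matrix.isUnit_iff_isUnit_det P).1 hP)
  have h2 : P⁻¹ * P = 1 := Matrix.nonsing_inv_mul P ((Matrix.isUnit_iff_isUnit_det P).1 hP)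
  exact ⟨AlgEquiv.ofAlgHom (aeval fun i => linForm (P i)) (aeval fun i => linForm (P⁻¹ i))
    (key _ _ h2) (key _ _ h1), fun i => aeval_X _ _⟩

/-- After a linear change of coordinates this is the primality of an ideal generated by variables.
-/
theorem regular_linForm {v : Fin 4 → Fin 4 → K} (hv : LinearIndependent K v) {s : Set (Fin 4)}
    {i : Fin 4} (hi : i ∉ s) {p : MvPolynomial (Fin 4) K}
    (hp : linForm (v i) * p ∈ Ideal.span ((fun j => linForm (v j)) '' s)) :
    p ∈ Ideal.span ((fun j => linForm (v j)) '' s) := by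
  obtain ⟨σ, hσ⟩ := exists_linear_change hv
  have h1 : Ideal.span ((fun j => linForm (v j)) '' s) =
      (Ideal.span (X '' s)).comap (σ.symm : MvPolynomial (Fin 4) K →+* MvPolynomial (Fin 4) K) := by
    have h2 := Ideal.map_comap_of_equiv (I := Ideal.span (X '' s)) σ.toRingEquiv
    have h3 : Ideal.map (σ.toRingEquiv : MvPolynomial (Fin 4) K →+* MvPolynomial (Fin 4) K)
        (Ideal.span (X '' s)) = Ideal.span ((fun j => linForm (v j)) '' s) := by
      rw [Ideal.map_span, Set.image_image]
      congr 1
      refine Set.image_congr fun j _ => ?_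
      exact hσ j
    rw [← h3]
    exact h2
  rw [h1, Ideal.mem_comap] at hp ⊢
  rw [map_mul] at hp
  have h4 : (σ.symm : MvPolynomial (Fin 4) K →+* MvPolynomial (Fin 4) K) (linForm (v i)) = X i := by
    rw [← hσ]; exact σ.symm_apply_apply _
  rw [h4] at hp
  exact ((isPrime_span_X_image s).mem_or_mem hp).resolve_left
    fun h => hi (X_mem_span_X_image.1 h)

theorem ofList_linForm (v : Fin 4 → Fin 4 → K) (l : List (Fin 4)) :
    Ideal.ofList (l.map fun j => linForm (v j)) =
      Ideal.span ((fun j => linForm (v j)) '' {j | j ∈ l}) := by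
  unfold Ideal.ofList
  congr 1
  ext x
  simp

theorem isReg_top_linForm {v : Fin 4 → Fin 4 → K} (hv : LinearIndependent K v) (k : ℕ)
    {l : List (Fin 4)} (hl : l.Nodup) :
    IsReg (⊤ : Submodule (MvPolynomial (Fin 4) K) (Fin k → MvPolynomial (Fin 4) K))
      (l.map fun j => linForm (v j)) := by
  induction l with
  | nil => trivial
  | cons i l ih =>
    rw [List.nodup_cons] at hl
    refine ⟨fun y _ hy => ?_, ih hl.2⟩
    change _ ∈ chain _ (l.map fun j => linForm (v j)) at hy
    rw [mem_chain_top_pi] at hy ⊢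
    intro j
    have := hy j
    rw [ofList_linForm] at this ⊢
    exact regular_linForm hv (s := {j | j ∈ l}) hl.1 this

theorem mem_ofList_linForm {v : Fin 4 → Fin 4 → K} (hv : LinearIndependent K v)
    {p : MvPolynomial (Fin 4) K} (hp : constantCoeff p = 0) :
    p ∈ Ideal.ofList (([3, 2, 1, 0] : List (Fin 4)).map fun j => linForm (v j)) := by
  have h1 : ({j | j ∈ ([3, 2, 1, 0] : List (Fin 4))} : Set (Fin 4)) = Set.univ := by
    ext j; fin_cases j <;> simp
  rw [ofList_linForm, h1, Set.image_univ]
  obtain ⟨σ, hσ⟩ := exists_linear_change hv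
  let P : Matrix (Fin 4) (Fin 4) K := Matrix.of v
  have hP : IsUnit P := Matrix.linearIndependent_rows_iff_isUnit.1 hv
  have h2 : P⁻¹ * P = 1 := Matrix.nonsing_inv_mul P ((Matrix.isUnit_iff_isUnit_det P).1 hP)
  refine (Ideal.span_le.2 ?_) (mem_span_X_of_constantCoeff hp)
  rintro _ ⟨i, rfl⟩
  have h3 : (X i : MvPolynomial (Fin 4) K) = ∑ j, C (P⁻¹ i j) * linForm (v j) := by
    have h1 : ∀ k, ∑ j, P⁻¹ i j * v j k = if i = k then 1 else 0 := fun k => by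
      rw [← Matrix.one_apply, ← h2, Matrix.mul_apply]; rfl
    simp only [linForm, Finset.mul_sum, ← mul_assoc, ← map_mul]
    rw [Finset.sum_comm]
    simp only [← Finset.sum_mul, ← map_sum, h1]
    simp
  rw [SetLike.mem_coe, h3]
  exact sum_mem fun j _ => Ideal.mul_mem_left _ _ (Ideal.subset_span ⟨j, rfl⟩)

theorem ofList_linForm_ne_top (v : Fin 4 → Fin 4 → K) (l : List (Fin 4)) :
    Ideal.ofList (l.map fun j => linForm (v j)) ≠ ⊤ := by
  rw [ofList_linForm, Ne, Ideal.eq_top_iff_one]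
  intro h
  have hle : Ideal.span ((fun j => linForm (v j)) '' {j | j ∈ l}) ≤
      RingHom.ker (constantCoeff : MvPolynomial (Fin 4) K →+* K) := by
    rw [Ideal.span_le]
    rintro _ ⟨j, -, rfl⟩
    exact linForm_mem (v j)
  have := hle h
  simp [RingHom.mem_ker] at this

end Coordinates

end FermatCubic

namespace FermatCubic

open MvPolynomial

/-! ### Minimal homogeneous generators. -/

section MinimalGenerators

variable {K : Type*} [Field K] {M : Type*} [AddCommGroup M] [Module (MvPolynomial (Fin 4) K) M]
  {ℳ : ℤ → AddSubgroup M} {π : ℤ → M →+ M}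

/-- The projections onto the homogeneous components are compatible with the action of forms. -/
def IsCompatible (π : ℤ → M →+ M) : Prop :=
  ∀ (d : ℤ) (h : MvPolynomial (Fin 4) K), IsHomZ d h → ∀ n x, π n (h • x) = h • π (n - d) x

theorem IsCompatible.proj_smul (hc : IsCompatible (K := K) π) (hπ : IsDecomp ℳ π) {e : ℤ} {g : M}
    (hg : g ∈ ℳ e) (n : ℤ) (z : MvPolynomial (Fin 4) K) : π n (z • g) = hcomp (n - e) z • g := by
  have h1 : ∀ i : ℤ, π n (hcomp i z • g) = hcomp (n - e) (hcomp i z) • g := fun i => by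
    rw [hc i _ (isHomZ_hcomp i z)]
    by_cases h : n - i = e
    · rw [show n - e = i by omega, (isHomZ_hcomp i z).hcomp_eq, h, hπ.same e g hg]
    · rw [hπ.ne _ _ g h hg, (isHomZ_hcomp i z).hcomp_eq_zero (by omega), smul_zero, zero_smul]
  conv_lhs => rw [← sum_hcomp z]
  conv_rhs => rw [← sum_hcomp z]
  rw [Finset.sum_smul, map_sum, map_sum, Finset.sum_smul]
  exact Finset.sum_congr rfl fun i _ => h1 i

/-- A finitely generated graded module has homogeneous generators all of whose relations have
coefficients without constant terms. -/
theorem exists_minimal_generators [Module.Finite (MvPolynomial (Fin 4) K) M]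
    (hπ : IsDecomp ℳ π) (hc : IsCompatible (K := K) π) :
    ∃ (k : ℕ) (ε : Fin k → ℤ) (g : Fin k → M), (∀ i, g i ∈ ℳ (ε i)) ∧
      Submodule.span (MvPolynomial (Fin 4) K) (Set.range g) = ⊤ ∧
      ∀ z : Fin k → MvPolynomial (Fin 4) K, ∑ i, z i • g i = 0 → ∀ i, constantCoeff (z i) = 0 := by
  classical
  let P : ℕ → Prop := fun k => ∃ (ε : Fin k → ℤ) (g : Fin k → M), (∀ i, g i ∈ ℳ (ε i)) ∧
    Submodule.span (MvPolynomial (Fin 4) K) (Set.range g) = ⊤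
  have hP : ∃ k, P k := by
    have hspan : Submodule.span (MvPolynomial (Fin 4) K) {x | ∃ n, x ∈ ℳ n} = ⊤ := by
      rw [eq_top_iff]
      intro x _
      exact hπ.induction x (fun n y hy => Submodule.subset_span ⟨n, hy⟩) (zero_mem _)
        fun y z hy hz => add_mem hy hz
    have hfg : (Submodule.span (MvPolynomial (Fin 4) K) {x | ∃ n, x ∈ ℳ n}).FG := by
      rw [hspan]; exact Module.Finite.fg_top
    obtain ⟨s, hs, hs'⟩ := (Submodule.fg_span_iff_fg_span_finset_subset _).1 hfg
    let e := s.equivFin.symm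
    choose ε hε using fun i => hs (e i).2
    refine ⟨s.card, ε, fun i => e i, hε, ?_⟩
    rw [← hspan, hs']
    congr 1
    ext x
    constructor
    · rintro ⟨i, rfl⟩
      exact (e i).2
    · intro hx
      exact ⟨e.symm ⟨x, hx⟩, by simp⟩
  obtain ⟨ε, g, hg, hspan⟩ := Nat.find_spec hP
  refine ⟨Nat.find hP, ε, g, hg, hspan, fun z hz i => ?_⟩
  by_contra hne
  obtain ⟨k, hk⟩ : ∃ k, Nat.find hP = k + 1 := Nat.exists_eq_succ_of_ne_zero fun h0 => by
    have := i.2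
    omega
  have hmin := Nat.find_min hP (m := k) (by omega)
  revert ε g hg hspan z i
  rw [hk]
  intro ε g hg hspan z hz i hne
  apply hmin
  refine ⟨fun j => ε (i.succAbove j), fun j => g (i.succAbove j), fun j => hg _, ?_⟩
  rw [eq_top_iff, ← hspan, Submodule.span_le]
  -- The component of the relation in degree `ε i`. Its coefficient at `g i` is the nonzero constant
  -- term of `z i`, so `g i` is redundant, against the minimal choice of `k`.
  have hz' : ∑ j, hcomp (ε i - ε j) (z j) • g j = 0 := by
    rw [← map_zero (π (ε i)), ← hz, map_sum]
    exact Finset.sum_congr rfl fun j _ => (hc.proj_smul hπ (hg j) _ _).symm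
  rw [Fin.sum_univ_succAbove _ i, sub_self, (isHomZ_hcomp 0 (z i)).eq_C,
    constantCoeff_hcomp_zero] at hz'
  rintro _ ⟨l, rfl⟩
  by_cases hl : l = i
  · subst hl
    have h1 : g l = (C (constantCoeff (z l))⁻¹ : MvPolynomial (Fin 4) K) •
        ((C (constantCoeff (z l)) : MvPolynomial (Fin 4) K) • g l) := by
      rw [smul_smul, ← map_mul, inv_mul_cancel₀ hne, map_one, one_smul]
    rw [h1, eq_neg_of_add_eq_zero_left hz']
    refine Submodule.smul_mem _ _ (neg_mem (sum_mem fun j _ => Submodule.smul_mem _ _ ?_))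
    exact Submodule.subset_span ⟨j, rfl⟩
  · obtain ⟨j, rfl⟩ := Fin.exists_succAbove_eq hl
    exact Submodule.subset_span ⟨j, rfl⟩

end MinimalGenerators

/-! ### A regular sequence of linear forms on an MCM module. -/

section DepthThree

variable {K : Type*} [Field K] [CharZero K] {M : Type*} [AddCommGroup M] [Module (R4 K) M]
  [Module (MvPolynomial (Fin 4) K) M]

omit [CharZero K] [Module (MvPolynomial (Fin 4) K) M] in
theorem ofList_cons_smul_top (r : R4 K) (l : List (R4 K)) :
    (Ideal.ofList (r :: l) • ⊤ : Submodule (R4 K) M) =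
      addMul (Ideal.ofList l • ⊤) r := by
  rw [Ideal.ofList_cons, Submodule.sup_smul, sup_comm, Submodule.ideal_span_singleton_smul]
  unfold addMul
  congr 1
  ext y
  simp [Submodule.mem_smul_pointwise_iff_exists]

/-- The given sequence of length `dim R4 = 3` is exchanged for linear forms; the fourth form is
needed later, when the relations acquire depth 4. -/
theorem IsGradedMCM.exists_isReg {ℳ : ℤ → AddSubgroup M} (h : IsGradedMCM (K := K) ℳ)
    (hsm : ∀ (p : MvPolynomial (Fin 4) K) (y : M), p • y = toR4 K p • y) :
    ∃ v : Fin 4 → Fin 4 → K, LinearIndependent K v ∧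
      IsReg (⊤ : Submodule (MvPolynomial (Fin 4) K) M)
        (([2, 1, 0] : List (Fin 4)).map fun j => linForm (v j)) := by
  have := h.finite
  obtain ⟨rs, hrs, hlen, hreg⟩ := h.depth_eq_dim
  rw [ringKrullDim_R4] at hlen
  have hlen3 : rs.length = 3 := by exact_mod_cast hlen
  obtain ⟨r₁, r₂, r₃, rfl⟩ := List.length_eq_three.1 hlen3
  have h1 := hreg.regular_mod_prev 0 (by simp)
  have h2 := hreg.regular_mod_prev 1 (by simp)
  have h3 := hreg.regular_mod_prev 2 (by simp)
  rw [isSMulRegular_quotient_iff_mem_of_smul_mem] at h1 h2 h3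
  have e0 : (Ideal.ofList ([] : List (R4 K)) • ⊤ : Submodule (R4 K) M) = ⊥ := by simp
  have e1 : (Ideal.ofList [r₁] • ⊤ : Submodule (R4 K) M) = addMul ⊥ r₁ := by
    rw [ofList_cons_smul_top, e0]
  have e2 : (Ideal.ofList [r₁, r₂] • ⊤ : Submodule (R4 K) M) = addMul (addMul ⊥ r₁) r₂ := by
    rw [← e1, ← ofList_cons_smul_top, Ideal.ofList_cons, Ideal.ofList_cons, Ideal.ofList_cons,
      Ideal.ofList_cons, Ideal.ofList_nil, sup_left_comm]
  obtain ⟨v₀, v₁, v₂, v₃, hv, g1, g2, g3⟩ := exists_regular_linearCombinations (K := K) (n := 4)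
    (x := fun k => toR4 K (X k)) (W := (⊥ : Submodule (R4 K) M))
    (hrs r₁ (by simp)) (hrs r₂ (by simp)) (hrs r₃ (by simp))
    (fun y hy => by rw [← e0] at hy ⊢; exact h1 y hy)
    (fun y hy => by rw [← e1] at hy ⊢; exact h2 y hy)
    (fun y hy => by rw [← e2] at hy ⊢; exact h3 y hy) (by norm_num)
  have hlin : ∀ v, Fintype.linearCombination K (fun k : Fin 4 => toR4 K (X k)) v =
      toR4 K (linForm v) := fun v => by
    rw [Fintype.linearCombination_apply, linForm, map_sum]
    refine Finset.sum_congr rfl fun k _ => ?_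
    rw [map_mul]
    exact Algebra.smul_def (v k) (toR4 K (X k))
  simp only [hlin] at g1 g2 g3
  have k0 : ∀ y : M, y ∈ chain (⊤ : Submodule (MvPolynomial (Fin 4) K) M) [] ↔
      y ∈ (⊥ : Submodule (R4 K) M) := fun y => Iff.rfl
  have kc : ∀ (l : List (MvPolynomial (Fin 4) K)) (W : Submodule (R4 K) M)
      (p : MvPolynomial (Fin 4) K),
      (∀ y : M, y ∈ chain (⊤ : Submodule (MvPolynomial (Fin 4) K) M) l ↔ y ∈ W) →
      ∀ y : M, y ∈ chain (⊤ : Submodule (MvPolynomial (Fin 4) K) M) (p :: l) ↔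
        y ∈ addMul W (toR4 K p) := fun l W p H y => by
    rw [mem_chain_cons, mem_addMul]
    simp only [H, Submodule.mem_top, true_and, hsm]
  have k1 := kc [] ⊥ (linForm v₀) k0
  have k2 := kc _ _ (linForm v₁) k1
  refine ⟨![v₀, v₁, v₂, v₃], hv, fun y _ hy => ?_, fun y _ hy => ?_, fun y _ hy => ?_, trivial⟩
  · exact (k2 y).2 (g3 y (by rw [← hsm]; exact (k2 _).1 hy))
  · exact (k1 y).2 (g2 y (by rw [← hsm]; exact (k1 _).1 hy))
  · exact (k0 y).2 (g1 y (by rw [← hsm]; exact (k0 _).1 hy))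

end DepthThree

/-! ### Square presentations from the Auslander–Buchsbaum argument. -/

section Presentation

variable {K : Type*} [Field K] [CharZero K]

/-- The graded module `ℳ` is presented by the matrix `A` over the polynomial ring, with
homogeneous generators of degrees `δ`. -/
def IsPresentation {m k : ℕ} {M : Type*} [AddCommGroup M] [Module (R4 K) M]
    (ℳ : ℤ → AddSubgroup M)
    (A : Matrix (Fin m) (Fin k) (MvPolynomial (Fin 4) K)) (δ : Fin m → ℤ) : Prop :=
  ∃ g : Fin m → M, (∀ i, g i ∈ ℳ (δ i)) ∧ Submodule.span (R4 K) (Set.range g) = ⊤ ∧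
    ∀ z : Fin m → MvPolynomial (Fin 4) K, ∑ i, toR4 K (z i) • g i = 0 ↔ ∃ u, z = A.mulVec u

-- Taking a component of a relation between homogeneous generators gives another relation, so the
-- relations form a graded module.
omit [CharZero K] in
theorem exists_isDecomp_ker {M : Type*} [AddCommGroup M] [Module (MvPolynomial (Fin 4) K) M]
    {ℳ : ℤ → AddSubgroup M} {π : ℤ → M →+ M} (hπ : IsDecomp ℳ π) (hc : IsCompatible (K := K) π)
    {k : ℕ} {ε : Fin k → ℤ} {g : Fin k → M} (hg : ∀ i, g i ∈ ℳ (ε i)) :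
    ∃ (𝒩 : ℤ → AddSubgroup
        (LinearMap.ker (Fintype.linearCombination (MvPolynomial (Fin 4) K) g)))
      (ρ : ℤ → _ →+ _), IsDecomp 𝒩 ρ ∧ IsCompatible (K := K) ρ ∧
        ∀ n z, z ∈ 𝒩 n → ∀ i, IsHomZ (n - ε i) (z.1 i) := by
  let N := LinearMap.ker (Fintype.linearCombination (MvPolynomial (Fin 4) K) g)
  let σ : ℤ → (Fin k → MvPolynomial (Fin 4) K) →+ (Fin k → MvPolynomial (Fin 4) K) := fun n =>
    AddMonoidHom.mk' (fun v i => hcomp (n - ε i) (v i)) (fun v w => by ext; simp)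
  have hσ := (isDecomp_hcomp K).pi ε
  have hN : ∀ n (z : N), σ n z.1 ∈ N := fun n z => by
    have hz : ∑ i, z.1 i • g i = 0 := z.2
    change ∑ i, hcomp (n - ε i) (z.1 i) • g i = 0
    rw [← map_zero (π n), ← hz, map_sum]
    exact Finset.sum_congr rfl fun i _ => (hc.proj_smul hπ (hg i) _ _).symm
  let ρ : ℤ → N →+ N := fun n =>
    AddMonoidHom.mk' (fun z => ⟨σ n z.1, hN n z⟩) fun z w => Subtype.ext (map_add (σ n) z.1 w.1)
  refine ⟨_, ρ, hσ.comap N.subtype.toAddMonoidHom N.injective_subtype ρ fun n z => rfl, ?_, ?_⟩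
  · intro d h hh n z
    refine Subtype.ext (funext fun i => ?_)
    change hcomp (n - ε i) (h * z.1 i) = h * hcomp (n - d - ε i) (z.1 i)
    rw [hh.hcomp_mul, sub_right_comm]
  · intro n z hz i
    exact AddSubgroup.mem_pi _ |>.1 hz i trivial

-- Write `g` in terms of two arbitrary generators and back. By minimality the constant terms give
-- the `k × k` identity as a product through `K²`, so `k ≤ 2`, even though `R4` is not local.
omit [CharZero K] in
theorem card_eq_two_of_minimal {M : Type*} [AddCommGroup M] [Module (R4 K) M]
    [Module.Finite (R4 K) M] (hrank : (⊤ : Submodule (R4 K) M).spanFinrank = 2) {k : ℕ}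
    {g : Fin k → M} (hspan : Submodule.span (R4 K) (Set.range g) = ⊤)
    (hmin : ∀ z : Fin k → MvPolynomial (Fin 4) K, ∑ i, toR4 K (z i) • g i = 0 →
      ∀ i, constantCoeff (z i) = 0) : k = 2 := by
  classical
  apply le_antisymm
  · obtain ⟨s, hs, hs'⟩ := Submodule.FG.exists_span_finset_card_eq_spanFinrank
      (Module.Finite.fg_top (R := R4 K) (M := M))
    rw [hrank] at hs
    let e : Fin 2 ≃ s := (s.equivFinOfCardEq hs).symm
    let h : Fin 2 → M := fun j => e j
    have hh : Submodule.span (R4 K) (Set.range h) = ⊤ := by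
      rw [← hs']
      congr 1
      ext x
      constructor
      · rintro ⟨i, rfl⟩
        exact (e i).2
      · intro hx
        exact ⟨e.symm ⟨x, hx⟩, by simp [h]⟩
    have h1 : ∀ i, ∃ c : Fin 2 → MvPolynomial (Fin 4) K, ∑ j, toR4 K (c j) • h j = g i :=
      fun i => by
        have : g i ∈ Submodule.span (R4 K) (Set.range h) := hh ▸ trivial
        obtain ⟨c, hc⟩ := (Submodule.mem_span_range_iff_exists_fun _).1 this
        obtain ⟨c, rfl⟩ := exists_lift_vec c
        exact ⟨c, hc⟩
    have h2 : ∀ j, ∃ c : Fin k → MvPolynomial (Fin 4) K, ∑ i, toR4 K (c i) • g i = h j :=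
      fun j => by
        have : h j ∈ Submodule.span (R4 K) (Set.range g) := hspan ▸ trivial
        obtain ⟨c, hc⟩ := (Submodule.mem_span_range_iff_exists_fun _).1 this
        obtain ⟨c, rfl⟩ := exists_lift_vec c
        exact ⟨c, hc⟩
    choose B hB using h1
    choose D hD using h2
    let B₀ : Matrix (Fin k) (Fin 2) K := Matrix.of fun i j => constantCoeff (B i j)
    let D₀ : Matrix (Fin 2) (Fin k) K := Matrix.of fun j i => constantCoeff (D j i)
    have hBD : B₀ * D₀ = 1 := by
      ext i l
      have h3 : ∑ m, toR4 K (∑ j, B i j * D j m - Pi.single (M := fun _ => _) i 1 m) • g m = 0 := by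
        simp only [map_sub, map_sum, map_mul, sub_smul, Finset.sum_sub_distrib, Finset.sum_smul]
        rw [Finset.sum_comm, sub_eq_zero]
        calc ∑ j, ∑ m, (toR4 K (B i j) * toR4 K (D j m)) • g m
            = ∑ j, toR4 K (B i j) • h j := by
              refine Finset.sum_congr rfl fun j _ => ?_
              rw [← hD j, Finset.smul_sum]
              exact Finset.sum_congr rfl fun m _ => mul_smul _ _ _
          _ = g i := hB i
          _ = _ := by
              rw [Finset.sum_eq_single i]
              · simp
              · intro m _ hm
                rw [Pi.single_eq_of_ne hm, map_zero]
                exact zero_smul (R4 K) (g m)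
              · simp
      have h4 := hmin _ h3 l
      rw [map_sub, map_sum, sub_eq_zero] at h4
      rw [Matrix.mul_apply, Matrix.one_apply]
      simp only [map_mul] at h4
      simp only [B₀, D₀, Matrix.of_apply]
      rw [h4]
      by_cases hil : i = l
      · subst hil; simp
      · rw [if_neg hil, Pi.single_eq_of_ne (Ne.symm hil), map_zero]
    have h5 := Matrix.rank_mul_le_left B₀ D₀
    rw [hBD, Matrix.rank_one, Fintype.card_fin] at h5
    have h6 := Matrix.rank_le_card_width B₀
    rw [Fintype.card_fin] at h6
    omega
  · rw [← hrank, ← hspan]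
    refine (Submodule.spanFinrank_span_le_ncard_of_finite (Set.finite_range g)).trans ?_
    rw [← Set.image_univ]
    refine (Set.ncard_image_le Set.finite_univ).trans ?_
    simp

/-- A two-generated graded maximal Cohen-Macaulay module is presented by a `2 × 2` matrix over the
polynomial ring. -/
theorem IsGradedMCM.exists_isPresentation {M : Type*} [AddCommGroup M] [Module (R4 K) M]
    {ℳ : ℤ → AddSubgroup M} (h : IsGradedMCM (K := K) ℳ)
    (hrank : (⊤ : Submodule (R4 K) M).spanFinrank = 2) :
    ∃ (δ ε : Fin 2 → ℤ) (A : Matrix (Fin 2) (Fin 2) (MvPolynomial (Fin 4) K)),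
      IsPresentation ℳ A δ ∧ IsHomMat δ ε A ∧ IsMinimal A := by
  classical
  let _ : Module (MvPolynomial (Fin 4) K) M := Module.compHom M (toR4 K)
  have hsm : ∀ (p : MvPolynomial (Fin 4) K) (y : M), p • y = toR4 K p • y := fun p y => rfl
  have := h.finite
  have hspan_eq : ∀ (s : Set M), Submodule.span (R4 K) s = ⊤ →
      Submodule.span (MvPolynomial (Fin 4) K) s = ⊤ := fun s hs => by
    rw [eq_top_iff]
    intro x _
    have hx : x ∈ Submodule.span (R4 K) s := hs ▸ trivial
    induction hx using Submodule.span_induction with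
    | mem x hx => exact Submodule.subset_span hx
    | zero => exact zero_mem _
    | add x y _ _ hx hy => exact add_mem (hx trivial) (hy trivial)
    | smul r x _ hx =>
      obtain ⟨p, rfl⟩ := Ideal.Quotient.mk_surjective r
      rw [← hsm]
      exact Submodule.smul_mem _ _ (hx trivial)
  have hspan_eq' : ∀ (s : Set M), Submodule.span (MvPolynomial (Fin 4) K) s = ⊤ →
      Submodule.span (R4 K) s = ⊤ := fun s hs => by
    rw [eq_top_iff]
    intro x _
    have hx : x ∈ Submodule.span (MvPolynomial (Fin 4) K) s := hs ▸ trivial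
    induction hx using Submodule.span_induction with
    | mem x hx => exact Submodule.subset_span hx
    | zero => exact zero_mem _
    | add x y _ _ hx hy => exact add_mem (hx trivial) (hy trivial)
    | smul r x _ hx =>
      rw [hsm]
      exact Submodule.smul_mem _ _ (hx trivial)
  have : Module.Finite (MvPolynomial (Fin 4) K) M := by
    obtain ⟨s, hs⟩ := this.fg_top
    exact ⟨⟨s, hspan_eq _ hs⟩⟩
  obtain ⟨π, hπ⟩ := exists_isDecomp h.isGrading.isInternal
  have hc : IsCompatible (K := K) π := fun d p hp n x => by
    rw [hsm, hsm]
    exact h.isGrading.proj_smul hπ hp.toR4_mem n x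
  obtain ⟨k, δ, g, hg, hspan, hmin⟩ := exists_minimal_generators hπ hc
  have hk := card_eq_two_of_minimal hrank (hspan_eq' _ hspan) hmin
  subst hk
  obtain ⟨v, hv, hreg⟩ := h.exists_isReg hsm
  let τ := Fintype.linearCombination (MvPolynomial (Fin 4) K) g
  have hτ : LinearMap.range τ = ⊤ := by
    rw [← hspan]; exact Fintype.range_linearCombination _ _
  obtain ⟨𝒩, ρ, hρ, hρc, h𝒩⟩ := exists_isDecomp_ker hπ hc hg
  obtain ⟨l, ε, G, hG, hGspan, hGmin⟩ := exists_minimal_generators hρ hρc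
  let τ' : (Fin l → MvPolynomial (Fin 4) K) →ₗ[MvPolynomial (Fin 4) K]
    (Fin 2 → MvPolynomial (Fin 4) K) :=
    (LinearMap.ker τ).subtype ∘ₗ Fintype.linearCombination (MvPolynomial (Fin 4) K) G
  have hτ' : LinearMap.range τ' = LinearMap.ker τ := by
    rw [LinearMap.range_comp, Fintype.range_linearCombination, hGspan, Submodule.map_top,
      Submodule.range_subtype]
  have hreg' : IsReg (LinearMap.range τ')
      (([3, 2, 1, 0] : List (Fin 4)).map fun j => linForm (v j)) := by
    rw [hτ']
    -- Depth 3 on `M` and depth 4 on the free cover give depth 4 on the relations.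
    refine isReg_ker τ (l := ([2, 1, 0] : List (Fin 4)).map fun j => linForm (v j))
      (hτ ▸ hreg) (isReg_top_linForm hv 2 (l := [3, 2, 1, 0]) (by decide))
  -- The four forms generate the irrelevant ideal, and minimal relations have coefficients in it;
  -- hence the relation module is free.
  have hinj : LinearMap.ker τ' = ⊥ := by
    refine ker_eq_bot_of_isReg τ' hreg' (ofList_linForm_ne_top v _) fun z hz i =>
      mem_ofList_linForm hv (hGmin z (Subtype.ext hz) i)
  -- The relation module embeds in `S²` and contains `f4 S²`, so its rank is 2.
  have hl : l = 2 := by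
    have h1 := card_le_of_injective _ τ' (LinearMap.ker_eq_bot.1 hinj)
    let e := LinearEquiv.ofInjective τ' (LinearMap.ker_eq_bot.1 hinj)
    have hf : ∀ w : Fin 2 → MvPolynomial (Fin 4) K, f4 K • w ∈ LinearMap.range τ' := fun w => by
      rw [hτ', LinearMap.mem_ker, map_smul, hsm, toR4_eq_zero.2 dvd_rfl]
      exact zero_smul (R4 K) (τ w)
    let θ : (Fin 2 → MvPolynomial (Fin 4) K) →ₗ[MvPolynomial (Fin 4) K]
        (Fin l → MvPolynomial (Fin 4) K) :=
      e.symm.toLinearMap ∘ₗ LinearMap.codRestrict _ (LinearMap.lsmul _ _ (f4 K)) hf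
    have hθ : Function.Injective θ := by
      refine e.symm.injective.comp ?_
      intro w w' hww
      exact smul_right_injective _ (prime_f4 K).ne_zero (congrArg Subtype.val hww)
    have h2 := card_le_of_injective _ θ hθ
    rw [Fintype.card_fin, Fintype.card_fin] at h1 h2
    omega
  subst hl
  refine ⟨δ, ε, Matrix.of fun i j => (G j).1 i, ⟨g, hg, hspan_eq' _ hspan, fun z => ?_⟩,
    fun i j => h𝒩 _ _ (hG j) i, fun i j => hmin _ (G j).2 i⟩
  have hz : ∑ i, toR4 K (z i) • g i = 0 ↔ z ∈ LinearMap.range τ' := by rw [hτ']; rfl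
  rw [hz]
  have hmul : ∀ u, τ' u = (Matrix.of fun i j => (G j).1 i : Matrix (Fin 2) (Fin 2) _).mulVec u :=
    fun u => by
      ext1 i
      simp [τ', Fintype.linearCombination_apply, Matrix.mulVec, dotProduct, mul_comm]
  constructor
  · rintro ⟨u, rfl⟩
    exact ⟨u, hmul u⟩
  · rintro ⟨u, rfl⟩
    exact ⟨u, hmul u⟩

end Presentation

end FermatCubic

namespace FermatCubic

open MvPolynomial

/-! ### Lines on the Fermat cubic surface. -/

section Lines

variable {K : Type*} [Field K] [CharZero K]

theorem eq_zero_of_cube_sum_eq_zero {α β γ δ : K}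
    (h : ∀ s t : K, s ^ 3 + t ^ 3 + (α * s + β * t) ^ 3 + (γ * s + δ * t) ^ 3 = 0) :
    (α = 0 ∧ δ = 0 ∧ β ^ 3 = -1 ∧ γ ^ 3 = -1) ∨ (β = 0 ∧ γ = 0 ∧ α ^ 3 = -1 ∧ δ ^ 3 = -1) := by
  have h10 : 1 + α ^ 3 + γ ^ 3 = 0 := by linear_combination h 1 0
  have h01 : 1 + β ^ 3 + δ ^ 3 = 0 := by linear_combination h 0 1
  -- The coefficients of `s² t` and `s t²`, up to the factor 3, interpolated from values at `(1,
  -- ±1)` and at the basis vectors.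
  have hP : α ^ 2 * β + γ ^ 2 * δ = 0 := by
    linear_combination (1 / 6 : K) * h 1 1 - (1 / 6 : K) * h 1 (-1) - (1 / 3 : K) * h 0 1
  have hQ : α * β ^ 2 + γ * δ ^ 2 = 0 := by
    linear_combination (1 / 6 : K) * h 1 1 + (1 / 6 : K) * h 1 (-1) - (1 / 3 : K) * h 1 0
  by_cases hα : α = 0
  · subst hα
    have hγ : γ ^ 3 = -1 := by linear_combination h10
    have hγ0 : γ ≠ 0 := by rintro rfl; norm_num at hγ
    have hδ : δ = 0 := by simpa [hγ0] using hP
    subst hδ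
    exact Or.inl ⟨rfl, rfl, by linear_combination h01, hγ⟩
  · by_cases hβ : β = 0
    · subst hβ
      have hδ : δ ^ 3 = -1 := by linear_combination h01
      have hδ0 : δ ≠ 0 := by rintro rfl; norm_num at hδ
      have hγ : γ = 0 := by simpa [hδ0] using hP
      subst hγ
      exact Or.inr ⟨rfl, rfl, by linear_combination h10, hδ⟩
    · exfalso
      have h1 : α * δ = β * γ := by
        have : α * β * (α * δ - β * γ) = 0 := by linear_combination δ * hP - γ * hQ
        have := (mul_eq_zero.1 this).resolve_left (mul_ne_zero hα hβ)
        linear_combination this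
      -- Using `αδ = βγ`, the left side is `β (α³ + γ³)`.
      have h2 : α * (α ^ 2 * β + γ ^ 2 * δ) = -β := by
        linear_combination γ ^ 2 * h1 + β * h10
      rw [hP, mul_zero] at h2
      exact hβ (neg_eq_zero.1 h2.symm)

omit [CharZero K] in
theorem sum_fin_four {i j k l : Fin 4} (hij : i ≠ j) (hik : i ≠ k) (hil : i ≠ l) (hjk : j ≠ k)
    (hjl : j ≠ l) (hkl : k ≠ l) (g : Fin 4 → K) : ∑ m, g m = g i + g j + g k + g l := by
  have h : (Finset.univ : Finset (Fin 4)) = {i, j, k, l} := by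
    revert i j k l
    decide
  rw [h, Finset.sum_insert (by simp [hij, hik, hil]), Finset.sum_insert (by simp [hjk, hjl]),
    Finset.sum_insert (by simp [hkl]), Finset.sum_singleton]
  ring

set_option synthInstance.maxHeartbeats 400000 in
set_option synthInstance.maxSize 1000 in
/-- The four variables are partitioned into two pairs as in a `Datum`. -/
theorem exists_index_partition : ∀ k j l i : Fin 4, k ≠ j → k ≠ l → k ≠ i → j ≠ l → j ≠ i →
    l ≠ i → ∃ i' j' s' : Fin 4, i' < j' ∧ ({i', j', s'} : Finset (Fin 4)) = {1, 2, 3} ∧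
      ((((k = 0 ∧ j = s') ∨ (k = s' ∧ j = 0)) ∧ ((l = i' ∧ i = j') ∨ (l = j' ∧ i = i'))) ∨
       (((l = 0 ∧ i = s') ∨ (l = s' ∧ i = 0)) ∧ ((k = i' ∧ j = j') ∨ (k = j' ∧ j = i')))) := by
  decide +kernel

/-- The linear form `X i - β X j`, with `β ^ 3 = -1`, lies in `V`. -/
def HasBinomial (V : Submodule K (Fin 4 → K)) (i j : Fin 4) : Prop :=
  ∃ β : K, β ^ 3 = -1 ∧ (Pi.single i 1 - β • Pi.single j 1 : Fin 4 → K) ∈ V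

omit [CharZero K] in
theorem HasBinomial.symm {V : Submodule K (Fin 4 → K)} {i j : Fin 4} (h : HasBinomial V i j) :
    HasBinomial V j i := by
  obtain ⟨β, hβ, hV⟩ := h
  have hβ0 : β ≠ 0 := by rintro rfl; simp at hβ
  refine ⟨β⁻¹, by rw [inv_pow, hβ, inv_neg, inv_one], ?_⟩
  have h1 : (Pi.single j 1 - β⁻¹ • Pi.single i 1 : Fin 4 → K) =
      (-β⁻¹) • (Pi.single i 1 - β • Pi.single j 1 : Fin 4 → K) := by
    rw [smul_sub, smul_smul, neg_mul, inv_mul_cancel₀ hβ0]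
    simp only [neg_smul, one_smul]
    abel
  rw [h1]
  exact Submodule.smul_mem _ _ hV

omit [CharZero K] in
theorem exists_datum_of_hasBinomial {V : Submodule K (Fin 4 → K)} {k j l i : Fin 4} (hkj : k ≠ j)
    (hkl : k ≠ l) (hki : k ≠ i) (hjl : j ≠ l) (hji : j ≠ i) (hli : l ≠ i)
    (h1 : HasBinomial V k j) (h2 : HasBinomial V l i) : ∃ p : Datum K, ∀ r, p.form r ∈ V := by
  obtain ⟨i', j', s', hij, hperm, h⟩ := exists_index_partition k j l i hkj hkl hki hjl hji hli
  have H : HasBinomial V 0 s' ∧ HasBinomial V i' j' := by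
    rcases h with ⟨⟨rfl, rfl⟩ | ⟨rfl, rfl⟩, ⟨rfl, rfl⟩ | ⟨rfl, rfl⟩⟩ |
      ⟨⟨rfl, rfl⟩ | ⟨rfl, rfl⟩, ⟨rfl, rfl⟩ | ⟨rfl, rfl⟩⟩
    · exact ⟨h1, h2⟩
    · exact ⟨h1, h2.symm⟩
    · exact ⟨h1.symm, h2⟩
    · exact ⟨h1.symm, h2.symm⟩
    · exact ⟨h2, h1⟩
    · exact ⟨h2, h1.symm⟩
    · exact ⟨h2.symm, h1⟩
    · exact ⟨h2.symm, h1.symm⟩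
  obtain ⟨⟨a, ha, hV⟩, b, hb, hV'⟩ := H
  refine ⟨⟨a, b, i', j', s', ha, hb, hij, hperm⟩, fun r => ?_⟩
  fin_cases r
  · exact hV
  · exact hV'

set_option linter.unusedSimpArgs false in
/-- The lines on the Fermat cubic surface. -/
theorem exists_datum_of_vanishing {v w : Fin 4 → K} {k l : Fin 4}
    (hdet : v k * w l - v l * w k ≠ 0)
    (hvan : ∀ x : Fin 4 → K, ∑ m, v m * x m = 0 → ∑ m, w m * x m = 0 → ∑ m, x m ^ 3 = 0) :
    ∃ p : Datum K, ∀ r, ∃ x y : K, p.form r = x • v + y • w := by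
  have hkl : k ≠ l := by
    rintro rfl
    exact hdet (by ring)
  obtain ⟨i, j, hij, hik, hil, hjk, hjl⟩ : ∃ i j : Fin 4, i ≠ j ∧ i ≠ k ∧ i ≠ l ∧ j ≠ k ∧ j ≠ l := by
    clear hvan hdet
    revert k l
    decide
  have hsum := sum_fin_four (K := K) hij hik hil hjk hjl hkl
  set d := v k * w l - v l * w k with hd
  let V := Submodule.span K {v, w}
  have hmem : ∀ u ∈ V, ∃ x y : K, u = x • v + y • w := fun u hu => by
    obtain ⟨x, y, h⟩ := Submodule.mem_span_pair.1 hu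
    exact ⟨x, y, h.symm⟩
  -- By Cramer's rule, the basis of the span that is in reduced form with respect to the coordinates
  -- `k` and `l`.
  let f : Fin 4 → K := (w l / d) • v - (v l / d) • w
  let g : Fin 4 → K := (v k / d) • w - (w k / d) • v
  have hv : v ∈ V := Submodule.subset_span (by simp)
  have hw : w ∈ V := Submodule.subset_span (by simp)
  have hf : f ∈ V := sub_mem (Submodule.smul_mem _ _ hv) (Submodule.smul_mem _ _ hw)
  have hg : g ∈ V := sub_mem (Submodule.smul_mem _ _ hw) (Submodule.smul_mem _ _ hv)
  have hf' : ∀ m, f m = (w l * v m - v l * w m) / d := fun m => by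
    simp only [f, Pi.sub_apply, Pi.smul_apply, smul_eq_mul]; ring
  have hg' : ∀ m, g m = (v k * w m - w k * v m) / d := fun m => by
    simp only [g, Pi.sub_apply, Pi.smul_apply, smul_eq_mul]; ring
  have hvfg : ∀ m, v m = v k * f m + v l * g m := fun m => by
    rw [hf', hg']; field_simp; rw [hd]; ring
  have hwfg : ∀ m, w m = w k * f m + w l * g m := fun m => by
    rw [hf', hg']; field_simp; rw [hd]; ring
  have hfk : f k = 1 := by rw [hf', div_eq_one_iff_eq hdet, hd]; ring
  have hfl : f l = 0 := by rw [hf', div_eq_zero_iff]; left; ring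
  have hgk : g k = 0 := by rw [hg', div_eq_zero_iff]; left; ring
  have hgl : g l = 1 := by rw [hg', div_eq_one_iff_eq hdet, hd]; ring
  -- The line is parametrized by the remaining coordinates `x i = s`, `x j = t`.
  have hcubic : ∀ s t : K, s ^ 3 + t ^ 3 + (-f i * s + -f j * t) ^ 3 +
      (-g i * s + -g j * t) ^ 3 = 0 := fun s t => by
    let x : Fin 4 → K := fun m => if m = i then s else if m = j then t else
      if m = k then -f i * s + -f j * t else -g i * s + -g j * t
    have xi : x i = s := by simp [x]
    have xj : x j = t := by simp [x, hij.symm]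
    have xk : x k = -f i * s + -f j * t := by simp [x, hik.symm, hjk.symm]
    have xl : x l = -g i * s + -g j * t := by simp [x, hil.symm, hjl.symm, hkl.symm]
    have h1 : ∑ m, f m * x m = 0 := by
      rw [hsum, xi, xj, xk, xl, hfk, hfl]; ring
    have h2 : ∑ m, g m * x m = 0 := by
      rw [hsum, xi, xj, xk, xl, hgk, hgl]; ring
    have h3 : ∀ a b : K, ∑ m, (a * f m + b * g m) * x m = 0 := fun a b => by
      have : ∀ m, (a * f m + b * g m) * x m = a * (f m * x m) + b * (g m * x m) := fun m => by ring
      simp only [this, Finset.sum_add_distrib, ← Finset.mul_sum, h1, h2, mul_zero, add_zero]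
    have h4 := hvan x ((Finset.sum_congr rfl fun m _ => congrArg (· * x m) (hvfg m)).trans
      (h3 _ _)) ((Finset.sum_congr rfl fun m _ => congrArg (· * x m) (hwfg m)).trans (h3 _ _))
    rw [hsum, xi, xj, xk, xl] at h4
    exact h4
  have hext : ∀ u u' : Fin 4 → K, u i = u' i → u j = u' j → u k = u' k → u l = u' l → u = u' := by
    intro u u' hi hj hk hl
    ext m
    have : m = i ∨ m = j ∨ m = k ∨ m = l := by
      clear * - hij hik hil hjk hjl hkl
      omega
    rcases this with rfl | rfl | rfl | rfl <;> assumption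
  suffices H : ∃ p : Datum K, ∀ r, p.form r ∈ V by
    obtain ⟨p, hp⟩ := H
    exact ⟨p, fun r => hmem _ (hp r)⟩
  rcases eq_zero_of_cube_sum_eq_zero hcubic with ⟨h1, h2, h3, h4⟩ | ⟨h1, h2, h3, h4⟩
  · have e1 : (Pi.single k 1 - (-f j) • Pi.single j 1 : Fin 4 → K) = f := by
      apply hext <;> simp [hij, hik, hil, hjk, hjl, hkl, hij.symm, hik.symm, hil.symm, hjk.symm,
        hjl.symm, hkl.symm, hfk, hfl, neg_eq_zero.1 h1]
    have e2 : (Pi.single l 1 - (-g i) • Pi.single i 1 : Fin 4 → K) = g := by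
      apply hext <;> simp [hij, hik, hil, hjk, hjl, hkl, hij.symm, hik.symm, hil.symm, hjk.symm,
        hjl.symm, hkl.symm, hgk, hgl, neg_eq_zero.1 h2]
    exact exists_datum_of_hasBinomial hjk.symm hkl hik.symm hjl hij.symm hil.symm
      ⟨-f j, h3, e1.symm ▸ hf⟩ ⟨-g i, h4, e2.symm ▸ hg⟩
  · have e1 : (Pi.single k 1 - (-f i) • Pi.single i 1 : Fin 4 → K) = f := by
      apply hext <;> simp [hij, hik, hil, hjk, hjl, hkl, hij.symm, hik.symm, hil.symm, hjk.symm,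
        hjl.symm, hkl.symm, hfk, hfl, neg_eq_zero.1 h1]
    have e2 : (Pi.single l 1 - (-g j) • Pi.single j 1 : Fin 4 → K) = g := by
      apply hext <;> simp [hij, hik, hil, hjk, hjl, hkl, hij.symm, hik.symm, hil.symm, hjk.symm,
        hjl.symm, hkl.symm, hgk, hgl, neg_eq_zero.1 h2]
    exact exists_datum_of_hasBinomial hik.symm hkl hjk.symm hil hij hjl.symm
      ⟨-f i, h3, e1.symm ▸ hf⟩ ⟨-g j, h4, e2.symm ▸ hg⟩

omit [CharZero K] in
theorem IsHomZ.eq_linForm {p : MvPolynomial (Fin 4) K} (hp : IsHomZ 1 p) :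
    p = linForm (linPart p) := hp.eq_sum_X

omit [CharZero K] in
theorem linForm_add_smul (x y : K) (v w : Fin 4 → K) :
    linForm (x • v + y • w) = C x * linForm v + C y * linForm w := by
  simp only [linForm, Pi.add_apply, Pi.smul_apply, smul_eq_mul, map_add, map_mul, add_mul,
    Finset.sum_add_distrib, Finset.mul_sum, mul_assoc]

omit [CharZero K] in
theorem linForm_form_zero (p : Datum K) : linForm (p.form 0) = X 0 - C p.a * X p.s := by
  rw [(isHomZ_X_sub p.a 0 p.s).eq_linForm, linPart_X_sub]; rfl

omit [CharZero K] in
theorem linForm_form_one (p : Datum K) : linForm (p.form 1) = X p.i - C p.b * X p.j := by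
  rw [(isHomZ_X_sub p.b p.i p.j).eq_linForm, linPart_X_sub]; rfl

/-- The form `f₄` is not a product of polynomials without constant term. -/
theorem mul_ne_C_mul_f4 {c : K} (hc : c ≠ 0) {x y : MvPolynomial (Fin 4) K}
    (hx : constantCoeff x = 0) (hy : constantCoeff y = 0) : x * y ≠ C c * f4 K := by
  intro h
  have hnu : ∀ {z : MvPolynomial (Fin 4) K}, constantCoeff z = 0 → ¬ IsUnit z := fun hz hu => by
    have := hu.map (constantCoeff (R := K) (σ := Fin 4))
    rw [hz] at this
    exact not_isUnit_zero this
  have hu : IsUnit (C c : MvPolynomial (Fin 4) K) := (IsUnit.mk0 c hc).map C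
  have hirr : Irreducible (C c * f4 K) :=
    ((irreducible_isUnit_mul hu).2 (prime_f4 K).irreducible)
  rw [← h] at hirr
  rcases hirr.isUnit_or_isUnit rfl with h | h
  · exact hnu hx h
  · exact hnu hy h

/-- Two linear forms that generate an ideal containing `f₄` are equivalent to those of a `Datum`. -/
theorem exists_datum_of_mem {c : K} (hc : c ≠ 0) {l₁ l₂ q₁ q₂ : MvPolynomial (Fin 4) K}
    (h₁ : IsHomZ 1 l₁) (h₂ : IsHomZ 1 l₂) (hq₁ : constantCoeff q₁ = 0)
    (hq₂ : constantCoeff q₂ = 0) (h : l₁ * q₁ + l₂ * q₂ = C c * f4 K) :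
    ∃ (p : Datum K) (G : Matrix (Fin 2) (Fin 2) K), G.det ≠ 0 ∧
      X 0 - C p.a * X p.s = C (G 0 0) * l₁ + C (G 0 1) * l₂ ∧
      X p.i - C p.b * X p.j = C (G 1 0) * l₁ + C (G 1 1) * l₂ := by
  have e₁ := h₁.eq_linForm
  have e₂ := h₂.eq_linForm
  set v := linPart l₁
  set w := linPart l₂
  have heval : ∀ (u x : Fin 4 → K), eval x (linForm u) = ∑ m, u m * x m := fun u x => by
    simp [linForm]
  -- If the forms were proportional, `f4` would be a product of two polynomials without constant
  -- term.
  have hdet : ∃ k l, v k * w l - v l * w k ≠ 0 := by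
    by_contra! H
    by_cases hv : v = 0
    · have h0 : l₁ = 0 := by rw [e₁, hv]; simp [linForm]
      rw [h0, zero_mul, zero_add] at h
      refine mul_ne_C_mul_f4 hc ?_ hq₂ h
      rw [e₂]; exact linForm_mem _
    · obtain ⟨k, hk⟩ := Function.ne_iff.1 hv
      have hk' : v k ≠ 0 := hk
      have hw : w = (w k / v k) • v + (0 : K) • v := by
        ext m
        have := H k m
        simp only [Pi.add_apply, Pi.smul_apply, smul_eq_mul, zero_mul, add_zero]
        field_simp
        linear_combination this
      have h0 : l₂ = C (w k / v k) * l₁ := by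
        rw [e₂, e₁]
        conv_lhs => rw [hw, linForm_add_smul, map_zero, zero_mul, add_zero]
      rw [h0] at h
      refine mul_ne_C_mul_f4 hc (x := l₁) (y := q₁ + C (w k / v k) * q₂) ?_ ?_ ?_
      · rw [e₁]; exact linForm_mem _
      · simp [hq₁, hq₂]
      · rw [← h]; ring
  obtain ⟨k, l, hdet⟩ := hdet
  obtain ⟨p, hp⟩ := exists_datum_of_vanishing hdet fun x hx hx' => by
    have h3 := congrArg (eval x) h
    rw [map_add, map_mul, map_mul, map_mul, e₁, e₂, heval, heval, hx, hx', zero_mul, zero_mul,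
      add_zero, eval_C] at h3
    have h4 := (mul_eq_zero.1 h3.symm).resolve_left hc
    rw [Fin.sum_univ_four, ← h4]
    simp [f4]
  choose x y hxy using hp
  refine ⟨p, !![x 0, y 0; x 1, y 1], ?_, ?_, ?_⟩
  · rw [Matrix.det_fin_two_of]
    intro h0
    have h1 := p.form_independent (x := y 1) (y := -y 0) (by
      rw [hxy 0, hxy 1]
      ext m
      simp only [Pi.add_apply, Pi.smul_apply, smul_eq_mul, Pi.zero_apply]
      linear_combination v m * h0)
    have h2 := p.form_independent (x := x 1) (y := -x 0) (by
      rw [hxy 0, hxy 1]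
      ext m
      simp only [Pi.add_apply, Pi.smul_apply, smul_eq_mul, Pi.zero_apply]
      linear_combination -w m * h0)
    have h3 := p.form_independent (x := 1) (y := 0) (by
      rw [hxy 0, neg_eq_zero.1 h1.2, neg_eq_zero.1 h2.2]; simp)
    exact one_ne_zero h3.1
  · rw [← linForm_form_zero, hxy 0, linForm_add_smul, ← e₁, ← e₂]; rfl
  · rw [← linForm_form_one, hxy 1, linForm_add_smul, ← e₁, ← e₂]; rfl

end Lines

end FermatCubic

namespace FermatCubic

open MvPolynomial

/-! ### Coprimality of the two linear forms of a datum. -/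

section Coprime

variable {K : Type*} [Field K]

theorem Datum.i_ne_zero (p : Datum K) : p.i ≠ 0 := by
  rcases p.cases with ⟨h, -, -⟩ | ⟨h, -, -⟩ | ⟨h, -, -⟩ <;> rw [h] <;> decide

theorem Datum.i_ne_s (p : Datum K) : p.i ≠ p.s := by
  rcases p.cases with ⟨h, -, h'⟩ | ⟨h, -, h'⟩ | ⟨h, -, h'⟩ <;> rw [h, h'] <;> decide

theorem Datum.i_ne_j (p : Datum K) : p.i ≠ p.j := p.hij.ne

theorem Datum.prime_linear (p : Datum K) :
    Prime (X 0 - C p.a * X p.s : MvPolynomial (Fin 4) K) := by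
  have hcoeff : coeff (Finsupp.single 0 1) (X 0 - C p.a * X p.s : MvPolynomial (Fin 4) K) = 1 := by
    have := congrFun (linPart_X_sub p.a 0 p.s) 0
    simpa [linPart, p.s_ne_zero.symm] using this
  have hne : (X 0 - C p.a * X p.s : MvPolynomial (Fin 4) K) ≠ 0 := by
    intro h
    rw [h, coeff_zero] at hcoeff
    exact zero_ne_one hcoeff
  refine (irreducible_of_totalDegree_eq_one ?_ fun x hx => ?_).prime
  · exact (isHomZ_natCast.1 (by exact_mod_cast isHomZ_X_sub p.a 0 p.s)).totalDegree hne
  · have := hx (Finsupp.single 0 1)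
    rw [hcoeff] at this
    exact isUnit_of_dvd_one this

theorem Datum.linear_dvd_of_dvd_mul (p : Datum K) {t : MvPolynomial (Fin 4) K}
    (h : (X 0 - C p.a * X p.s : MvPolynomial (Fin 4) K) ∣ (X p.i - C p.b * X p.j) * t) :
    (X 0 - C p.a * X p.s : MvPolynomial (Fin 4) K) ∣ t := by
  refine (p.prime_linear.dvd_or_dvd h).resolve_left fun ⟨q, hq⟩ => ?_
  -- At this point the first form vanishes and the second takes the value 1.
  have := congrArg (eval (Pi.single p.i 1 : Fin 4 → K)) hq
  simp [p.i_ne_zero.symm, p.i_ne_s.symm, p.i_ne_j.symm] at this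

end Coprime

/-! ### Changes of generators and relations. -/

section Presentation

variable {K : Type*} [Field K] {M : Type*} [AddCommGroup M] [Module (R4 K) M]
  {ℳ : ℤ → AddSubgroup M} {A : Matrix (Fin 2) (Fin 2) (MvPolynomial (Fin 4) K)} {δ : Fin 2 → ℤ}

theorem IsPresentation.of_mul_right (h : IsPresentation ℳ A δ)
    {B V V' : Matrix (Fin 2) (Fin 2) (MvPolynomial (Fin 4) K)} (h₁ : A = B * V)
    (h₂ : B = A * V') : IsPresentation ℳ B δ := by
  obtain ⟨g, hg, hspan, hrel⟩ := h
  refine ⟨g, hg, hspan, fun z => (hrel z).trans ⟨?_, ?_⟩⟩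
  · rintro ⟨u, rfl⟩
    exact ⟨V.mulVec u, by rw [Matrix.mulVec_mulVec, ← h₁]⟩
  · rintro ⟨u, rfl⟩
    exact ⟨V'.mulVec u, by rw [Matrix.mulVec_mulVec, ← h₂]⟩

/-- The new generators are the combinations of the old ones with coefficients in the columns of `U`;
homogeneity of `U` keeps them homogeneous. -/
theorem IsPresentation.of_mul_left (hℳ : IsGrading (K := K) ℳ)
    {U U' : Matrix (Fin 2) (Fin 2) (MvPolynomial (Fin 4) K)}
    (h : IsPresentation ℳ (U * A) δ) {δ' : Fin 2 → ℤ} (hU : IsHomMat δ δ' U) (h₁ : U * U' = 1)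
    (h₂ : U' * U = 1) : IsPresentation ℳ A δ' := by
  obtain ⟨g, hg, hspan, hrel⟩ := h
  have hsum : ∀ z : Fin 2 → MvPolynomial (Fin 4) K,
      ∑ j, toR4 K (z j) • ∑ i, toR4 K (U i j) • g i = ∑ i, toR4 K (U.mulVec z i) • g i := by
    intro z
    simp only [Matrix.mulVec, dotProduct, Finset.smul_sum, map_sum, map_mul, Finset.sum_smul,
      smul_smul]
    rw [Finset.sum_comm]
    simp only [mul_comm]
  refine ⟨fun j => ∑ i, toR4 K (U i j) • g i, fun j => ?_, ?_, fun z => ?_⟩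
  · refine sum_mem fun i _ => ?_
    have := hℳ.smul_mem _ _ _ _ (hU i j).toR4_mem (hg i)
    rwa [sub_add_cancel] at this
  · rw [eq_top_iff, ← hspan, Submodule.span_le]
    rintro _ ⟨k, rfl⟩
    have h3 := hsum (U'.mulVec (Pi.single k 1))
    rw [Matrix.mulVec_mulVec, h₁, Matrix.one_mulVec] at h3
    have h4 : ∑ i, toR4 K ((Pi.single k 1 : Fin 2 → MvPolynomial (Fin 4) K) i) • g i = g k := by
      rw [Finset.sum_eq_single k]
      · rw [Pi.single_eq_same, map_one]
        exact one_smul (R4 K) (g k)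
      · intro m _ hm
        rw [Pi.single_eq_of_ne hm, map_zero]
        exact zero_smul (R4 K) (g m)
      · simp
    rw [SetLike.mem_coe, ← h4, ← h3]
    exact sum_mem fun j _ => Submodule.smul_mem _ _ (Submodule.subset_span ⟨j, rfl⟩)
  · rw [hsum, hrel]
    constructor
    · rintro ⟨u, hu⟩
      refine ⟨u, ?_⟩
      have := congrArg U'.mulVec hu
      rwa [Matrix.mulVec_mulVec, Matrix.mulVec_mulVec, ← Matrix.mul_assoc, h₂, Matrix.one_mul,
        Matrix.one_mulVec] at this
    · rintro ⟨u, rfl⟩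
      exact ⟨u, by rw [Matrix.mulVec_mulVec]⟩

theorem IsPresentation.gradedIso (h : IsPresentation ℳ A fun i => δ i + c)
    (hℳ : IsGrading (K := K) ℳ) {ε : Fin 2 → ℤ} (hA : IsHomMat δ ε A) :
    GradedIso (K := K) ℳ (cokerGrading A δ) := by
  apply GradedIso.symm
  obtain ⟨g, hg, hspan, hrel⟩ := h
  let τ := Fintype.linearCombination (R4 K) g
  have hker : LinearMap.range (A.map (toR4 K)).mulVecLin = LinearMap.ker τ := by
    ext v
    constructor
    · rintro ⟨u, rfl⟩
      obtain ⟨u, rfl⟩ := exists_lift_vec u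
      rw [Matrix.mulVecLin_apply, map_mulVec_toR4]
      exact (hrel _).2 ⟨u, rfl⟩
    · intro hv
      obtain ⟨w, rfl⟩ := exists_lift_vec v
      obtain ⟨u, rfl⟩ := (hrel w).1 hv
      refine ⟨fun i => toR4 K (u i), ?_⟩
      rw [Matrix.mulVecLin_apply, map_mulVec_toR4]
  have hsurj : Function.Surjective τ := by
    rw [← LinearMap.range_eq_top, ← hspan]
    exact Fintype.range_linearCombination _ _
  let e : Coker A ≃ₗ[R4 K] M :=
    (Submodule.quotEquivOfEq _ _ hker).trans (LinearMap.quotKerEquivOfSurjective τ hsurj)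
  obtain ⟨ρ, hρ⟩ := hA.exists_isDecomp_coker
  obtain ⟨π, hπ⟩ := exists_isDecomp hℳ.isInternal
  refine ⟨c, e, hρ.mem_iff hπ (e : Coker A →+ M) e.injective c ?_⟩
  rintro n _ ⟨v, hv, rfl⟩
  change ∑ i, v i • g i ∈ ℳ (n + c)
  refine sum_mem fun i _ => ?_
  have := hℳ.smul_mem _ _ _ _ (mem_freeGrading.1 hv i) (hg i)
  rwa [show n - δ i + (δ i + c) = n + c by ring] at this

end Presentation

/-! ### Normal forms and the classification. -/

section Classification

variable {K : Type*} [Field K] [CharZero K] {M : Type*} [AddCommGroup M] [Module (R4 K) M]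
  {ℳ : ℤ → AddSubgroup M} {A : Matrix (Fin 2) (Fin 2) (MvPolynomial (Fin 4) K)} {δ : Fin 2 → ℤ}

/-- The determinant of a presentation of a module that is not free. -/
theorem IsPresentation.exists_det_eq (h : IsPresentation ℳ A δ) (hA : IsMinimal A)
    (hfree : ¬ Module.Free (R4 K) M) : ∃ c : K, c ≠ 0 ∧ A.det = C c * f4 K := by
  obtain ⟨g, hg, hspan, hrel⟩ := h
  have h1 : ∀ j, ∃ u, f4 K • (Pi.single j 1 : Fin 2 → MvPolynomial (Fin 4) K) = A.mulVec u :=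
    fun j => (hrel _).1 (Finset.sum_eq_zero fun i _ => by
      have h0 : toR4 K ((f4 K • (Pi.single j 1 : Fin 2 → MvPolynomial (Fin 4) K)) i) = 0 :=
        toR4_eq_zero.2 (dvd_mul_right _ _)
      rw [h0]
      exact zero_smul (R4 K) (g i))
  choose u hu using h1
  let B : Matrix (Fin 2) (Fin 2) (MvPolynomial (Fin 4) K) := Matrix.of fun i j => u j i
  have hAB : A * B = f4 K • (1 : Matrix (Fin 2) (Fin 2) (MvPolynomial (Fin 4) K)) := by
    ext1 i j
    have := congrFun (hu j) i
    rw [Matrix.smul_apply, Matrix.one_apply, ← Pi.single_apply]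
    exact this.symm
  have hdet : A.det * B.det = f4 K ^ 2 := by
    rw [← Matrix.det_mul, hAB, Matrix.det_smul, Matrix.det_one, mul_one, Fintype.card_fin]
  -- So `det A` is a unit times `f4 ^ k`: the constant term excludes `k = 0`, and freeness excludes
  -- `k = 2`.
  obtain ⟨k, hk, v, hv⟩ := (dvd_prime_pow (prime_f4 K) 2).1 ⟨_, hdet.symm⟩
  have hA0 : constantCoeff A.det = 0 := by
    rw [Matrix.det_fin_two, map_sub, map_mul, map_mul, hA 0 0, hA 0 1, zero_mul, zero_mul, sub_zero]
  interval_cases k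
  · exfalso
    have h2 := congrArg constantCoeff hv
    rw [map_mul, hA0, zero_mul, pow_zero, map_one] at h2
    exact zero_ne_one h2
  · obtain ⟨c, hc, hcv⟩ := isUnit_iff_eq_C_of_isReduced.1 (v⁻¹).isUnit
    refine ⟨c, hc.ne_zero, ?_⟩
    rw [← hcv, ← pow_one (f4 K), ← hv, mul_comm A.det, ← mul_assoc, Units.inv_mul, one_mul]
  · exfalso
    apply hfree
    have hA0 : A.det ≠ 0 := left_ne_zero_of_mul (hdet ▸ pow_ne_zero 2 (prime_f4 K).ne_zero)
    have hBv : B.det = v := mul_left_cancel₀ hA0 (hdet.trans hv.symm)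
    -- For `k = 2` the matrix `B` is invertible, so `A B = f4` makes `A` divisible by `f4`, and the
    -- generators have no relations over `R4`.
    have hdvd : ∀ w i, f4 K ∣ A.mulVec w i := fun w i => by
      have h3 : (A * B).mulVec (B.adjugate.mulVec w) = B.det • A.mulVec w := by
        rw [Matrix.mulVec_mulVec, Matrix.mul_assoc, Matrix.mul_adjugate, Matrix.mul_smul,
          Matrix.mul_one, Matrix.smul_mulVec]
      rw [hAB, Matrix.smul_mulVec, Matrix.one_mulVec] at h3
      have h4 := congrFun h3 i
      rw [Pi.smul_apply, Pi.smul_apply, smul_eq_mul, smul_eq_mul, hBv] at h4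
      exact (Units.dvd_mul_left).1 ⟨_, h4.symm⟩
    have hli : LinearIndependent (R4 K) g := by
      rw [Fintype.linearIndependent_iff]
      intro r hr i
      obtain ⟨z, rfl⟩ := exists_lift_vec r
      obtain ⟨w, rfl⟩ := (hrel z).1 hr
      exact toR4_eq_zero.2 (hdvd w i)
    exact Module.Free.of_basis (Module.Basis.mk hli hspan.ge)

omit [CharZero K] in
theorem inv_map_C {G : Matrix (Fin 2) (Fin 2) K} (hG : G.det ≠ 0) :
    (G.map (C : K →+* MvPolynomial (Fin 4) K)) * (G⁻¹).map C = 1 ∧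
      (G⁻¹).map (C : K →+* MvPolynomial (Fin 4) K) * G.map C = 1 := by
  rw [← Matrix.map_mul, ← Matrix.map_mul, Matrix.mul_nonsing_inv G (Ne.isUnit hG),
    Matrix.nonsing_inv_mul G (Ne.isUnit hG), and_self]
  exact Matrix.map_one _ (map_zero _) (map_one _)

/-- Constant row operations bring the linear column to that of `phi`. Equality of determinants up to
a constant, with coprimality of the two forms, determines the second column up to that constant and
a multiple of the first. -/
theorem IsPresentation.exists_phi (hℳ : IsGrading (K := K) ℳ) (h : IsPresentation ℳ A δ)
    (hA : IsMinimal A) (hδ : δ 0 = δ 1) (hlin : ∀ i, IsHomZ 1 (A i 0)) {c : K} (hc : c ≠ 0)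
    (hdet : A.det = C c * f4 K) : ∃ p : Datum K, IsPresentation ℳ (phi p) δ := by
  rw [Matrix.det_fin_two] at hdet
  obtain ⟨p, G, hG, e₀, e₁⟩ := exists_datum_of_mem hc (hlin 0) (hlin 1) (q₁ := A 1 1)
    (q₂ := -A 0 1) (hA 1 1) (by rw [map_neg, hA 0 1, neg_zero]) (by rw [← hdet]; ring)
  obtain ⟨hGG, hGG'⟩ := inv_map_C hG
  set U := G.map (C : K →+* MvPolynomial (Fin 4) K) with hU
  set U' := (G⁻¹).map (C : K →+* MvPolynomial (Fin 4) K) with hU'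
  have h1 : IsPresentation ℳ (U' * (U * A)) δ := by
    rwa [← Matrix.mul_assoc, hGG', Matrix.one_mul]
  have h2 : IsPresentation ℳ (U * A) δ := by
    refine h1.of_mul_left hℳ (fun i j => ?_) hGG' hGG
    refine (isHomZ_C _).congr ?_
    fin_cases i <;> fin_cases j <;> simp [hδ]
  refine ⟨p, ?_⟩
  set L₀ : MvPolynomial (Fin 4) K := X 0 - C p.a * X p.s with hL₀
  set L₁ : MvPolynomial (Fin 4) K := X p.i - C p.b * X p.j with hL₁
  have f0 : (U * A) 0 0 = L₀ := by
    rw [Matrix.mul_apply, Fin.sum_univ_two, e₀]; rfl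
  have f1 : (U * A) 1 0 = L₁ := by
    rw [Matrix.mul_apply, Fin.sum_univ_two, e₁]; rfl
  have hd : (U * A).det = C (G.det * c) * f4 K := by
    have : U.det = C G.det := (RingHom.map_det C G).symm
    rw [Matrix.det_mul, Matrix.det_fin_two A, hdet, this, map_mul, mul_assoc]
  have hphi := det_phi p
  have p0 : phi p 0 0 = L₀ := rfl
  have p1 : phi p 1 0 = L₁ := rfl
  rw [Matrix.det_fin_two, p0, p1] at hphi
  rw [Matrix.det_fin_two, f0, f1, ← hphi] at hd
  set c' := G.det * c with hc'
  have hc'0 : c' ≠ 0 := mul_ne_zero hG hc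
  have key : L₀ * ((U * A) 1 1 - C c' * phi p 1 1) = L₁ * ((U * A) 0 1 - C c' * phi p 0 1) := by
    linear_combination hd
  obtain ⟨m, hm⟩ := p.linear_dvd_of_dvd_mul ⟨_, key.symm⟩
  rw [← hL₀] at hm
  have hm' : (U * A) 1 1 - C c' * phi p 1 1 = L₁ * m := by
    refine mul_left_cancel₀ p.prime_linear.ne_zero ?_
    rw [← hL₀, key, hm]; ring
  have hcc : (C c' : MvPolynomial (Fin 4) K) * C c'⁻¹ = 1 := by
    rw [← map_mul, mul_inv_cancel₀ hc'0, map_one]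
  -- The column operation that scales the second column by `c'` and adds `m` times the first.
  refine h2.of_mul_right (B := phi p) (V := !![1, m; 0, C c'])
    (V' := !![1, -(m * C c'⁻¹); 0, C c'⁻¹]) ?_ ?_
  · ext1 i j
    rw [Matrix.mul_apply (M := phi p), Fin.sum_univ_two]
    fin_cases i <;> fin_cases j
    · simp [f0, p0]
    · simp [p0]; linear_combination hm
    · simp [f1, p1]
    · simp [p1]; linear_combination hm'
  · ext1 i j
    rw [Matrix.mul_apply (M := U * A), Fin.sum_univ_two]
    fin_cases i <;> fin_cases j
    · simp [f0, p0]
    · simp [f0]; linear_combination (-phi p 0 1) * hcc - C c'⁻¹ * hm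
    · simp [f1, p1]
    · simp [f1]; linear_combination (-phi p 1 1) * hcc - C c'⁻¹ * hm'

/-- The same argument with rows and columns exchanged. The last operation now changes generators, so
the multiplier `m` must also be shown to be a linear form. -/
theorem IsPresentation.exists_psi (hℳ : IsGrading (K := K) ℳ) (h : IsPresentation ℳ A δ)
    (hA : IsMinimal A) (hδ : δ 1 = δ 0 + 1) (hquad : ∀ j, IsHomZ 2 (A 0 j))
    (hlin : ∀ j, IsHomZ 1 (A 1 j)) {c : K} (hc : c ≠ 0)
    (hdet : A.det = C c * f4 K) : ∃ p : Datum K, IsPresentation ℳ (psi p) δ := by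
  rw [Matrix.det_fin_two] at hdet
  obtain ⟨p, G, hG, e₀, e₁⟩ := exists_datum_of_mem hc (hlin 1) (hlin 0) (q₁ := A 0 0)
    (q₂ := -A 0 1) (hA 0 0) (by rw [map_neg, hA 0 1, neg_zero]) (by rw [← hdet]; ring)
  refine ⟨p, ?_⟩
  set L₀ : MvPolynomial (Fin 4) K := X 0 - C p.a * X p.s with hL₀
  set L₁ : MvPolynomial (Fin 4) K := X p.i - C p.b * X p.j with hL₁
  -- Rearranged from `G` so that the second row of `A * V` becomes `(-L₁, L₀)`.
  let H : Matrix (Fin 2) (Fin 2) K := !![-G 1 1, G 0 1; -G 1 0, G 0 0]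
  have hH : H.det ≠ 0 := by
    rw [Matrix.det_fin_two] at hG
    rw [Matrix.det_fin_two_of]
    intro h0
    apply hG
    linear_combination -h0
  obtain ⟨hHH, hHH'⟩ := inv_map_C hH
  set V := H.map (C : K →+* MvPolynomial (Fin 4) K) with hV
  set V' := (H⁻¹).map (C : K →+* MvPolynomial (Fin 4) K) with hV'
  have h2 : IsPresentation ℳ (A * V) δ :=
    h.of_mul_right (V := V') (V' := V) (by rw [Matrix.mul_assoc, hHH, Matrix.mul_one]) rfl
  have f0 : (A * V) 1 0 = -L₁ := by
    rw [Matrix.mul_apply, Fin.sum_univ_two, e₁]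
    simp [V, H]; ring
  have f1 : (A * V) 1 1 = L₀ := by
    rw [Matrix.mul_apply, Fin.sum_univ_two, e₀]
    simp [V, H]; ring
  have hq : ∀ j, IsHomZ 2 ((A * V) 0 j) := fun j => by
    rw [Matrix.mul_apply]
    exact IsHomZ.sum _ fun i _ => ((hquad i).mul (isHomZ_C _)).congr (add_zero 2)
  have hd : (A * V).det = C (c * H.det) * f4 K := by
    have : V.det = C H.det := (RingHom.map_det C H).symm
    rw [Matrix.det_mul, Matrix.det_fin_two A, hdet, this, map_mul]
    ring
  have hpsi := det_psi p
  have p0 : psi p 1 0 = -L₁ := rfl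
  have p1 : psi p 1 1 = L₀ := rfl
  rw [Matrix.det_fin_two, p0, p1] at hpsi
  rw [Matrix.det_fin_two, f0, f1, ← hpsi] at hd
  set c' := c * H.det with hc'
  have hc'0 : c' ≠ 0 := mul_ne_zero hc hH
  have key : L₁ * ((A * V) 0 1 - C c' * psi p 0 1) = L₀ * -((A * V) 0 0 - C c' * psi p 0 0) := by
    linear_combination hd
  obtain ⟨m, hm⟩ := p.linear_dvd_of_dvd_mul ⟨_, key⟩
  rw [← hL₀] at hm
  have hm' : (A * V) 0 0 - C c' * psi p 0 0 = -(L₁ * m) := by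
    refine mul_left_cancel₀ p.prime_linear.ne_zero ?_
    rw [← hL₀]
    rw [hm] at key
    linear_combination key
  have hmhom : IsHomZ 1 m := by
    have h3 : IsHomZ 2 (L₀ * m) := by
      rw [← hm]
      exact (hq 1).sub (((isHomMat_psi p 0 1).congr (by simp)).C_mul c')
    have h4 : L₀ * hcomp 1 m = L₀ * m :=
      ((isHomZ_X_sub p.a 0 p.s).hcomp_mul 2 m).symm.trans h3.hcomp_eq
    rw [← mul_left_cancel₀ p.prime_linear.ne_zero h4]
    exact isHomZ_hcomp 1 m
  have hcc : (C c' : MvPolynomial (Fin 4) K) * C c'⁻¹ = 1 := by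
    rw [← map_mul, mul_inv_cancel₀ hc'0, map_one]
  have hAV : A * V = !![C c', m; 0, 1] * psi p := by
    ext1 i j
    rw [Matrix.mul_apply (N := psi p), Fin.sum_univ_two]
    fin_cases i <;> fin_cases j
    · simp [p0]; linear_combination hm'
    · simp [p1]; linear_combination hm
    · simp [f0, p0]
    · simp [f1, p1]
  rw [hAV] at h2
  refine h2.of_mul_left hℳ (U' := !![C c'⁻¹, -(m * C c'⁻¹); 0, 1]) ?_ ?_ ?_
  · intro i j
    fin_cases i <;> fin_cases j
    · exact (isHomZ_C c').congr (by simp)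
    · exact hmhom.congr (by simp [hδ])
    · exact IsHomZ.zero _
    · exact isHomZ_one.congr (by simp)
  · ext1 i j
    rw [Matrix.mul_apply, Fin.sum_univ_two]
    fin_cases i <;> fin_cases j
    · simpa using hcc
    · simp; linear_combination (-m) * hcc
    · simp
    · simp
  · ext1 i j
    rw [Matrix.mul_apply, Fin.sum_univ_two]
    fin_cases i <;> fin_cases j
    · simpa [mul_comm] using hcc
    · simp; ring
    · simp
    · simp

/-- The classification of the graded modules presented by a minimal matrix. -/
theorem IsPresentation.classification {ε : Fin 2 → ℤ} (hℳ : IsGrading (K := K) ℳ)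
    (h : IsPresentation ℳ A δ) (hhom : IsHomMat δ ε A) (hA : IsMinimal A)
    (hfree : ¬ Module.Free (R4 K) M) :
    ∃ p : Datum K, GradedIso (K := K) ℳ (phiGrading p) ∨ GradedIso (K := K) ℳ (psiGrading p) := by
  obtain ⟨c, hc, hdet⟩ := h.exists_det_eq hA hfree
  have hdet' := hdet
  rw [Matrix.det_fin_two] at hdet'
  -- A zero entry would make the determinant a product of two entries, up to sign, without constant
  -- terms.
  have hne : ∀ i j, A i j ≠ 0 := by
    intro i j h0
    fin_cases i <;> fin_cases j <;> dsimp only [Fin.zero_eta, Fin.mk_one] at h0 <;>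
      rw [h0] at hdet'
    · exact mul_ne_C_mul_f4 hc (x := -A 0 1) (by rw [map_neg, hA 0 1, neg_zero]) (hA 1 0)
        (by linear_combination hdet')
    · exact mul_ne_C_mul_f4 hc (hA 0 0) (hA 1 1) (by linear_combination hdet')
    · exact mul_ne_C_mul_f4 hc (hA 0 0) (hA 1 1) (by linear_combination hdet')
    · exact mul_ne_C_mul_f4 hc (x := -A 0 1) (by rw [map_neg, hA 0 1, neg_zero]) (hA 1 0)
        (by linear_combination hdet')
  have hpos : ∀ i j, 0 < ε j - δ i := fun i j => (hhom i j).pos (hne i j) (hA i j)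
  have hdeg : ε 0 - δ 0 + (ε 1 - δ 1) = 3 := by
    have h1 : IsHomZ (ε 0 - δ 0 + (ε 1 - δ 1)) A.det := by
      rw [Matrix.det_fin_two]
      exact ((hhom 0 0).mul (hhom 1 1)).sub (((hhom 0 1).mul (hhom 1 0)).congr (by ring))
    have h2 : IsHomZ 3 A.det := by
      rw [hdet]; exact isHomZ_f4.C_mul c
    refine h1.unique h2 ?_
    rw [hdet]
    exact mul_ne_zero ((map_ne_zero_iff _ (C_injective _ _)).2 hc) (prime_f4 K).ne_zero
  have p00 := hpos 0 0
  have p01 := hpos 0 1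
  have p10 := hpos 1 0
  have p11 := hpos 1 1
  have hphi : ∀ p : Datum K, δ 0 = δ 1 → IsPresentation ℳ (phi p) δ →
      GradedIso (K := K) ℳ (phiGrading p) := fun p hδ hp => by
    have h1 : δ = fun i => (![0, 0] : Fin 2 → ℤ) i + δ 0 := by
      ext i; fin_cases i <;> simp [hδ]
    rw [h1] at hp
    exact hp.gradedIso hℳ (isHomMat_phi p)
  have hpsi : ∀ (δ : Fin 2 → ℤ) (p : Datum K), δ 1 = δ 0 + 1 → IsPresentation ℳ (psi p) δ →
      GradedIso (K := K) ℳ (psiGrading p) := fun δ p hδ hp => by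
    have h1 : δ = fun i => (![0, 1] : Fin 2 → ℤ) i + δ 0 := by
      ext i; fin_cases i <;> simp [hδ, add_comm]
    rw [h1] at hp
    exact hp.gradedIso hℳ (isHomMat_psi p)
  -- Both diagonals have positive degrees with sum 3. The degrees of the first row decide the shape:
  -- equal degrees put the linear entries in a row (`psi`), unequal degrees in a column (`phi`).
  have hcase : (ε 0 - δ 0 = 1 ∨ ε 0 - δ 0 = 2) ∧ (ε 1 - δ 0 = 1 ∨ ε 1 - δ 0 = 2) := by omega
  let σ : Matrix (Fin 2) (Fin 2) (MvPolynomial (Fin 4) K) := !![0, 1; 1, 0]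
  have hσ : σ * σ = 1 := by
    ext1 i j
    rw [Matrix.mul_apply, Fin.sum_univ_two]
    fin_cases i <;> fin_cases j <;> simp [σ]
  obtain ⟨h00 | h00, h01 | h01⟩ := hcase
  · have hσA : ∀ j, (σ * A) 0 j = A 1 j ∧ (σ * A) 1 j = A 0 j := fun j => by
      simp [Matrix.mul_apply, Fin.sum_univ_two, σ]
    have h1 : IsPresentation ℳ (σ * A) ![δ 1, δ 0] := by
      have h2 : IsPresentation ℳ (σ * (σ * A)) δ := by
        rwa [← Matrix.mul_assoc, hσ, Matrix.one_mul]
      refine h2.of_mul_left hℳ (fun i j => ?_) hσ hσ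
      fin_cases i <;> fin_cases j
      · exact IsHomZ.zero _
      · exact isHomZ_one.congr (by simp)
      · exact isHomZ_one.congr (by simp)
      · exact IsHomZ.zero _
    obtain ⟨p, hp⟩ := h1.exists_psi hℳ
      (fun i j => by
        fin_cases i
        · exact ((congrArg _ (hσA j).1).trans (hA 1 j))
        · exact ((congrArg _ (hσA j).2).trans (hA 0 j)))
      (by simp; omega)
      (fun j => by
        rw [(hσA j).1]
        refine (hhom 1 j).congr ?_
        fin_cases j <;> simp <;> omega)
      (fun j => by
        rw [(hσA j).2]
        refine (hhom 0 j).congr ?_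
        fin_cases j <;> simp <;> omega)
      (neg_ne_zero.2 hc)
      (by rw [Matrix.det_mul, hdet, Matrix.det_fin_two_of, map_neg]; ring)
    exact ⟨p, Or.inr (hpsi _ p (by simp; omega) hp)⟩
  · obtain ⟨p, hp⟩ := h.exists_phi hℳ hA (by omega)
      (fun i => (hhom i 0).congr (by fin_cases i <;> simp <;> omega)) hc hdet
    exact ⟨p, Or.inl (hphi p (by omega) hp)⟩
  · have hAσ : ∀ i, (A * σ) i 0 = A i 1 ∧ (A * σ) i 1 = A i 0 := fun i => by
      simp [Matrix.mul_apply, Fin.sum_univ_two, σ]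
    have h1 : IsPresentation ℳ (A * σ) δ :=
      h.of_mul_right (V := σ) (V' := σ) (by rw [Matrix.mul_assoc, hσ, Matrix.mul_one]) rfl
    obtain ⟨p, hp⟩ := h1.exists_phi hℳ
      (fun i j => by
        fin_cases j
        · exact ((congrArg _ (hAσ i).1).trans (hA i 1))
        · exact ((congrArg _ (hAσ i).2).trans (hA i 0)))
      (by omega)
      (fun i => by
        rw [(hAσ i).1]
        refine (hhom i 1).congr ?_
        fin_cases i <;> simp <;> omega)
      (neg_ne_zero.2 hc)
      (by rw [Matrix.det_mul, hdet, Matrix.det_fin_two_of, map_neg]; ring)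
    exact ⟨p, Or.inl (hphi p (by omega) hp)⟩
  · obtain ⟨p, hp⟩ := h.exists_psi hℳ hA (by omega)
      (fun j => (hhom 0 j).congr (by fin_cases j <;> simp <;> omega))
      (fun j => (hhom 1 j).congr (by fin_cases j <;> simp <;> omega)) hc hdet
    exact ⟨p, Or.inr (hpsi _ p (by omega) hp)⟩

end Classification

end FermatCubic

open FermatCubic in
theorem mainTheorem1 {K : Type*} [Field K] [IsAlgClosed K] [CharZero K] :
    -- matrix factorizations
    (∀ p : Datum K,
      phi p * psi p = f4 K • (1 : Matrix (Fin 2) (Fin 2) (MvPolynomial (Fin 4) K)) ∧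
      psi p * phi p = f4 K • (1 : Matrix (Fin 2) (Fin 2) (MvPolynomial (Fin 4) K))) ∧
    -- the cokernels are two-generated, non-free, graded MCM modules
    (∀ p : Datum K,
      (IsGradedMCM (K := K) (phiGrading p) ∧
        (⊤ : Submodule (R4 K) (Coker (phi p))).spanFinrank = 2 ∧
        ¬ Module.Free (R4 K) (Coker (phi p))) ∧
      (IsGradedMCM (K := K) (psiGrading p) ∧
        (⊤ : Submodule (R4 K) (Coker (psi p))).spanFinrank = 2 ∧
        ¬ Module.Free (R4 K) (Coker (psi p)))) ∧
    -- every two-generated, non-free, graded MCM module is one of these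
    (∀ (M : Type*) [AddCommGroup M] [Module (R4 K) M] (ℳ : ℤ → AddSubgroup M),
      IsGradedMCM (K := K) ℳ → (⊤ : Submodule (R4 K) M).spanFinrank = 2 →
      ¬ Module.Free (R4 K) M →
      ∃ p : Datum K,
        GradedIso (K := K) ℳ (phiGrading p) ∨ GradedIso (K := K) ℳ (psiGrading p)) ∧
    -- pairwise non-isomorphic, even without gradings
    (∀ p q : Datum K, p ≠ q →
      IsEmpty (Coker (phi p) ≃ₗ[R4 K] Coker (phi q)) ∧
      IsEmpty (Coker (psi p) ≃ₗ[R4 K] Coker (psi q)) ∧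
      fittingIdeal ((phi p).map (toR4 K)) 1 ≠ fittingIdeal ((phi q).map (toR4 K)) 1 ∧
      fittingIdeal ((psi p).map (toR4 K)) 1 ≠ fittingIdeal ((psi q).map (toR4 K)) 1) ∧
    (∀ p q : Datum K, IsEmpty (Coker (phi p) ≃ₗ[R4 K] Coker (psi q))) ∧
    -- syzygies and duals
    (∀ p : Datum K,
      IsFirstSyzygy (K := K) (phiGrading p) (psiGrading p) ∧
      GradedIso (K := K) (dualGrading (K := K) (psiGrading p)) (phiGrading p)) ∧
    -- rank one
    (∀ p : Datum K,
      Module.rank (R4 K) (Coker (phi p)) = 1 ∧ Module.rank (R4 K) (Coker (psi p)) = 1) := by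
  refine ⟨fun p => isMF_phi_psi p, fun p => ⟨⟨?_, ?_, ?_⟩, ?_, ?_, ?_⟩, ?_, fun p q hpq => ?_,
    isEmpty_coker_phi_equiv_coker_psi, fun p => ⟨isFirstSyzygy_phi_psi p, gradedIso_dual_psi_phi p⟩,
    fun p => ⟨rank_coker_phi p, rank_coker_psi p⟩⟩
  · exact (isMF_phi_psi p).isGradedMCM (isMinimal_phi p) (isHomMat_phi p)
  · exact (isMinimal_phi p).spanFinrank_coker
  · exact (isMinimal_phi p).not_free (rank_coker_phi p)
  · exact (isMF_phi_psi p).symm.isGradedMCM (isMinimal_psi p) (isHomMat_psi p)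
  · exact (isMinimal_psi p).spanFinrank_coker
  · exact (isMinimal_psi p).not_free (rank_coker_psi p)
  · intro M _ _ ℳ h hrank hfree
    obtain ⟨δ, ε, A, hpres, hhom, hA⟩ := h.exists_isPresentation hrank
    exact hpres.classification h.isGrading hhom hA hfree
  · exact ⟨⟨fun e => hpq (eq_of_coker_phi_equiv e)⟩, ⟨fun e => hpq (eq_of_coker_psi_equiv e)⟩,
      fun h => hpq (eq_of_fittingIdeal_phi h), fun h => hpq (eq_of_fittingIdeal_psi h)⟩
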